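/- Identify $S^1$ with $[0,2\pi]/\{0\sim 2\pi\}$. For a measure $\sigma$ on $S^1$ put $L(\sigma)=\frac12\int_{S^1}\nu'(\theta)^2\,d\theta$ if $d\sigma=\nu(\theta)^2d\theta$ with $\nu\ge 0$, $\nu\in W^{1,2}(S^1)$, and $L(\sigma)=\infty$ otherwise; for a measurable family $\rho=(\rho_t)$ of measures on $S^1$ put $S_{[0,1]}(\rho)=\int_0^1L(\rho_t)\,dt$. If $\int_0^1\rho_t(S^1)\,dt<\infty$, a *Loewner chain driven by $\rho$* on $[0,1]$ is a family of injective holomorphic maps $f_t:\mathbb D\to D_t$ onto domains $D_t\subset\mathbb D$ decreasing in $t$, with $f_t(0)=0$, $f_t'(0)>0$, $f_0(z)=z$, such that $t\mapsto f_t(z)$ is absolutely continuous for each $z\in\mathbb D$ and, for a.e. $t\in[0,1]$, $$\partial_tf_t(z)=-z\,f_t'(z)\int_{S^1}\frac{e^{i\theta}+z}{e^{i\theta}-z}\,d\rho_t(\theta)\qquad\text{for all }z\in\mathbb D.$$ Its hulls are $K_t=\overline{\mathbb D}\setminus D_t$ and its uniformizing maps are $g_t=f_t^{-1}:D_t\to\mathbb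 D$. **Theorem (Conformal distortion).** Let $\rho=(\rho_t)$ be a measurable family of probability measures on $S^1$ with $S_{[0,1]}(\rho)<\infty$, with Loewner chain $(f_t)$, uniformizing maps $g_t$ and hulls $K_t$, $t\in[0,1]$. Let $U\supset K_1$ and $\tilde U$ be relatively open subsets of $\overline{\mathbb D}$, and let $\psi:U\to\tilde U$ be a homeomorphism that is holomorphic in $U\cap\mathbb D$. Let $\tilde\rho=(\tilde\rho_t)$ be a measurable family of measures on $S^1$ with $\int_0^1\tilde\rho_t(S^1)\,dt<\infty$ that generates the image hulls, that is, it drives a Loewner chain $(\tilde f_t)$ with hulls $\tilde K_t=\psi(K_t)$ for all $t\in[0,1]$; write $\tilde g_t=\tilde f_t^{-1}$. Then: 1. for every $t\in[0,1]$ the map $\psi_t=\tilde g_t\circ\psi\circ g_t^{-1}$, defined on $g_t(U\setminus K_t)$, extends holomorphically to a neighborhood of the unit circle, with non-vanishing derivative on the circle; 2. for a.e. $t\in[0,1]$, $L(\rho_t)$ and $L(\tilde\rho_t)$ are finite and $$L(\tilde\rho_t)-L(\rho_t)=\frac14\int_{S^1}e^{2i\theta}\,\mathcal S\psi_t(e^{i\theta})\,d\rho_t(\theta)+\frac18\bigl(|\tilde\rho_t|-|\rho_t|\bigr),$$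 where $\mathcal S\psi=(\psi''/\psi')'-\frac12(\psi''/\psi')^2$ is the Schwarzian derivative and $|\sigma|=\sigma(S^1)$; 3. $S_{[0,1]}(\tilde\rho)<\infty$, the function $t\mapsto\int_{S^1}e^{2i\theta}\mathcal S\psi_t(e^{i\theta})\,d\rho_t(\theta)$ is integrable on $[0,1]$, and $$S_{[0,1]}(\tilde\rho)-S_{[0,1]}(\rho)=\frac14\int_0^1\int_{S^1}e^{2i\theta}\,\mathcal S\psi_t(e^{i\theta})\,d\rho_t(\theta)\,dt+\frac18\bigl(\log\tilde g_1'(0)-\log g_1'(0)\bigr).$$ -/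

import Mathlib

open Set MeasureTheory ProbabilityTheory Metric
open scoped ENNReal

noncomputable section

namespace LoewnerKufarev

/-- The unit circle `S¹` in the angular coordinate, that is, `[0, 2π]` with `0` and `2π`
identified. Its volume is Lebesgue measure `dθ`, of total mass `2π`. -/
abbrev S1 : Type := AddCircle (2 * Real.pi)

instance factTwoPiPos : Fact (0 < 2 * Real.pi) := ⟨Real.two_pi_pos⟩

/-- The point `e^{iθ}` of the complex plane. -/
def expI (θ : S1) : ℂ := (AddCircle.toCircle θ : ℂ)

theorem expI_coe (x : ℝ) : expI (x : S1) = Complex.exp (x * Complex.I) := by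
  have h : 2 * Real.pi / (2 * Real.pi) * x = x := by
    rw [div_self Real.two_pi_pos.ne', one_mul]
  rw [expI, AddCircle.toCircle_apply_mk, h, Circle.coe_exp]

/-- `ν` is the square-root density of the measure `σ` on `S¹`: a non-negative function in
`W^{1,2}(S¹)` (represented by its absolutely continuous representative, whose a.e. derivative is
square integrable) with `dσ(θ) = ν(θ)² dθ`. -/
structure IsSqrtDensity (σ : Measure S1) (ν : S1 → ℝ) : Prop where
  nonneg : ∀ θ, 0 ≤ ν θ
  absCont : AbsolutelyContinuousOnInterval (fun x : ℝ => ν x) 0 (2 * Real.pi)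
  sqIntegrable : MemLp (deriv fun x : ℝ => ν x) 2 (volume.restrict (Ioc 0 (2 * Real.pi)))
  density : σ = volume.withDensity (fun θ => ENNReal.ofReal (ν θ ^ 2))

/-- `L(σ) = ½ ∫ ν'(θ)² dθ` if `dσ = ν² dθ` with `ν ≥ 0` in `W^{1,2}(S¹)`, and `∞` otherwise.
The function `ν` is determined by `σ`, so the infimum is over at most one function; over none
it is `∞`. -/
def localEnergy (σ : Measure S1) : ℝ≥0∞ :=
  ⨅ (ν : S1 → ℝ) (_ : IsSqrtDensity σ ν),
    2⁻¹ * ∫⁻ x in Ioc 0 (2 * Real.pi), ENNReal.ofReal (deriv (fun y : ℝ => ν y) x ^ 2)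

/-- The Loewner-Kufarev energy on `[0,1]` of the measure `ρ_t(dθ) dt`:
`S_{[0,1]}(ρ) = ∫₀¹ L(ρ_t) dt`. -/
def energy (ρ : Kernel ℝ S1) : ℝ≥0∞ :=
  ∫⁻ t in Icc (0 : ℝ) 1, localEnergy (ρ t)

/-- The Herglotz integral `H[σ](z) = ∫ (e^{iθ} + z) / (e^{iθ} - z) dσ(θ)`. -/
def herglotz (σ : Measure S1) (z : ℂ) : ℂ :=
  ∫ θ : S1, (expI θ + z) / (expI θ - z) ∂σ

/-- `(f_t)`, `0 ≤ t ≤ 1`, is the Loewner chain in the unit disk driven by `ρ_t(dθ) dt`: conformal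
maps `f_t` of the unit disk onto decreasing domains `D_t = f_t(𝔻)`, with `f_t(0) = 0`,
`f_t'(0) > 0` and `f_0(z) = z`, solving the Loewner-Kufarev equation
`∂_t f_t(z) = - z f_t'(z) H[ρ_t](z)` in the sense that `t ↦ f_t(z)` is absolutely continuous and
the equation holds for all `z` outside one null set of times. -/
structure IsLoewnerChain (ρ : Kernel ℝ S1) (f : ℝ → ℂ → ℂ) : Prop where
  holomorphic : ∀ t ∈ Icc (0 : ℝ) 1, DifferentiableOn ℂ (f t) (ball 0 1)
  injective : ∀ t ∈ Icc (0 : ℝ) 1, InjOn (f t) (ball 0 1)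
  map_zero : ∀ t ∈ Icc (0 : ℝ) 1, f t 0 = 0
  deriv_zero_pos : ∀ t ∈ Icc (0 : ℝ) 1, 0 < (deriv (f t) 0).re ∧ (deriv (f t) 0).im = 0
  initial : ∀ z ∈ ball (0 : ℂ) 1, f 0 z = z
  decreasing : AntitoneOn (fun t => f t '' ball 0 1) (Icc (0 : ℝ) 1)
  absCont : ∀ z ∈ ball (0 : ℂ) 1, AbsolutelyContinuousOnInterval (fun t => f t z) 0 1
  equation : ∀ᵐ t ∂(volume.restrict (Icc (0 : ℝ) 1)), ∀ z ∈ ball (0 : ℂ) 1,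
    HasDerivAt (fun s => f s z) (-z * deriv (f t) z * herglotz (ρ t) z) t

/-- The hull `K_t`, the complement of `D_t = f_t(𝔻)` in the closed unit disk. -/
def hull (f : ℝ → ℂ → ℂ) (t : ℝ) : Set ℂ := closedBall 0 1 \ f t '' ball 0 1

/-- The uniformizing map `g_t = f_t⁻¹ : D_t → 𝔻`. -/
def uniformizing (f : ℝ → ℂ → ℂ) (t : ℝ) : ℂ → ℂ := Function.invFunOn (f t) (ball 0 1)

/-- `ψ` is a conformal map of `U` onto `U'`, both relatively open subsets of the closed unit disk:
a homeomorphism of `U` onto `U'` that is holomorphic on the part of `U` in the open disk. -/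
structure IsConformalMap (ψ : ℂ → ℂ) (U U' : Set ℂ) : Prop where
  source_open : ∃ V : Set ℂ, IsOpen V ∧ U = V ∩ closedBall 0 1
  target_open : ∃ V : Set ℂ, IsOpen V ∧ U' = V ∩ closedBall 0 1
  bijective : BijOn ψ U U'
  continuous : ContinuousOn ψ U
  continuous_inv : ContinuousOn (Function.invFunOn ψ U) U'
  holomorphic : DifferentiableOn ℂ ψ (U ∩ ball 0 1)

/-- The Schwarzian derivative `𝒮f = (f''/f')' - (f''/f')²/2`. -/
def schwarzian (f : ℂ → ℂ) (z : ℂ) : ℂ :=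
  deriv (fun w => deriv (deriv f) w / deriv f w) z - (deriv (deriv f) z / deriv f z) ^ 2 / 2

/-- `∫ e^{2iθ} 𝒮F(e^{iθ}) dσ(θ)`. -/
def schwarzianIntegral (F : ℂ → ℂ) (σ : Measure S1) : ℂ :=
  ∫ θ : S1, expI θ ^ 2 * schwarzian F (expI θ) ∂σ

/-- `Ψ` is the holomorphic extension to a neighbourhood of the unit circle of the conformal map
`ψ_t = g'_t ∘ ψ ∘ g_t⁻¹`, which is defined on `g_t(U \ K_t) = {z ∈ 𝔻 | f_t(z) ∈ U}`. It is unique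
near the circle, and it is conformal there. -/
structure IsConjugatedExtension (f f' : ℝ → ℂ → ℂ) (ψ : ℂ → ℂ) (U : Set ℂ) (t : ℝ)
    (Ψ : ℂ → ℂ) : Prop where
  eqOn : ∀ z ∈ ball (0 : ℂ) 1, f t z ∈ U → Ψ z = uniformizing f' t (ψ (f t z))
  analytic : AnalyticOnNhd ℂ Ψ (sphere 0 1)
  deriv_ne_zero : ∀ z ∈ sphere (0 : ℂ) 1, deriv Ψ z ≠ 0

end LoewnerKufarev

end

/-! Write ψ_t = g'_t ∘ ψ ∘ f_t for the conjugated map, where primes on f, g, ρ denote the image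
chain. It is defined on an annulus r < |z| < 1 with r independent of t, and |ψ_t| → 1 at the unit
circle, because the hulls correspond under ψ (`exists_radius`, `norm_conjMap_tendsto`). Schwarz
reflection therefore extends ψ_t across the circle. The extension is given by an explicit Cauchy
integral over the circles |w| = a and |w| = 1/a (`reflectExt`), so regularity in t that is known
strictly inside the disk carries over to the unit circle. On the circle the extension E is a
diffeomorphism with angular derivative q = zE'/E > 0 (`IsCircleMap.deriv_ne_zero`,
`angularDeriv_re_pos`, `injOn_sphere`, `exists_lift`).

At almost every t the two Loewner equations give ∂_t ψ_t = ψ_t H[ρ'_t](ψ_t) − z ψ_t' H[ρ_t]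
(`hasDerivAt_conjMap`). Dividing by ψ_t, the function H[ρ'_t](ψ_t) − q H[ρ_t] extends continuously
to the circle, and its real part vanishes there because |ψ_t| = 1 for all times. When dρ_t = ν² dθ,
the boundary values of Re H[ρ_t] are 2πν², so those of Re H[ρ'_t] at ψ_t(e^{iθ}) are 2πqν². Hence
ρ'_t has the density ν'² with ν'∘φ = √q ν, where φ is the angular lift of E
(`eq_withDensity_transport`).

What remains at a fixed time is calculus. With p = (log q)', expanding ∫(ν + …)'² in the new angle
and integrating by parts over a period gives the change −½∫ν²(p' − p²/2) of the Dirichlet integral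
(`IsCircleLift.transport`). On the circle e^{2iθ}𝒮E = ½ − q²/2 − (p' − p²/2) (`sq_mul_schwarzian`),
and ∫ν²q² is the mass of ρ'_t. This yields the pointwise formula, with the mass difference coming
from ½ − q²/2.

Integration over time uses log g_1'(0) = ∫|ρ_t| dt (`log_deriv_uniformizing_zero`) and joint
continuity of the Schwarzian in (t, θ). Since the local energy is an infimum, its measurability in t
is not available, and a finite lower integral does not by itself give finiteness almost everywhere.
A measurable Fourier-side quantity, bounded by a multiple of the local energy and finite only when
it is finite, replaces it (`ae_localEnergy_ne_top`), and the integrated identity is arranged so that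
no measurability of the energies is needed (`lintegral_toReal_sub`). -/

namespace LoewnerKufarev

open Filter Topology ComplexConjugate

/-! ### Injective holomorphic maps and their inverses -/

section InjectiveHolomorphic

variable {f : ℂ → ℂ} {V : Set ℂ}

/-- A holomorphic map is either locally constant or open at a point, and injectivity rules out the
first case. -/
theorem nhds_le_map_of_injOn (hV : IsOpen V) (hf : DifferentiableOn ℂ f V) (hi : InjOn f V)
    {z : ℂ} (hz : z ∈ V) : 𝓝 (f z) ≤ map f (𝓝 z) := by
  have hVz : V ∈ 𝓝 z := hV.mem_nhds hz
  refine ((hf.analyticAt hVz).eventually_constant_or_nhds_le_map_nhds).resolve_left fun h => ?_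
  have h1 : ∀ᶠ y in 𝓝[≠] z, f y = f z ∧ y ∈ V :=
    nhdsWithin_le_nhds (h.and hVz)
  obtain ⟨y, ⟨hy, hyV⟩, hne⟩ := (h1.and self_mem_nhdsWithin).exists
  exact hne (hi hyV hz hy)

theorem isOpen_image_of_injOn (hV : IsOpen V) (hf : DifferentiableOn ℂ f V) (hi : InjOn f V)
    {s : Set ℂ} (hs : IsOpen s) (hsV : s ⊆ V) : IsOpen (f '' s) := by
  rw [isOpen_iff_mem_nhds]
  rintro _ ⟨z, hz, rfl⟩
  exact nhds_le_map_of_injOn hV hf hi (hsV hz) (image_mem_map (hs.mem_nhds hz))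

theorem continuousAt_invFunOn (hV : IsOpen V) (hf : DifferentiableOn ℂ f V) (hi : InjOn f V)
    {z : ℂ} (hz : z ∈ V) : ContinuousAt (Function.invFunOn f V) (f z) := by
  have hl := hi.leftInvOn_invFunOn
  rw [ContinuousAt, hl hz]
  intro N hN
  have h1 : f '' (N ∩ V) ∈ 𝓝 (f z) :=
    nhds_le_map_of_injOn hV hf hi hz (image_mem_map (inter_mem hN (hV.mem_nhds hz)))
  refine mem_map.2 (mem_of_superset h1 ?_)
  rintro _ ⟨y, hy, rfl⟩
  rw [mem_preimage, hl hy.2]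
  exact hy.1

theorem hasDerivAt_invFunOn_of_ne (hV : IsOpen V) (hf : DifferentiableOn ℂ f V)
    (hi : InjOn f V) {z : ℂ} (hz : z ∈ V) (h0 : deriv f z ≠ 0) :
    HasDerivAt (Function.invFunOn f V) (deriv f z)⁻¹ (f z) := by
  have hl := hi.leftInvOn_invFunOn
  refine HasDerivAt.of_local_left_inverse (f := f) (continuousAt_invFunOn hV hf hi hz) ?_ h0 ?_
  · rw [hl hz]
    exact (hf.differentiableAt (hV.mem_nhds hz)).hasDerivAt
  · have h1 : f '' V ∈ 𝓝 (f z) :=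
      (isOpen_image_of_injOn hV hf hi hV subset_rfl).mem_nhds (mem_image_of_mem f hz)
    filter_upwards [h1]
    rintro _ ⟨y, hy, rfl⟩
    rw [hl hy]

/-- Zeros of f' are isolated, so the inverse g is holomorphic near f(z) except possibly at f(z),
where it is continuous. The singularity is removable, and the chain rule for g ∘ f = id gives
g'(f(z)) f'(z) = 1. -/
theorem deriv_ne_zero_of_injOn (hV : IsOpen V) (hf : DifferentiableOn ℂ f V) (hi : InjOn f V)
    {z : ℂ} (hz : z ∈ V) : deriv f z ≠ 0 := by
  intro h0
  have hVz : V ∈ 𝓝 z := hV.mem_nhds hz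
  have hl := hi.leftInvOn_invFunOn
  set g := Function.invFunOn f V with hg
  have hfz := (hf.differentiableAt hVz)
  -- Otherwise f' vanishes near z, and f is constant on a ball, against injectivity.
  have hne : ∀ᶠ y in 𝓝[≠] z, deriv f y ≠ 0 := by
    refine (hf.analyticAt hVz).deriv.eventually_eq_zero_or_eventually_ne_zero.resolve_left
      fun h => ?_
    obtain ⟨ε, hε, hb⟩ := Metric.mem_nhds_iff.1 (h.and hVz)
    have hc : ∀ y ∈ ball z ε, f y = f z := fun y hy => by
      refine (convex_ball z ε).is_const_of_fderivWithin_eq_zero (𝕜 := ℂ)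
        (hf.mono fun x hx => (hb hx).2) (fun x hx => ?_) hy (mem_ball_self hε)
      rw [fderivWithin_of_isOpen isOpen_ball hx]
      ext
      simpa using (hb hx).1
    have h1 : ∀ᶠ y in 𝓝[≠] z, f y = f z ∧ y ∈ V :=
      nhdsWithin_le_nhds ((Filter.eventually_of_mem (ball_mem_nhds z hε) hc).and hVz)
    obtain ⟨y, ⟨hy, hyV⟩, hne⟩ := (h1.and self_mem_nhdsWithin).exists
    exact hne (hi hyV hz hy)
  have hgc : ContinuousAt g (f z) := continuousAt_invFunOn hV hf hi hz
  have hpunct : ∀ᶠ w in 𝓝[≠] (f z), DifferentiableAt ℂ g w := by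
    have hV' : ∀ᶠ w in 𝓝[≠] (f z), w ∈ f '' V := nhdsWithin_le_nhds
      ((isOpen_image_of_injOn hV hf hi hV subset_rfl).mem_nhds (mem_image_of_mem f hz))
    have hne' : ∀ᶠ y in 𝓝 z, y ≠ z → deriv f y ≠ 0 := eventually_nhdsWithin_iff.1 hne
    have h2 : ∀ᶠ w in 𝓝 (f z), g w ≠ z → deriv f (g w) ≠ 0 := by
      refine hgc.eventually (p := fun y => y ≠ z → deriv f y ≠ 0) ?_
      rw [hl hz]
      exact hne'
    filter_upwards [hV', nhdsWithin_le_nhds h2, self_mem_nhdsWithin]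
    rintro _ ⟨y, hy, rfl⟩ h3 h4
    rw [hl hy] at h3
    exact (hasDerivAt_invFunOn_of_ne hV hf hi hy
      (h3 fun h => h4 (by rw [h]; rfl))).differentiableAt
  have hga := Complex.analyticAt_of_differentiable_on_punctured_nhds_of_continuousAt hpunct hgc
  have hcomp : HasDerivAt (g ∘ f) (deriv g (f z) * deriv f z) z :=
    hga.differentiableAt.hasDerivAt.comp z hfz.hasDerivAt
  have hid : HasDerivAt (g ∘ f) 1 z :=
    (hasDerivAt_id z).congr_of_eventuallyEq (by filter_upwards [hVz] with y hy using hl hy)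
  have := hcomp.unique hid
  rw [h0, mul_zero] at this
  exact zero_ne_one this

theorem differentiableOn_invFunOn (hV : IsOpen V) (hf : DifferentiableOn ℂ f V)
    (hi : InjOn f V) : DifferentiableOn ℂ (Function.invFunOn f V) (f '' V) := by
  rintro _ ⟨z, hz, rfl⟩
  exact (hasDerivAt_invFunOn_of_ne hV hf hi hz
    (deriv_ne_zero_of_injOn hV hf hi hz)).differentiableAt.differentiableWithinAt

/-- Properness of a conformal map onto its image: the images of smaller concentric disks form an
increasing open cover of M. This turns compactness in the image domain into a radius that is close
to the circle. -/
theorem exists_radius_of_isCompact_subset_image (hf : DifferentiableOn ℂ f (ball 0 1))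
    (hi : InjOn f (ball 0 1)) {M : Set ℂ} (hM : IsCompact M) (hMf : M ⊆ f '' ball 0 1) :
    ∃ s ∈ Ioo (0 : ℝ) 1, ∀ z ∈ ball (0 : ℂ) 1, f z ∈ M → ‖z‖ < s := by
  have hsub : ∀ s : Ioo (0 : ℝ) 1, ball (0 : ℂ) s ⊆ ball 0 1 := fun s => ball_subset_ball s.2.2.le
  have : Nonempty (Ioo (0 : ℝ) 1) := ⟨⟨1 / 2, by norm_num, by norm_num⟩⟩
  obtain ⟨s, hs⟩ := hM.elim_directed_cover (fun s : Ioo (0 : ℝ) 1 => f '' ball 0 s)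
    (fun s => isOpen_image_of_injOn isOpen_ball hf hi isOpen_ball (hsub s))
    (by
      intro w hw
      obtain ⟨z, hz, rfl⟩ := hMf hw
      rw [mem_ball_zero_iff] at hz
      obtain ⟨s, hs1, hs2⟩ := exists_between hz
      exact mem_iUnion.2 ⟨⟨s, (norm_nonneg z).trans_lt hs1, hs2⟩, z, by simpa using hs1, rfl⟩)
    (by
      intro s t
      rcases le_total s t with h | h
      · exact ⟨t, image_mono (ball_subset_ball h), subset_rfl⟩
      · exact ⟨s, subset_rfl, image_mono (ball_subset_ball h)⟩)
  refine ⟨s, s.2, fun z hz hzM => ?_⟩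
  obtain ⟨y, hy, hyz⟩ := hs hzM
  rw [← hi (hsub s hy) hz hyz]
  simpa using hy

end InjectiveHolomorphic

end LoewnerKufarev

/-! ### Cauchy's formula on annuli and Schwarz reflection -/

namespace LoewnerKufarev

open Filter Topology ComplexConjugate

/-- The open annulus `{z | a < |z| < b}`. -/
def annulus (a b : ℝ) : Set ℂ := {z | a < ‖z‖ ∧ ‖z‖ < b}

theorem isOpen_annulus (a b : ℝ) : IsOpen (annulus a b) :=
  (isOpen_lt continuous_const continuous_norm).inter (isOpen_lt continuous_norm continuous_const)

section CauchyAnnulus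

variable {F : ℂ → ℂ} {r R a b : ℝ} {z : ℂ}

theorem circleIntegral_eq_of_differentiableOn_annulus (hF : DifferentiableOn ℂ F (annulus r R))
    (hr : r < a) (ha : 0 < a) (hab : a ≤ b) (hR : b < R) :
    (∮ w in C(0, b), F w) = ∮ w in C(0, a), F w := by
  have hsub : closedBall (0 : ℂ) b \ ball 0 a ⊆ annulus r R := fun w hw => by
    simp only [Set.mem_sdiff, mem_closedBall_zero_iff, mem_ball_zero_iff, not_lt] at hw
    exact ⟨hr.trans_le hw.2, hw.1.trans_lt hR⟩
  refine Complex.circleIntegral_eq_of_differentiable_on_annulus_off_countable ha hab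
    countable_empty (hF.continuousOn.mono hsub) fun w hw => ?_
  exact hF.differentiableAt ((isOpen_annulus r R).mem_nhds
    (hsub ⟨ball_subset_closedBall hw.1.1, fun h => hw.1.2 (ball_subset_closedBall h)⟩))

theorem circleIntegrable_cauchy {F : ℂ → ℂ} {s : ℝ} (hs : 0 ≤ s)
    (hF : ContinuousOn F (sphere 0 s)) (hz : ‖z‖ ≠ s) :
    CircleIntegrable (fun w => (w - z)⁻¹ • F w) 0 s := by
  refine ContinuousOn.circleIntegrable hs ?_
  have h1 : ContinuousOn (fun w : ℂ => w - z) (sphere 0 s) := by fun_prop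
  refine ContinuousOn.smul (h1.inv₀ fun w hw h => hz ?_) hF
  rw [sub_eq_zero] at h
  rw [← h]; simpa using hw

/-- The difference quotient `dslope F z` is holomorphic on the annulus, so its integrals over the
two circles agree. Separating the term F(z)/(w − z) leaves 2πi on the outer circle and 0 on the
inner one. -/
theorem cauchy_annulus_of_mem (hF : DifferentiableOn ℂ F (annulus r R))
    (hr : r < a) (ha : 0 < a) (hR : b < R) (haz : a < ‖z‖) (hzb : ‖z‖ < b) :
    (∮ w in C(0, b), (w - z)⁻¹ • F w) - (∮ w in C(0, a), (w - z)⁻¹ • F w)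
      = (2 * Real.pi * Complex.I) * F z := by
  have hab : a < b := haz.trans hzb
  have hzm : annulus r R ∈ 𝓝 z :=
    (isOpen_annulus r R).mem_nhds ⟨hr.trans haz, hzb.trans hR⟩
  have hd : DifferentiableOn ℂ (dslope F z) (annulus r R) :=
    (Complex.differentiableOn_dslope hzm).2 hF
  have key := circleIntegral_eq_of_differentiableOn_annulus hd hr ha hab.le hR
  have hcont : ∀ s, 0 < s → r < s → s < R → ContinuousOn F (sphere 0 s) := fun s _ h1 h2 =>
    hF.continuousOn.mono fun w hw => by
      rw [mem_sphere_zero_iff_norm] at hw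
      exact ⟨by rw [hw]; exact h1, by rw [hw]; exact h2⟩
  have hsplit : ∀ s, 0 < s → r < s → s < R → ‖z‖ ≠ s →
      (∮ w in C(0, s), dslope F z w) = (∮ w in C(0, s), (w - z)⁻¹ • F w)
        - (∮ w in C(0, s), (w - z)⁻¹) * F z := fun s hs h1 h2 h3 => by
    have e1 : (∮ w in C(0, s), dslope F z w)
        = ∮ w in C(0, s), ((w - z)⁻¹ • F w - (w - z)⁻¹ • F z) := by
      refine circleIntegral.integral_congr hs.le fun w hw => ?_
      have : w ≠ z := fun h => h3 (by rw [← h]; simpa using hw)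
      simp only [dslope_of_ne _ this, slope_def_module, smul_sub]
    rw [e1, circleIntegral.integral_sub (circleIntegrable_cauchy hs.le (hcont s hs h1 h2) h3)
      (circleIntegrable_cauchy hs.le continuousOn_const h3), circleIntegral.integral_smul_const,
      smul_eq_mul]
  rw [hsplit b (ha.trans hab) (hr.trans hab) hR hzb.ne,
    hsplit a ha hr (hab.trans hR) haz.ne',
    circleIntegral.integral_sub_inv_of_mem_ball (by simpa using hzb)] at key
  have h0 : (∮ w in C(0, a), (w - z)⁻¹) = 0 := by
    refine Complex.circleIntegral_eq_zero_of_differentiable_on_off_countable ha.le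
      countable_empty (ContinuousOn.inv₀ (by fun_prop) fun w hw h => ?_) fun w hw => ?_
    · rw [sub_eq_zero] at h
      rw [h, mem_closedBall_zero_iff] at hw
      linarith
    · refine DifferentiableAt.inv (by fun_prop) fun h => ?_
      have := hw.1
      rw [sub_eq_zero] at h
      rw [h, mem_ball_zero_iff] at this
      linarith
  rw [h0, zero_mul, sub_zero] at key
  rw [← key]; ring

theorem cauchy_annulus_of_notMem (hF : DifferentiableOn ℂ F (annulus r R))
    (hr : r < a) (ha : 0 < a) (hab : a ≤ b) (hR : b < R) (hz : ‖z‖ < a ∨ b < ‖z‖) :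
    (∮ w in C(0, b), (w - z)⁻¹ • F w) = (∮ w in C(0, a), (w - z)⁻¹ • F w) := by
  have hsub : closedBall (0 : ℂ) b \ ball 0 a ⊆ annulus r R := fun w hw => by
    simp only [Set.mem_sdiff, mem_closedBall_zero_iff, mem_ball_zero_iff, not_lt] at hw
    exact ⟨hr.trans_le hw.2, hw.1.trans_lt hR⟩
  have hne : ∀ w ∈ closedBall (0 : ℂ) b \ ball 0 a, w - z ≠ 0 := fun w hw h => by
    rw [sub_eq_zero] at h
    simp only [h, Set.mem_sdiff, mem_closedBall_zero_iff, mem_ball_zero_iff, not_lt] at hw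
    rcases hz with hz | hz <;> linarith
  refine Complex.circleIntegral_eq_of_differentiable_on_annulus_off_countable ha hab
    countable_empty (ContinuousOn.smul (ContinuousOn.inv₀ (by fun_prop) hne)
      (hF.continuousOn.mono hsub)) fun w hw => ?_
  have hw' : w ∈ closedBall (0 : ℂ) b \ ball 0 a :=
    ⟨ball_subset_closedBall hw.1.1, fun h => hw.1.2 (ball_subset_closedBall h)⟩
  have hd : DifferentiableAt ℂ (fun w => w - z) w := by fun_prop
  exact DifferentiableAt.smul (hd.inv (hne w hw'))
    (hF.differentiableAt ((isOpen_annulus r R).mem_nhds (hsub hw')) : DifferentiableAt ℂ F w)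

end CauchyAnnulus

/-- The reflection `w ↦ 1 / conj (F (1 / conj w))` of `F` in the unit circle. -/
noncomputable def reflect (F : ℂ → ℂ) (w : ℂ) : ℂ := (conj (F (conj w)⁻¹))⁻¹

/-- The Cauchy integral over the boundary of `annulus a a⁻¹` of the function that is `F` on the
inner circle and its reflection on the outer one. -/
noncomputable def reflectExt (F : ℂ → ℂ) (a : ℝ) (z : ℂ) : ℂ :=
  (2 * Real.pi * Complex.I)⁻¹ *
    ((∮ w in C(0, a⁻¹), (w - z)⁻¹ • reflect F w) - ∮ w in C(0, a), (w - z)⁻¹ • F w)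

section Reflection

variable {F : ℂ → ℂ} {r a : ℝ} {z : ℂ}

theorem mem_annulus_inv_conj {r : ℝ} (hr : 0 < r) (hz : z ∈ annulus 1 r⁻¹) :
    (conj z)⁻¹ ∈ annulus r 1 := by
  have h1 : 1 < ‖z‖ := hz.1
  have h2 : ‖z‖ < r⁻¹ := hz.2
  have h0 : 0 < ‖z‖ := one_pos.trans h1
  refine ⟨?_, ?_⟩
  · rw [norm_inv, RCLike.norm_conj, lt_inv_comm₀ hr h0]; exact h2
  · rw [norm_inv, RCLike.norm_conj]; exact inv_lt_one_of_one_lt₀ h1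

theorem differentiableOn_reflect (hr : 0 < r) (hF : DifferentiableOn ℂ F (annulus r 1))
    (h0 : ∀ z ∈ annulus r 1, F z ≠ 0) : DifferentiableOn ℂ (reflect F) (annulus 1 r⁻¹) := by
  intro w hw
  have hm := mem_annulus_inv_conj hr hw
  have hw0 : w ≠ 0 := by
    intro h
    have := hw.1
    rw [h, norm_zero] at this
    linarith
  have h1 : DifferentiableAt ℂ F (conj w⁻¹) := by
    rw [map_inv₀]
    exact hF.differentiableAt ((isOpen_annulus r 1).mem_nhds hm)
  have h3 : DifferentiableAt ℂ (conj ∘ F ∘ conj) w⁻¹ := by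
    simpa using h1.conj_conj
  have h2 : DifferentiableAt ℂ (fun w => conj (F (conj w⁻¹))) w :=
    DifferentiableAt.comp (f := fun w : ℂ => w⁻¹) (g := conj ∘ F ∘ conj) w h3
      (differentiableAt_inv hw0)
  refine DifferentiableAt.differentiableWithinAt ?_
  unfold reflect
  simp_rw [map_inv₀] at h2
  exact h2.inv ((map_ne_zero _).2 (h0 _ hm))

theorem reflect_circleMap (s θ : ℝ) :
    reflect F (circleMap 0 s⁻¹ θ) = (conj (F (circleMap 0 s θ)))⁻¹ := by
  have : (conj (circleMap 0 s⁻¹ θ))⁻¹ = circleMap 0 s θ := by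
    simp only [circleMap, zero_add, map_mul, Complex.conj_ofReal, mul_inv, ← Complex.exp_conj,
      ← Complex.exp_neg, Complex.conj_I]
    congr 1
    · push_cast; rw [inv_inv]
    · congr 1; ring
  rw [reflect, this]

theorem norm_circleMap_inv_sub_circleMap {s : ℝ} (hs : 0 < s) (hs1 : s < 1) (θ : ℝ) :
    ‖circleMap 0 s⁻¹ θ - circleMap 0 s θ‖ = s⁻¹ - s := by
  simp only [circleMap, zero_add]
  rw [← sub_mul, norm_mul, Complex.norm_exp_ofReal_mul_I, mul_one, ← Complex.ofReal_sub,
    Complex.norm_real, Real.norm_of_nonneg]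
  have := one_lt_inv₀ hs |>.2 hs1
  linarith

/-- Here x − 1/x̄ = (|x| − 1)(|x| + 1)/x̄. The bounds |x| + 1 ≤ 5/2 and 1/|x| ≤ 2 produce the factor
5. -/
theorem norm_sub_conj_inv_le {x : ℂ} {ε : ℝ} (hε : ε ≤ 1 / 2) (hx : |‖x‖ - 1| < ε) :
    ‖x - (conj x)⁻¹‖ ≤ 5 * ε ∧ ‖(conj x)⁻¹‖ ≤ 2 := by
  rw [abs_lt] at hx
  have h1 : 1 / 2 ≤ ‖x‖ := by linarith
  have hx0 : x ≠ 0 := by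
    intro h; rw [h, norm_zero] at h1; linarith
  have h2 : ‖(conj x)⁻¹‖ ≤ 2 := by
    rw [norm_inv, RCLike.norm_conj]
    calc ‖x‖⁻¹ ≤ (1 / 2)⁻¹ := inv_anti₀ (by norm_num) h1
      _ = 2 := by norm_num
  refine ⟨?_, h2⟩
  have hc : conj x ≠ 0 := (map_ne_zero _).2 hx0
  have e : x - (conj x)⁻¹ = ((‖x‖ - 1) * (‖x‖ + 1) : ℝ) * (conj x)⁻¹ := by
    have := Complex.mul_conj' x
    field_simp
    rw [this]
    push_cast; ring
  rw [e, norm_mul, Complex.norm_real, Real.norm_eq_abs, abs_mul]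
  have h3 : |‖x‖ - 1| ≤ ε := (abs_lt.2 hx).le
  have h4 : |‖x‖ + 1| ≤ 5 / 2 := by
    rw [abs_of_pos (by linarith)]; linarith
  calc |‖x‖ - 1| * |‖x‖ + 1| * ‖(conj x)⁻¹‖ ≤ ε * (5 / 2) * 2 := by
        have := (abs_nonneg _).trans h3
        gcongr
    _ = 5 * ε := by ring

/-- This replaces boundary continuity in the reflection principle: only |F| → 1 is assumed, not
convergence of F. Points of the circles of radii s and 1/s are paired by angle. The values F and
1/F̄ are close because |F| is near 1, and the kernels are close because 1/s − s → 0. -/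
theorem tendsto_circleIntegral_sub_reflect (hr : 0 < r) (hr1 : r < 1)
    (hF : DifferentiableOn ℂ F (annulus r 1)) (h0 : ∀ z ∈ annulus r 1, F z ≠ 0)
    (hb : ∀ ε > 0, ∃ s < 1, ∀ z : ℂ, s < ‖z‖ → ‖z‖ < 1 → |‖F z‖ - 1| < ε) (hz : ‖z‖ ≠ 1) :
    Tendsto (fun s : ℝ => (∮ w in C(0, s), (w - z)⁻¹ • F w)
      - ∮ w in C(0, s⁻¹), (w - z)⁻¹ • reflect F w) (𝓝[<] 1) (𝓝 0) := by
  set d := |‖z‖ - 1| / 2 with hd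
  have hd0 : 0 < d := half_pos (abs_pos.2 (sub_ne_zero.2 hz))
  have ev1 : ∀ᶠ s : ℝ in 𝓝[<] 1, d ≤ |s - ‖z‖| := by
    refine nhdsWithin_le_nhds ((ContinuousAt.eventually_lt (f := fun _ => d)
      (g := fun s : ℝ => |s - ‖z‖|) (by fun_prop) (by fun_prop) ?_).mono fun _ h => h.le)
    rw [abs_sub_comm]; linarith
  have ev2 : ∀ᶠ s : ℝ in 𝓝[<] 1, d ≤ |s⁻¹ - ‖z‖| := by
    have hc : ContinuousAt (fun s : ℝ => |s⁻¹ - ‖z‖|) 1 :=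
      ((continuousAt_inv₀ one_ne_zero).sub continuousAt_const).abs
    refine nhdsWithin_le_nhds ((ContinuousAt.eventually_lt (f := fun _ => d)
      (g := fun s : ℝ => |s⁻¹ - ‖z‖|) (by fun_prop) hc ?_).mono fun _ h => h.le)
    rw [inv_one, abs_sub_comm]; linarith
  have evr : ∀ᶠ s : ℝ in 𝓝[<] 1, r < s := nhdsWithin_le_nhds (lt_mem_nhds hr1)
  have evl : ∀ᶠ s : ℝ in 𝓝[<] 1, s < 1 := self_mem_nhdsWithin
  have key : ∀ ε : ℝ, 0 < ε → ε ≤ 1 / 2 → ∀ᶠ s : ℝ in 𝓝[<] 1,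
      ‖(∮ w in C(0, s), (w - z)⁻¹ • F w) - ∮ w in C(0, s⁻¹), (w - z)⁻¹ • reflect F w‖
        ≤ (5 * ε / d + ‖z‖ * (s⁻¹ - s) / (d * d) * 2) * |2 * Real.pi - 0| := by
    intro ε hε hε2
    obtain ⟨s₀, hs₀, hs⟩ := hb ε hε
    filter_upwards [ev1, ev2, evr, evl, nhdsWithin_le_nhds (lt_mem_nhds hs₀)]
      with s h1 h2 h3 h4 h5
    have hs0 : 0 < s := hr.trans h3
    have hi1 : CircleIntegrable (fun w => (w - z)⁻¹ • F w) 0 s := by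
      refine circleIntegrable_cauchy hs0.le (hF.continuousOn.mono fun w hw => ?_) fun h => ?_
      · rw [mem_sphere_zero_iff_norm] at hw
        exact ⟨by rw [hw]; exact h3, by rw [hw]; exact h4⟩
      · rw [h, sub_self, abs_zero] at h1; linarith
    have hi2 : CircleIntegrable (fun w => (w - z)⁻¹ • reflect F w) 0 s⁻¹ := by
      refine circleIntegrable_cauchy (inv_pos.2 hs0).le
        ((differentiableOn_reflect hr hF h0).continuousOn.mono fun w hw => ?_) fun h => ?_
      · rw [mem_sphere_zero_iff_norm] at hw
        exact ⟨by rw [hw]; exact (one_lt_inv₀ hs0).2 h4,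
          by rw [hw]; exact (inv_lt_inv₀ hs0 hr).2 h3⟩
      · rw [h, sub_self, abs_zero] at h2; linarith
    rw [circleIntegral, circleIntegral, ← intervalIntegral.integral_sub
      ((circleIntegrable_iff _).1 hi1) ((circleIntegrable_iff _).1 hi2)]
    refine intervalIntegral.norm_integral_le_of_norm_le_const fun θ _ => ?_
    rw [deriv_circleMap, deriv_circleMap, reflect_circleMap]
    set e := circleMap 0 s θ with he
    set e' := circleMap 0 s⁻¹ θ with he'
    have hne : ‖e‖ = s := by rw [he, norm_circleMap_zero, abs_of_pos hs0]
    have hne' : ‖e'‖ = s⁻¹ := by rw [he', norm_circleMap_zero, abs_of_pos (inv_pos.2 hs0)]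
    have hd1 : d ≤ ‖e - z‖ := h1.trans (by rw [← hne]; exact abs_norm_sub_norm_le _ _)
    have hd2 : d ≤ ‖e' - z‖ := h2.trans (by rw [← hne']; exact abs_norm_sub_norm_le _ _)
    have hz1 : e - z ≠ 0 := norm_pos_iff.1 (hd0.trans_le hd1)
    have hz2 : e' - z ≠ 0 := norm_pos_iff.1 (hd0.trans_le hd2)
    obtain ⟨hx1, hx2⟩ := norm_sub_conj_inv_le hε2 (hs e (by rw [hne]; exact h5)
      (by rw [hne]; exact h4))
    have hee : ‖e' - e‖ = s⁻¹ - s := norm_circleMap_inv_sub_circleMap hs0 h4 θ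
    -- Splits the difference into a change of function value and a change of kernel, using e/(e − z)
    -- − e'/(e' − z) = z(e' − e)/((e − z)(e' − z)).
    have halg : (e * Complex.I) • (e - z)⁻¹ • F e - (e' * Complex.I) • (e' - z)⁻¹ • (conj (F e))⁻¹
        = Complex.I * (e / (e - z) * (F e - (conj (F e))⁻¹)
          + z * (e' - e) / ((e - z) * (e' - z)) * (conj (F e))⁻¹) := by
      simp only [smul_eq_mul]
      generalize (conj (F e))⁻¹ = y
      field_simp
      ring
    rw [halg, norm_mul, Complex.norm_I, one_mul]
    refine (norm_add_le _ _).trans ?_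
    rw [norm_mul, norm_mul, norm_div, norm_div, norm_mul, norm_mul, hne, hee]
    have hss : 0 ≤ s⁻¹ - s := by rw [← hee]; exact norm_nonneg _
    refine add_le_add ?_ ?_
    · calc s / ‖e - z‖ * ‖F e - (conj (F e))⁻¹‖ ≤ 1 / d * (5 * ε) := by gcongr
        _ = 5 * ε / d := by ring
    · gcongr
  rw [Metric.tendsto_nhds]
  intro η hη
  set ε := min (1 / 2) (η * d / (5 * (4 * Real.pi) + 1)) with hε
  have hpi := Real.pi_pos
  have hε0 : 0 < ε := lt_min (by norm_num) (by positivity)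
  have hεη : 5 * ε / d * (2 * Real.pi) < η / 2 := by
    have : ε ≤ η * d / (5 * (4 * Real.pi) + 1) := min_le_right _ _
    rw [le_div_iff₀ (by positivity)] at this
    rw [div_mul_eq_mul_div, div_lt_iff₀ hd0]
    nlinarith
  have hlim : Tendsto (fun s : ℝ => ‖z‖ * (s⁻¹ - s) / (d * d) * 2 * (2 * Real.pi)) (𝓝[<] 1)
      (𝓝 0) := by
    have hc : ContinuousAt (fun s : ℝ => ‖z‖ * (s⁻¹ - s) / (d * d) * 2 * (2 * Real.pi)) 1 := by
      have := continuousAt_inv₀ (one_ne_zero (α := ℝ))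
      fun_prop
    have := hc.tendsto
    simp only [inv_one, sub_self, mul_zero, zero_div, zero_mul] at this
    exact this.mono_left nhdsWithin_le_nhds
  filter_upwards [key ε hε0 (min_le_left _ _), hlim.eventually (gt_mem_nhds (half_pos hη))]
    with s h1 h2
  rw [dist_zero_right]
  refine h1.trans_lt ?_
  rw [sub_zero, abs_of_pos (by positivity), add_mul]
  linarith

/-- Cauchy's formula between the circles of radii a and s produces F(z). Between 1/s and 1/a the
reflected function contributes nothing, since z lies inside both circles. The two middle circles
cancel as s → 1. The case |z| > 1 is symmetric. -/
theorem reflectExt_eq_of_lt_one (hr : 0 < r) (hra : r < a)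
    (hF : DifferentiableOn ℂ F (annulus r 1)) (h0 : ∀ z ∈ annulus r 1, F z ≠ 0)
    (hb : ∀ ε > 0, ∃ s < 1, ∀ z : ℂ, s < ‖z‖ → ‖z‖ < 1 → |‖F z‖ - 1| < ε)
    (hz : z ∈ annulus a 1) : reflectExt F a z = F z := by
  have ha : 0 < a := hr.trans hra
  have ha1 : a < 1 := hz.1.trans hz.2
  have hrefl := differentiableOn_reflect hr hF h0
  have h1 : ∀ᶠ s : ℝ in 𝓝[<] 1, (2 * Real.pi * Complex.I) * F z
      - ((∮ w in C(0, a⁻¹), (w - z)⁻¹ • reflect F w) - ∮ w in C(0, a), (w - z)⁻¹ • F w)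
      = (∮ w in C(0, s), (w - z)⁻¹ • F w) - ∮ w in C(0, s⁻¹), (w - z)⁻¹ • reflect F w := by
    filter_upwards [nhdsWithin_le_nhds (lt_mem_nhds hz.2), self_mem_nhdsWithin] with s hs hs1
    have hs0 : 0 < s := (norm_nonneg z).trans_lt hs
    have e1 := cauchy_annulus_of_mem hF hra ha hs1 hz.1 hs
    have e2 := cauchy_annulus_of_notMem (z := z) hrefl ((one_lt_inv₀ hs0).2 hs1) (inv_pos.2 hs0)
      ((inv_le_inv₀ hs0 ha).2 (hz.1.trans hs).le) ((inv_lt_inv₀ ha hr).2 hra)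
      (Or.inl (hz.2.trans ((one_lt_inv₀ hs0).2 hs1)))
    rw [← e1, e2]; ring
  have h2 := (tendsto_circleIntegral_sub_reflect hr (hra.trans ha1) hF h0 hb hz.2.ne).congr'
    (h1.mono fun _ h => h.symm)
  have h3 := tendsto_nhds_unique h2 tendsto_const_nhds
  have hne : (2 * Real.pi * Complex.I : ℂ) ≠ 0 := Complex.two_pi_I_ne_zero
  rw [reflectExt, ← sub_eq_zero.1 h3.symm, inv_mul_cancel_left₀ hne]

theorem reflectExt_eq_of_one_lt (hr : 0 < r) (hra : r < a)
    (hF : DifferentiableOn ℂ F (annulus r 1)) (h0 : ∀ z ∈ annulus r 1, F z ≠ 0)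
    (hb : ∀ ε > 0, ∃ s < 1, ∀ z : ℂ, s < ‖z‖ → ‖z‖ < 1 → |‖F z‖ - 1| < ε)
    (hz : z ∈ annulus 1 a⁻¹) : reflectExt F a z = reflect F z := by
  have ha : 0 < a := hr.trans hra
  have hza : ‖z‖⁻¹ < 1 := inv_lt_one_of_one_lt₀ hz.1
  have hz0 : 0 < ‖z‖ := one_pos.trans hz.1
  have ha1 : a < 1 := lt_trans ((lt_inv_comm₀ ha hz0).2 hz.2) hza
  have hrefl := differentiableOn_reflect hr hF h0
  have h1 : ∀ᶠ s : ℝ in 𝓝[<] 1,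
      ((∮ w in C(0, a⁻¹), (w - z)⁻¹ • reflect F w) - ∮ w in C(0, a), (w - z)⁻¹ • F w)
        - (2 * Real.pi * Complex.I) * reflect F z
      = - ((∮ w in C(0, s), (w - z)⁻¹ • F w) - ∮ w in C(0, s⁻¹), (w - z)⁻¹ • reflect F w) := by
    have hlt : ∀ᶠ s : ℝ in 𝓝[<] 1, ‖z‖⁻¹ < s := nhdsWithin_le_nhds (lt_mem_nhds hza)
    filter_upwards [hlt, self_mem_nhdsWithin, nhdsWithin_le_nhds (lt_mem_nhds ha1)]
      with s hs hs1 has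
    have hs0 : 0 < s := (inv_pos.2 hz0).trans hs
    have e1 := cauchy_annulus_of_mem hrefl ((one_lt_inv₀ hs0).2 hs1) (inv_pos.2 hs0)
      ((inv_lt_inv₀ ha hr).2 hra) ((inv_lt_comm₀ hs0 hz0).2 hs) hz.2
    have e2 := cauchy_annulus_of_notMem (z := z) hF hra ha has.le hs1
      (Or.inr (lt_trans hs1 hz.1))
    rw [← e1, e2]; ring
  have h2 := (tendsto_circleIntegral_sub_reflect hr (hra.trans ha1) hF h0 hb hz.1.ne').neg.congr'
    (h1.mono fun _ h => h.symm)
  have h3 := tendsto_nhds_unique h2 tendsto_const_nhds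
  rw [neg_zero] at h3
  have hne : (2 * Real.pi * Complex.I : ℂ) ≠ 0 := Complex.two_pi_I_ne_zero
  rw [reflectExt, sub_eq_zero.1 h3.symm, inv_mul_cancel_left₀ hne]

theorem le_norm_sub_of_mem_ball {s d : ℝ} (hd : d ≤ |‖z‖ - s| / 2) {w x : ℂ} (hw : ‖w‖ = s)
    (hx : x ∈ ball z d) : d ≤ ‖w - x‖ := by
  have h1 : |‖w‖ - ‖z‖| ≤ ‖w - z‖ := abs_norm_sub_norm_le w z
  have h2 : ‖w - z‖ ≤ ‖w - x‖ + ‖x - z‖ := norm_sub_le_norm_sub_add_norm_sub w x z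
  rw [mem_ball, dist_eq_norm] at hx
  rw [hw, abs_sub_comm] at h1
  linarith

/-- Only continuity of the density on the circle is needed: the Cauchy kernel is differentiated
under the integral, at a point off the circle. -/
theorem differentiableAt_circleIntegral_cauchy {g : ℂ → ℂ} {s : ℝ} (hs : 0 < s)
    (hg : ContinuousOn g (sphere 0 s)) (hz : ‖z‖ ≠ s) :
    DifferentiableAt ℂ (fun x => ∮ w in C(0, s), (w - x)⁻¹ • g w) z := by
  set d := |‖z‖ - s| / 2 with hd
  have hd0 : 0 < d := half_pos (abs_pos.2 (sub_ne_zero.2 hz))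
  obtain ⟨M, hM⟩ := (isCompact_sphere (0 : ℂ) s).exists_bound_of_continuousOn hg
  have hcm : ∀ θ, ‖circleMap 0 s θ‖ = s := fun θ => by
    rw [norm_circleMap_zero, abs_of_pos hs]
  have hmem : ∀ θ, circleMap 0 s θ ∈ sphere (0 : ℂ) s := fun θ => circleMap_mem_sphere _ hs.le _
  have hint : ∀ x, ‖x‖ ≠ s → IntervalIntegrable
      (fun θ => deriv (circleMap 0 s) θ • (circleMap 0 s θ - x)⁻¹ • g (circleMap 0 s θ))
      volume 0 (2 * Real.pi) := fun x hx =>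
    (circleIntegrable_iff _).1 (circleIntegrable_cauchy hs.le hg hx)
  have hball : ∀ x ∈ ball z d, ‖x‖ ≠ s := fun x hx h => by
    have := le_norm_sub_of_mem_ball hd.le h hx
    rw [sub_self, norm_zero] at this
    linarith
  have hcont : Continuous fun θ => deriv (circleMap 0 s) θ •
      ((circleMap 0 s θ - z) ^ 2)⁻¹ • g (circleMap 0 s θ) := by
    have h1 : Continuous fun θ => g (circleMap 0 s θ) :=
      hg.comp_continuous (continuous_circleMap 0 s) hmem
    have h2 : Continuous fun θ => ((circleMap 0 s θ - z) ^ 2)⁻¹ := by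
      refine Continuous.inv₀ (by fun_prop) fun θ => pow_ne_zero 2 fun h => hz ?_
      rw [← sub_eq_zero.1 h, hcm]
    simp only [deriv_circleMap]
    exact ((continuous_circleMap 0 s).mul continuous_const).smul (h2.smul h1)
  have := intervalIntegral.hasDerivAt_integral_of_dominated_loc_of_deriv_le (μ := volume)
    (a := 0) (b := 2 * Real.pi) (x₀ := z) (s := ball z d)
    (F := fun x θ => deriv (circleMap 0 s) θ • (circleMap 0 s θ - x)⁻¹ • g (circleMap 0 s θ))
    (F' := fun x θ => deriv (circleMap 0 s) θ •
      ((circleMap 0 s θ - x) ^ 2)⁻¹ • g (circleMap 0 s θ))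
    (bound := fun _ => s * ((d ^ 2)⁻¹ * M)) (ball_mem_nhds z hd0)
    (by
      filter_upwards [ball_mem_nhds z hd0] with x hx
      exact (hint x (hball x hx)).aestronglyMeasurable_restrict_uIoc)
    (hint z hz) hcont.aestronglyMeasurable
    (by
      refine Eventually.of_forall fun θ _ x hx => ?_
      have h1 := le_norm_sub_of_mem_ball hd.le (hcm θ) hx
      have h2 := hM _ (hmem θ)
      rw [norm_smul, norm_smul, deriv_circleMap, norm_mul, Complex.norm_I, mul_one, hcm, norm_inv,
        norm_pow]
      have hM0 : 0 ≤ M := (norm_nonneg _).trans h2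
      gcongr)
    (intervalIntegrable_const)
    (by
      refine Eventually.of_forall fun θ _ x hx => ?_
      have hne : circleMap 0 s θ - x ≠ 0 := fun h =>
        hball x hx (by rw [← sub_eq_zero.1 h, hcm])
      have h1 : HasDerivAt (fun x => (circleMap 0 s θ - x)⁻¹)
          (((circleMap 0 s θ - x) ^ 2)⁻¹) x := by
        have := ((hasDerivAt_id x).const_sub (circleMap 0 s θ)).fun_inv hne
        simpa [neg_div, one_div] using this
      exact (h1.smul_const _).fun_const_smul _)
  exact this.2.differentiableAt

theorem continuousOn_reflect_sphere (ha : 0 < a) (hF : ContinuousOn F (sphere 0 a))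
    (h0 : ∀ w ∈ sphere (0 : ℂ) a, F w ≠ 0) : ContinuousOn (reflect F) (sphere 0 a⁻¹) := by
  have hm : MapsTo (fun w : ℂ => (conj w)⁻¹) (sphere 0 a⁻¹) (sphere 0 a) := fun w hw => by
    rw [mem_sphere_zero_iff_norm] at hw ⊢
    rw [norm_inv, RCLike.norm_conj, hw, inv_inv]
  have h1 : ContinuousOn (fun w : ℂ => (conj w)⁻¹) (sphere 0 a⁻¹) := by
    refine ContinuousOn.inv₀ Complex.continuous_conj.continuousOn fun w hw h => ?_
    rw [mem_sphere_zero_iff_norm] at hw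
    rw [map_eq_zero] at h
    rw [h, norm_zero] at hw
    exact (inv_pos.2 ha).ne hw
  exact (Complex.continuous_conj.comp_continuousOn (hF.comp h1 hm)).inv₀
    fun w hw => (map_ne_zero _).2 (h0 _ (hm hw))

theorem differentiableOn_reflectExt (ha : 0 < a) (hF : ContinuousOn F (sphere 0 a))
    (h0 : ∀ z ∈ sphere (0 : ℂ) a, F z ≠ 0) :
    DifferentiableOn ℂ (reflectExt F a) (annulus a a⁻¹) := fun _ hz =>
  ((differentiableAt_circleIntegral_cauchy (inv_pos.2 ha) (continuousOn_reflect_sphere ha hF h0)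
    hz.2.ne).sub (differentiableAt_circleIntegral_cauchy ha hF hz.1.ne')).const_mul _
    |>.differentiableWithinAt

end Reflection

end LoewnerKufarev

/-! ### Boundary behaviour of maps that preserve the circle and its sides -/

namespace LoewnerKufarev

open Filter Topology ComplexConjugate

/-- `E` is holomorphic on an annulus around the unit circle, preserves the circle and its two
sides, and is injective on the inner side. -/
structure IsCircleMap (E : ℂ → ℂ) (a : ℝ) : Prop where
  pos : 0 < a
  lt_one : a < 1
  diff : DifferentiableOn ℂ E (annulus a a⁻¹)
  ne_zero : ∀ z ∈ annulus a 1, E z ≠ 0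
  norm_lt : ∀ z ∈ annulus a 1, ‖E z‖ < 1
  norm_gt : ∀ z ∈ annulus 1 a⁻¹, 1 < ‖E z‖
  norm_eq : ∀ z : ℂ, ‖z‖ = 1 → ‖E z‖ = 1
  inj : InjOn E (annulus a 1)

section Extension

variable {F : ℂ → ℂ} {r a : ℝ}

theorem isCircleMap_reflectExt (hr : 0 < r) (hra : r < a) (ha1 : a < 1)
    (hF : DifferentiableOn ℂ F (annulus r 1)) (h0 : ∀ z ∈ annulus r 1, F z ≠ 0)
    (h1 : ∀ z ∈ annulus r 1, ‖F z‖ < 1) (hi : InjOn F (annulus r 1))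
    (hb : ∀ ε > 0, ∃ s < 1, ∀ z : ℂ, s < ‖z‖ → ‖z‖ < 1 → |‖F z‖ - 1| < ε) :
    IsCircleMap (reflectExt F a) a := by
  have ha : 0 < a := hr.trans hra
  have hsub : annulus a 1 ⊆ annulus r 1 := fun z hz => ⟨hra.trans hz.1, hz.2⟩
  have hsph : sphere (0 : ℂ) a ⊆ annulus r 1 := fun z hz => by
    rw [mem_sphere_zero_iff_norm] at hz
    exact ⟨by rw [hz]; exact hra, by rw [hz]; exact ha1⟩
  have hin : EqOn (reflectExt F a) F (annulus a 1) := fun z hz =>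
    reflectExt_eq_of_lt_one hr hra hF h0 hb hz
  have hdiff : DifferentiableOn ℂ (reflectExt F a) (annulus a a⁻¹) :=
    differentiableOn_reflectExt ha (hF.continuousOn.mono hsph) fun z hz => h0 z (hsph hz)
  have ha1' : 1 < a⁻¹ := (one_lt_inv₀ ha).2 ha1
  refine ⟨ha, ha1, hdiff, fun z hz => ?_, fun z hz => ?_, fun z hz => ?_, fun z hz => ?_,
    fun z hz w hw h => ?_⟩
  · rw [hin hz]; exact h0 z (hsub hz)
  · rw [hin hz]; exact h1 z (hsub hz)
  · rw [reflectExt_eq_of_one_lt hr hra hF h0 hb hz, reflect, norm_inv, RCLike.norm_conj]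
    have hm : (conj z)⁻¹ ∈ annulus r 1 := hsub (mem_annulus_inv_conj ha hz)
    exact (one_lt_inv₀ (norm_pos_iff.2 (h0 _ hm))).2 (h1 _ hm)
  -- On the circle itself |E| is computed as a radial limit from inside, where E = F and |F| → 1.
  · have hc : ContinuousAt (reflectExt F a) z := (hdiff.differentiableAt
      ((isOpen_annulus _ _).mem_nhds ⟨by rw [hz]; exact ha1, by rw [hz]; exact ha1'⟩)).continuousAt
    have hc' : Tendsto (fun s : ℝ => ‖reflectExt F a (s * z)‖) (𝓝[<] 1)
        (𝓝 ‖reflectExt F a z‖) := by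
      have : Tendsto (fun s : ℝ => (s : ℂ) * z) (𝓝 1) (𝓝 z) := by
        have h : ContinuousAt (fun s : ℝ => (s : ℂ) * z) 1 := by fun_prop
        simpa using h.tendsto
      exact (hc.norm.tendsto.comp this).mono_left nhdsWithin_le_nhds
    have hc'' : Tendsto (fun s : ℝ => ‖reflectExt F a (s * z)‖) (𝓝[<] 1) (𝓝 1) := by
      rw [Metric.tendsto_nhds]
      intro ε hε
      obtain ⟨s₀, hs₀, hs⟩ := hb ε hε
      filter_upwards [nhdsWithin_le_nhds (lt_mem_nhds hs₀), nhdsWithin_le_nhds (lt_mem_nhds ha1),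
        self_mem_nhdsWithin] with s h1 h2 h3
      have hn : ‖(s : ℂ) * z‖ = s := by
        rw [norm_mul, hz, mul_one, Complex.norm_real, Real.norm_of_nonneg (ha.trans h2).le]
      rw [hin ⟨by rw [hn]; exact h2, by rw [hn]; exact h3⟩, Real.dist_eq]
      exact hs _ (by rw [hn]; exact h1) (by rw [hn]; exact h3)
    exact tendsto_nhds_unique hc' hc''
  · rw [hin hz, hin hw] at h
    exact hi (hsub hz) (hsub hw) h

end Extension

namespace IsCircleMap

variable {E : ℂ → ℂ} {a : ℝ} {ζ : ℂ}

theorem mem_annulus_of_norm (hE : IsCircleMap E a) (hζ : ‖ζ‖ = 1) : ζ ∈ annulus a a⁻¹ :=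
  ⟨by rw [hζ]; exact hE.lt_one, by rw [hζ]; exact (one_lt_inv₀ hE.pos).2 hE.lt_one⟩

theorem analyticAt (hE : IsCircleMap E a) {z : ℂ} (hz : z ∈ annulus a a⁻¹) : AnalyticAt ℂ E z :=
  hE.diff.analyticAt ((isOpen_annulus _ _).mem_nhds hz)

theorem eventually_mem (hE : IsCircleMap E a) (hζ : ‖ζ‖ = 1) : ∀ᶠ z in 𝓝 ζ, z ∈ annulus a a⁻¹ :=
  (isOpen_annulus _ _).mem_nhds (hE.mem_annulus_of_norm hζ)

theorem ne_zero_of_norm (hE : IsCircleMap E a) (hζ : ‖ζ‖ = 1) : E ζ ≠ 0 := by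
  rw [← norm_pos_iff, hE.norm_eq ζ hζ]; exact one_pos

theorem ne_zero' (hE : IsCircleMap E a) {z : ℂ} (hz : z ∈ annulus a a⁻¹) : E z ≠ 0 := by
  rcases lt_trichotomy ‖z‖ 1 with h | h | h
  · exact hE.ne_zero z ⟨hz.1, h⟩
  · exact hE.ne_zero_of_norm h
  · exact norm_pos_iff.1 (one_pos.trans (hE.norm_gt z ⟨h, hz.2⟩))

/-- The unit disk lies strictly on one side of the tangent line at the boundary point E(ζ). -/
theorem re_conj_mul_lt (hE : IsCircleMap E a) (hζ : ‖ζ‖ = 1) {z : ℂ} (hz : z ∈ annulus a 1) :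
    (conj (E ζ) * (E z - E ζ)).re < 0 := by
  have h1 : (conj (E ζ) * E z).re < 1 := by
    refine (Complex.re_le_norm _).trans_lt ?_
    rw [norm_mul, RCLike.norm_conj, hE.norm_eq ζ hζ, one_mul]
    exact hE.norm_lt z hz
  have h2 : conj (E ζ) * E ζ = 1 := by
    rw [Complex.conj_mul', hE.norm_eq ζ hζ]; simp
  rw [mul_sub, h2, Complex.sub_re, Complex.one_re]
  linarith

/-- Directions pointing strictly inward enter the disk, because |1 + su|² = 1 + s(2 Re u + s|u|²).
-/
theorem eventually_mem_of_re_neg (hE : IsCircleMap E a) (hζ : ‖ζ‖ = 1) {u : ℂ} (hu : u.re < 0) :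
    ∀ᶠ s : ℝ in 𝓝[>] 0, ζ * (1 + s * u) ∈ annulus a 1 := by
  have hcont : ContinuousAt (fun s : ℝ => ‖ζ * (1 + s * u)‖) 0 := by fun_prop
  have h1 : ∀ᶠ s : ℝ in 𝓝[>] 0, a < ‖ζ * (1 + s * u)‖ := by
    refine nhdsWithin_le_nhds (hcont.eventually_const_lt ?_)
    simp [hζ, hE.lt_one]
  have h2 : ∀ᶠ s : ℝ in 𝓝[>] 0, s * ‖u‖ ^ 2 < -2 * u.re := by
    have hc : ContinuousAt (fun s : ℝ => s * ‖u‖ ^ 2) 0 := by fun_prop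
    refine nhdsWithin_le_nhds (hc.eventually_lt_const ?_)
    show (0 : ℝ) * ‖u‖ ^ 2 < _
    rw [zero_mul]; linarith
  filter_upwards [h1, h2, self_mem_nhdsWithin] with s hs1 hs2 hs3
  refine ⟨hs1, ?_⟩
  rw [norm_mul, hζ, one_mul]
  have hsq : ‖1 + (s : ℂ) * u‖ ^ 2 = 1 + s * (2 * u.re + s * ‖u‖ ^ 2) := by
    rw [← Complex.normSq_eq_norm_sq, ← Complex.normSq_eq_norm_sq, Complex.normSq_apply,
      Complex.normSq_apply]
    simp
    ring
  have : s * (2 * u.re + s * ‖u‖ ^ 2) < 0 :=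
    mul_neg_of_pos_of_neg hs3 (by linarith)
  have h3 : ‖1 + (s : ℂ) * u‖ ^ 2 < 1 := by rw [hsq]; linarith
  nlinarith [norm_nonneg (1 + (s : ℂ) * u)]

/-- If E'(ζ) = 0, then E − E(ζ) vanishes to some order n ≥ 2, and u ↦ uⁿ spreads the half-plane of
inward directions over at least a full turn. But images of inner points stay in one half-plane.
Injectivity plays no role. -/
theorem deriv_ne_zero (hE : IsCircleMap E a) (hζ : ‖ζ‖ = 1) : deriv E ζ ≠ 0 := by
  intro hd
  have hζ0 : ζ ≠ 0 := by rw [← norm_pos_iff, hζ]; exact one_pos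
  have han : AnalyticAt ℂ (fun z => E z - E ζ) ζ :=
    (hE.analyticAt (hE.mem_annulus_of_norm hζ)).sub analyticAt_const
  have hpath : ∀ u : ℂ, Tendsto (fun s : ℝ => ζ * (1 + s * u)) (𝓝[>] 0) (𝓝 ζ) := fun u => by
    have h : ContinuousAt (fun s : ℝ => ζ * (1 + s * u)) 0 := by fun_prop
    have := h.tendsto
    simp only [Complex.ofReal_zero, zero_mul, add_zero, mul_one] at this
    exact this.mono_left nhdsWithin_le_nhds
  have hne : ¬ ∀ᶠ z in 𝓝 ζ, E z - E ζ = 0 := fun h => by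
    obtain ⟨s, h1, h2⟩ := (((hpath (-1)).eventually h).and
      (hE.eventually_mem_of_re_neg hζ (u := -1) (by simp))).exists
    have := hE.re_conj_mul_lt hζ h2
    rw [h1, mul_zero, Complex.zero_re] at this
    exact lt_irrefl _ this
  obtain ⟨n, g, hg, hg0, hev⟩ := han.exists_eventuallyEq_pow_smul_nonzero_iff.2 hne
  have hn0 : n ≠ 0 := by
    rintro rfl
    have := hev.self_of_nhds
    simp only [sub_self, pow_zero, one_smul] at this
    exact hg0 this.symm
  have hn1 : n ≠ 1 := by
    rintro rfl
    have h1 : HasDerivAt (fun z => (z - ζ) ^ 1 • g z) (g ζ) ζ := by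
      have := ((hasDerivAt_id ζ).sub_const ζ).fun_mul hg.differentiableAt.hasDerivAt
      simpa using this
    have h2 := (h1.congr_of_eventuallyEq hev).deriv
    rw [deriv_sub_const] at h2
    exact hg0 (h2.symm.trans hd)
  have hn2 : 2 ≤ n := by omega
  set d := conj (E ζ) * ζ ^ n * g ζ with hdd
  have hd0 : d ≠ 0 := by
    have := hE.ne_zero_of_norm hζ
    exact mul_ne_zero (mul_ne_zero ((map_ne_zero _).2 this) (pow_ne_zero _ hζ0)) hg0
  -- Leading-order term of the half-plane inequality along z = ζ(1 + su), divided by sⁿ, as s → 0⁺.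
  have hdir : ∀ u : ℂ, u.re < 0 → (d * u ^ n).re ≤ 0 := fun u hu => by
    have hlim : Tendsto (fun s : ℝ => (conj (E ζ) * ζ ^ n * g (ζ * (1 + s * u)) * u ^ n).re)
        (𝓝[>] 0) (𝓝 (d * u ^ n).re) :=
      (Complex.continuous_re.tendsto _).comp
        ((((hg.continuousAt.tendsto.comp (hpath u)).const_mul _)).mul_const _)
    refine le_of_tendsto hlim ?_
    filter_upwards [(hpath u).eventually hev, hE.eventually_mem_of_re_neg hζ hu,
      self_mem_nhdsWithin] with s h1 h2 h3
    have h4 := hE.re_conj_mul_lt hζ h2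
    have h5 : ζ * (1 + s * u) - ζ = s * (ζ * u) := by ring
    rw [h1, h5, smul_eq_mul] at h4
    have h6 : conj (E ζ) * ((s * (ζ * u)) ^ n * g (ζ * (1 + s * u)))
        = (s ^ n : ℝ) * (conj (E ζ) * ζ ^ n * g (ζ * (1 + s * u)) * u ^ n) := by
      push_cast; ring
    rw [h6, Complex.re_ofReal_mul] at h4
    by_contra! h
    exact absurd h4 (not_lt.2 (mul_nonneg (pow_pos h3 n).le h.le))
  have hnR : (2 : ℝ) ≤ n := by exact_mod_cast hn2
  have hpi := Real.pi_pos
  -- Four inward directions at angles π/2 + π/16 + jπ/(2n). They stay below 3π/2 because n ≥ 2, and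
  -- their nth powers differ by quarter turns, so D, iD, −D and −iD all have nonpositive real part
  -- and D = 0.
  have key : ∀ j : ℕ, j ≤ 3 → (d * Complex.exp (n * (Real.pi / 2 + Real.pi / 16) * Complex.I)
      * Complex.I ^ j).re ≤ 0 := fun j hj => by
    set α : ℝ := Real.pi / 2 + Real.pi / 16 + j * (Real.pi / (2 * n)) with hα
    have hjR : (j : ℝ) ≤ 3 := by exact_mod_cast hj
    have h1 : (j : ℝ) * (Real.pi / (2 * n)) ≤ 3 * (Real.pi / 4) := by
      have : Real.pi / (2 * n) ≤ Real.pi / 4 := by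
        gcongr; linarith
      gcongr
    have h2 : 0 ≤ (j : ℝ) * (Real.pi / (2 * n)) := by positivity
    have hcos : Real.cos α < 0 :=
      Real.cos_neg_of_pi_div_two_lt_of_lt (by linarith) (by linarith)
    have h3 := hdir (Complex.exp (α * Complex.I)) (by
      rw [Complex.exp_ofReal_mul_I_re]; exact hcos)
    have h4 : Complex.exp (α * Complex.I) ^ n
        = Complex.exp (n * (Real.pi / 2 + Real.pi / 16) * Complex.I) * Complex.I ^ j := by
      rw [← Complex.exp_nat_mul]
      have hI : Complex.I ^ j = Complex.exp (j * (Real.pi / 2 * Complex.I)) := by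
        rw [Complex.exp_nat_mul, Complex.exp_pi_div_two_mul_I]
      rw [hI, ← Complex.exp_add]
      congr 1
      rw [hα]
      push_cast
      have : (n : ℂ) ≠ 0 := by exact_mod_cast hn0
      field_simp
    rwa [h4, ← mul_assoc] at h3
  set D := d * Complex.exp (n * (Real.pi / 2 + Real.pi / 16) * Complex.I) with hD
  have hD0 : D ≠ 0 := mul_ne_zero hd0 (Complex.exp_ne_zero _)
  have k0 := key 0 (by norm_num)
  have k1 := key 1 (by norm_num)
  have k2 := key 2 (by norm_num)
  have k3 := key 3 (by norm_num)
  simp [pow_succ] at k0 k1 k2 k3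
  exact hD0 (Complex.ext (le_antisymm k0 k2) (le_antisymm k3 k1))

/-- The logarithmic derivative `z E'(z) / E(z)`. On the circle it is the derivative of the angle. -/
noncomputable def angularDeriv (E : ℂ → ℂ) (z : ℂ) : ℂ := z * deriv E z / E z

/-- Reality comes from differentiating |E|² = 1 along the circle. The real part is nonnegative
because radial difference quotients have that sign, and it is nonzero because E' ≠ 0. -/
theorem angularDeriv_re_pos (hE : IsCircleMap E a) (hζ : ‖ζ‖ = 1) :
    0 < (angularDeriv E ζ).re ∧ (angularDeriv E ζ).im = 0 := by
  have hζ0 : ζ ≠ 0 := by rw [← norm_pos_iff, hζ]; exact one_pos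
  have hd := (hE.analyticAt (hE.mem_annulus_of_norm hζ)).differentiableAt.hasDerivAt
  have hq : angularDeriv E ζ = conj (E ζ) * (ζ * deriv E ζ) := by
    have h1 : conj (E ζ) * E ζ = 1 := by
      rw [Complex.conj_mul', hE.norm_eq ζ hζ]; simp
    rw [angularDeriv, div_eq_iff (hE.ne_zero_of_norm hζ)]
    linear_combination (-ζ * deriv E ζ) * h1
  have him : (angularDeriv E ζ).im = 0 := by
    have h1 : HasDerivAt (fun θ : ℝ => ζ * Complex.exp (θ * Complex.I)) (ζ * Complex.I) 0 := by
      have : HasDerivAt (fun θ : ℝ => Complex.exp (θ * Complex.I))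
          (Complex.exp ((0 : ℝ) * Complex.I) * (1 * Complex.I)) 0 :=
        (Complex.ofRealCLM.hasDerivAt.mul_const Complex.I).cexp
      simpa using this.const_mul ζ
    have h2 : HasDerivAt (fun θ : ℝ => E (ζ * Complex.exp (θ * Complex.I)))
        (deriv E ζ * (ζ * Complex.I)) 0 := by
      refine HasDerivAt.comp (𝕜' := ℂ) (h₂ := E) 0 ?_ h1
      simpa using hd
    have h3 : HasDerivAt (fun θ : ℝ => ‖E (ζ * Complex.exp (θ * Complex.I))‖ ^ 2)
        (2 * inner ℝ (E ζ) (deriv E ζ * (ζ * Complex.I))) 0 := by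
      simpa using h2.norm_sq
    have h4 : (fun θ : ℝ => ‖E (ζ * Complex.exp (θ * Complex.I))‖ ^ 2) = fun _ => 1 := by
      ext θ
      rw [hE.norm_eq _ (by rw [norm_mul, hζ, Complex.norm_exp_ofReal_mul_I, mul_one]), one_pow]
    rw [h4] at h3
    have h5 := h3.unique (hasDerivAt_const 0 1)
    rw [Complex.inner] at h5
    have h6 : deriv E ζ * (ζ * Complex.I) * conj (E ζ) = angularDeriv E ζ * Complex.I := by
      rw [hq]; ring
    rw [h6] at h5
    simpa using h5
  refine ⟨lt_of_le_of_ne ?_ fun h => ?_, him⟩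
  · have h1 : HasDerivAt (fun s : ℝ => (s : ℂ) * ζ) ζ 1 := by
      simpa using (Complex.ofRealCLM.hasDerivAt (x := 1)).mul_const ζ
    have h2 : HasDerivAt (fun s : ℝ => E (s * ζ)) (deriv E ζ * ζ) 1 := by
      refine HasDerivAt.comp (𝕜' := ℂ) (h₂ := E) 1 ?_ h1
      simpa using hd
    have h3 : HasDerivAt (fun s : ℝ => (conj (E ζ) * E (s * ζ)).re)
        (conj (E ζ) * (deriv E ζ * ζ)).re 1 :=
      Complex.reCLM.hasFDerivAt.comp_hasDerivAt 1 (h2.const_mul _)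
    have h4 := (hasDerivAt_iff_tendsto_slope.1 h3).mono_left
      (nhdsWithin_mono (s := Iio (1 : ℝ)) 1 fun s (hs : s < 1) => hs.ne)
    have h5 : conj (E ζ) * (deriv E ζ * ζ) = angularDeriv E ζ := by rw [hq]; ring
    rw [h5] at h4
    refine ge_of_tendsto h4 ?_
    filter_upwards [self_mem_nhdsWithin, nhdsWithin_le_nhds (lt_mem_nhds hE.lt_one)] with s hs hsa
    have hn : ‖(s : ℂ) * ζ‖ = s := by
      rw [norm_mul, hζ, mul_one, Complex.norm_real, Real.norm_of_nonneg (hE.pos.trans hsa).le]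
    have h6 := hE.re_conj_mul_lt hζ (z := s * ζ) ⟨by rw [hn]; exact hsa, by rw [hn]; exact hs⟩
    rw [mul_sub, Complex.sub_re] at h6
    rw [slope_def_field, Complex.ofReal_one, one_mul]
    exact div_nonneg_of_nonpos h6.le (sub_nonpos.2 (le_of_lt hs))
  · have h0 : angularDeriv E ζ = 0 := Complex.ext h.symm him
    rw [angularDeriv, div_eq_zero_iff, mul_eq_zero] at h0
    rcases h0 with (h0 | h0) | h0
    · exact hζ0 h0
    · exact hE.deriv_ne_zero hζ h0
    · exact hE.ne_zero_of_norm hζ h0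

/-- If E(z) = E(w), both germs are open, so a point just inside the common image has preimages near
z and near w. Both preimages lie inside the disk because E preserves the sides, which contradicts
injectivity there. -/
theorem injOn_sphere (hE : IsCircleMap E a) : InjOn E (sphere 0 1) := by
  intro z hz w hw h
  rw [mem_sphere_zero_iff_norm] at hz hw
  by_contra hne
  obtain ⟨N, M, hN, hM, hzN, hwM, hNM⟩ := t2_separation hne
  have hopen : ∀ {x : ℂ} {N : Set ℂ}, ‖x‖ = 1 → IsOpen N → x ∈ N →
      E '' (N ∩ annulus a a⁻¹) ∈ 𝓝 (E x) := fun {x N} hx hN hxN => by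
    have hs := (hE.analyticAt (hE.mem_annulus_of_norm hx)).hasStrictDerivAt
    rw [← hs.map_nhds_eq (hE.deriv_ne_zero hx)]
    exact image_mem_map (inter_mem (hN.mem_nhds hxN) (hE.eventually_mem hx))
  have h1 := hopen hz hN hzN
  have h2 := hopen hw hM hwM
  rw [← h] at h2
  have hp : Tendsto (fun s : ℝ => (s : ℂ) * E z) (𝓝[<] 1) (𝓝 (E z)) := by
    have h : ContinuousAt (fun s : ℝ => (s : ℂ) * E z) 1 := by fun_prop
    have := h.tendsto
    simp only [Complex.ofReal_one, one_mul] at this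
    exact this.mono_left nhdsWithin_le_nhds
  obtain ⟨s, ⟨⟨⟨x, hx, hxs⟩, y, hy, hys⟩, hs0⟩, hs1⟩ := (((hp.eventually
    (inter_mem h1 h2)).and (nhdsWithin_le_nhds (lt_mem_nhds one_pos))).and
      self_mem_nhdsWithin).exists
  have hn : ‖(s : ℂ) * E z‖ < 1 := by
    rw [norm_mul, hE.norm_eq z hz, mul_one, Complex.norm_real, Real.norm_of_nonneg hs0.le]
    exact hs1
  have hinside : ∀ x ∈ annulus a a⁻¹, ‖E x‖ < 1 → x ∈ annulus a 1 := fun x hx hlt => by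
    refine ⟨hx.1, lt_of_not_ge fun hge => ?_⟩
    rcases hge.eq_or_lt with h | h
    · exact hlt.ne (hE.norm_eq x h.symm)
    · exact lt_asymm hlt (hE.norm_gt x ⟨h, hx.2⟩)
  have hxy : x = y := hE.inj (hinside x hx.2 (by rw [hxs]; exact hn))
    (hinside y hy.2 (by rw [hys]; exact hn)) (hxs.trans hys.symm)
  exact disjoint_left.1 hNM hx.1 (hxy ▸ hy.1)

end IsCircleMap

end LoewnerKufarev

/-! ### Absolute continuity on a period and square-root densities -/

namespace LoewnerKufarev

open Filter Topology ComplexConjugate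

section AbsolutelyContinuous

variable {f χ : ℝ → ℝ} {a b c d T : ℝ}

theorem absolutelyContinuousOnInterval_lipschitz_comp {X Y : Type*} [PseudoMetricSpace X]
    [PseudoMetricSpace Y] {f : ℝ → X} {L : X → Y} {K : NNReal} (hL : LipschitzWith K L)
    (hf : AbsolutelyContinuousOnInterval f a b) :
    AbsolutelyContinuousOnInterval (L ∘ f) a b := by
  have h := Filter.Tendsto.const_mul (K : ℝ) hf
  rw [mul_zero] at h
  refine squeeze_zero (fun E => Finset.sum_nonneg fun _ _ => dist_nonneg) (fun E => ?_) h
  rw [Finset.mul_sum]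
  exact Finset.sum_le_sum fun i _ => hL.dist_le_mul _ _

theorem disjoint_uIoc_map_of_monotoneOn {s : Set ℝ} (hχ : MonotoneOn χ s) {x y x' y' : ℝ}
    (hx : x ∈ s) (hy : y ∈ s) (hx' : x' ∈ s) (hy' : y' ∈ s)
    (hd : Disjoint (uIoc x y) (uIoc x' y')) :
    Disjoint (uIoc (χ x) (χ y)) (uIoc (χ x') (χ y')) := by
  wlog h : x ≤ y generalizing x y
  · rw [uIoc_comm]
    exact this hy hx (by rwa [uIoc_comm]) (le_of_not_ge h)
  wlog h' : x' ≤ y' generalizing x' y'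
  · rw [uIoc_comm (χ x')]
    exact this hy' hx' (by rwa [uIoc_comm y']) (le_of_not_ge h')
  rw [uIoc_of_le h, uIoc_of_le h', Ioc_disjoint_Ioc] at hd
  rw [uIoc_of_le (hχ hx hy h), uIoc_of_le (hχ hx' hy' h'), Ioc_disjoint_Ioc]
  rcases min_le_iff.1 hd with h1 | h1 <;> rcases le_max_iff.1 h1 with h2 | h2
  · exact (min_le_left _ _).trans ((hχ hy hx h2).trans (le_max_left _ _))
  · exact (min_le_left _ _).trans ((hχ hy hx' h2).trans (le_max_right _ _))
  · exact (min_le_right _ _).trans ((hχ hy' hx h2).trans (le_max_left _ _))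
  · exact (min_le_right _ _).trans ((hχ hy' hx' h2).trans (le_max_right _ _))

/-- Monotonicity of χ keeps disjoint intervals disjoint, and the Lipschitz bound controls their
total length. -/
theorem absolutelyContinuousOnInterval_comp_monotoneOn {K : NNReal}
    (hf : AbsolutelyContinuousOnInterval f c d) (hχ : MonotoneOn χ (uIcc a b))
    (hK : LipschitzOnWith K χ (uIcc a b)) (hm : MapsTo χ (uIcc a b) (uIcc c d)) :
    AbsolutelyContinuousOnInterval (f ∘ χ) a b := by
  rw [absolutelyContinuousOnInterval_iff] at hf ⊢
  intro ε hε
  obtain ⟨δ, hδ, h⟩ := hf ε hε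
  refine ⟨δ / (K + 1), by positivity, fun E hE hsum => ?_⟩
  refine h (E.1, fun i => (χ (E.2 i).1, χ (E.2 i).2)) ⟨fun i hi => ⟨hm (hE.1 i hi).1,
    hm (hE.1 i hi).2⟩, fun i hi j hj hij => ?_⟩ ?_
  · exact disjoint_uIoc_map_of_monotoneOn hχ (hE.1 i hi).1 (hE.1 i hi).2 (hE.1 j hj).1
      (hE.1 j hj).2 (hE.2 hi hj hij)
  · calc ∑ i ∈ Finset.range E.1, dist (χ (E.2 i).1) (χ (E.2 i).2)
        ≤ ∑ i ∈ Finset.range E.1, K * dist (E.2 i).1 (E.2 i).2 :=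
          Finset.sum_le_sum fun i hi => hK.dist_le_mul _ (hE.1 i hi).1 _ (hE.1 i hi).2
      _ = K * ∑ i ∈ Finset.range E.1, dist (E.2 i).1 (E.2 i).2 := (Finset.mul_sum _ _ _).symm
      _ ≤ (K + 1) * ∑ i ∈ Finset.range E.1, dist (E.2 i).1 (E.2 i).2 := by
          gcongr
          linarith
      _ < (K + 1) * (δ / (K + 1)) := by gcongr
      _ = δ := by field

theorem periodic_deriv (hf : Function.Periodic f T) : Function.Periodic (deriv f) T := fun x => by
  rw [← deriv_comp_add_const]
  congr 1
  exact funext hf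

/-- The integral of f' over a period vanishes, so f minus the primitive of f' is periodic. It equals
f(0) on one period by absolute continuity, hence everywhere. -/
theorem eq_add_integral_deriv_of_periodic (hT : 0 < T) (hp : Function.Periodic f T)
    (hf : AbsolutelyContinuousOnInterval f 0 T) (x : ℝ) :
    f x = f 0 + ∫ u in (0 : ℝ)..x, deriv f u := by
  have hpd := periodic_deriv hp
  have hint : ∀ u v, IntervalIntegrable (deriv f) volume u v := fun u v =>
    hpd.intervalIntegrable₀ hT.ne' hf.intervalIntegrable_deriv u v
  have hper : ∀ y, (∫ u in (0 : ℝ)..(y + T), deriv f u) = ∫ u in (0 : ℝ)..y, deriv f u := fun y => by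
    rw [← intervalIntegral.integral_add_adjacent_intervals (hint 0 y) (hint y (y + T)),
      hpd.intervalIntegral_add_eq y 0, zero_add, hf.integral_deriv_eq_sub]
    have : f T = f 0 := by simpa using hp 0
    rw [this, sub_self, add_zero]
  have hg : Function.Periodic (fun y => f y - ∫ u in (0 : ℝ)..y, deriv f u) T := fun y => by
    simp only [hp y, hper y]
  obtain ⟨y, hy, hxy⟩ := hg.exists_mem_Ico₀ hT x
  have h1 := (hf.mono (c := 0) (d := y) (by
    rw [uIcc_of_le hT.le, uIcc_of_le hy.1]; exact Icc_subset_Icc_right hy.2.le)).integral_deriv_eq_sub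
  simp only [h1] at hxy
  linarith

theorem absolutelyContinuousOnInterval_of_periodic (hT : 0 < T) (hp : Function.Periodic f T)
    (hf : AbsolutelyContinuousOnInterval f 0 T) (a b : ℝ) :
    AbsolutelyContinuousOnInterval f a b := by
  have hint : ∀ u v, IntervalIntegrable (deriv f) volume u v := fun u v =>
    (periodic_deriv hp).intervalIntegrable₀ hT.ne' hf.intervalIntegrable_deriv u v
  have h := (hint a b).absolutelyContinuousOnInterval_intervalIntegral (c := a) left_mem_uIcc
  have hc : LipschitzWith 1 (fun x : ℝ => f a + x) := by
    exact LipschitzWith.of_dist_le_mul fun x y => by simp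
  have h2 := absolutelyContinuousOnInterval_lipschitz_comp hc h
  suffices e : ((fun x => f a + x) ∘ fun x => ∫ v in a..x, deriv f v) = f by rwa [e] at h2
  ext x
  rw [Function.comp_apply, eq_add_integral_deriv_of_periodic hT hp hf x,
    eq_add_integral_deriv_of_periodic hT hp hf a, add_assoc,
    intervalIntegral.integral_add_adjacent_intervals (hint 0 a) (hint a x)]

end AbsolutelyContinuous

theorem periodic_coe_S1 {β : Type*} (ν : S1 → β) :
    Function.Periodic (fun x : ℝ => ν x) (2 * Real.pi) := fun x => by
  simp only [AddCircle.coe_add_period]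

theorem continuous_of_continuous_coe {β : Type*} [TopologicalSpace β] {ν : S1 → β}
    (h : Continuous fun x : ℝ => ν x) : Continuous ν :=
  isQuotientMap_quotient_mk'.continuous_iff.2 h

namespace IsSqrtDensity

variable {σ : Measure S1} {ν : S1 → ℝ}

theorem absCont' (h : IsSqrtDensity σ ν) (a b : ℝ) :
    AbsolutelyContinuousOnInterval (fun x : ℝ => ν x) a b :=
  absolutelyContinuousOnInterval_of_periodic Real.two_pi_pos (periodic_coe_S1 ν) h.absCont a b

theorem continuous_coe (h : IsSqrtDensity σ ν) : Continuous fun x : ℝ => ν x :=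
  continuous_iff_continuousAt.2 fun x => ((h.absCont' (x - 1) (x + 1)).continuousOn).continuousAt
    (by rw [uIcc_of_le (by linarith)]; exact Icc_mem_nhds (by linarith) (by linarith))

theorem continuous (h : IsSqrtDensity σ ν) : Continuous ν :=
  continuous_of_continuous_coe h.continuous_coe

/-- Squares of the two functions agree almost everywhere, and both functions are continuous and
nonnegative. The infimum defining `localEnergy` therefore has at most one candidate. -/
theorem unique {ν' : S1 → ℝ} (h : IsSqrtDensity σ ν) (h' : IsSqrtDensity σ ν') : ν = ν' := by
  have hc := h.continuous
  have hc' := h'.continuous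
  have h1 := h.density.symm.trans h'.density
  rw [withDensity_eq_iff_of_sigmaFinite (by fun_prop) (by fun_prop)] at h1
  have h2 : ν =ᵐ[volume] ν' := by
    filter_upwards [h1] with x hx
    rw [ENNReal.ofReal_eq_ofReal_iff (sq_nonneg _) (sq_nonneg _)] at hx
    exact (sq_eq_sq₀ (h.nonneg x) (h'.nonneg x)).1 hx
  exact (hc.ae_eq_iff_eq volume hc').1 h2

theorem localEnergy_eq (h : IsSqrtDensity σ ν) : localEnergy σ =
    2⁻¹ * ∫⁻ x in Ioc 0 (2 * Real.pi), ENNReal.ofReal (deriv (fun y : ℝ => ν y) x ^ 2) := by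
  refine le_antisymm (iInf₂_le ν h) (le_iInf₂ fun ν' h' => ?_)
  rw [h.unique h']

theorem integrable_sq (h : IsSqrtDensity σ ν) :
    IntervalIntegrable (fun x => deriv (fun y : ℝ => ν y) x ^ 2) volume 0 (2 * Real.pi) := by
  rw [intervalIntegrable_iff_integrableOn_Ioc_of_le Real.two_pi_pos.le]
  exact (memLp_two_iff_integrable_sq (measurable_deriv _).aestronglyMeasurable).1 h.sqIntegrable

theorem localEnergy_toReal (h : IsSqrtDensity σ ν) : localEnergy σ ≠ ∞ ∧
    (localEnergy σ).toReal = 2⁻¹ * ∫ x in (0 : ℝ)..(2 * Real.pi), deriv (fun y : ℝ => ν y) x ^ 2 := by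
  have h2 := h.integrable_sq
  rw [intervalIntegrable_iff_integrableOn_Ioc_of_le Real.two_pi_pos.le] at h2
  rw [h.localEnergy_eq, ← ofReal_integral_eq_lintegral_ofReal h2
    (Eventually.of_forall fun x => sq_nonneg _), intervalIntegral.integral_of_le Real.two_pi_pos.le]
  refine ⟨ENNReal.mul_ne_top (by simp) ENNReal.ofReal_ne_top, ?_⟩
  rw [ENNReal.toReal_mul, ENNReal.toReal_ofReal (integral_nonneg fun x => sq_nonneg _)]
  simp

theorem integral_eq {G : Type*} [NormedAddCommGroup G] [NormedSpace ℝ G]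
    (h : IsSqrtDensity σ ν) (g : S1 → G) :
    ∫ θ, g θ ∂σ = ∫ x in (0 : ℝ)..(2 * Real.pi), (ν x ^ 2) • g x := by
  have hc := h.continuous
  have := AddCircle.intervalIntegral_preimage (2 * Real.pi) 0 (fun θ => (ν θ ^ 2) • g θ)
  rw [zero_add] at this
  rw [this, h.density, integral_withDensity_eq_integral_toReal_smul (by fun_prop) (by simp)]
  simp only [ENNReal.toReal_ofReal (sq_nonneg _)]

theorem of_localEnergy_ne_top (h : localEnergy σ ≠ ∞) : ∃ ν, IsSqrtDensity σ ν := by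
  by_contra! hn
  exact h (by simp [localEnergy, hn])

end IsSqrtDensity

end LoewnerKufarev

/-! ### Change of the Dirichlet energy under a circle diffeomorphism -/

namespace LoewnerKufarev

open Filter Topology ComplexConjugate

/-- `φ` is a lift to the real line of an orientation preserving circle diffeomorphism, with
derivative `q = exp (∫ p)`, and `p` is continuously differentiable with derivative `p'`. -/
structure IsCircleLift (φ q p p' : ℝ → ℝ) : Prop where
  deriv_eq : ∀ θ, HasDerivAt φ (q θ) θ
  deriv_log : ∀ θ, HasDerivAt q (p θ * q θ) θ
  deriv_deriv_log : ∀ θ, HasDerivAt p (p' θ) θ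
  cont : Continuous p'
  pos : ∀ θ, 0 < q θ
  add_period : ∀ θ, φ (θ + 2 * Real.pi) = φ θ + 2 * Real.pi
  periodic_q : Function.Periodic q (2 * Real.pi)
  periodic_p : Function.Periodic p (2 * Real.pi)

namespace IsCircleLift

variable {φ q p p' : ℝ → ℝ}

theorem strictMono (h : IsCircleLift φ q p p') : StrictMono φ :=
  strictMono_of_deriv_pos fun x => by rw [(h.deriv_eq x).deriv]; exact h.pos x

theorem continuous (h : IsCircleLift φ q p p') : Continuous φ :=
  continuous_iff_continuousAt.2 fun x => (h.deriv_eq x).continuousAt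

theorem continuous_q (h : IsCircleLift φ q p p') : Continuous q :=
  continuous_iff_continuousAt.2 fun x => (h.deriv_log x).continuousAt

theorem continuous_p (h : IsCircleLift φ q p p') : Continuous p :=
  continuous_iff_continuousAt.2 fun x => (h.deriv_deriv_log x).continuousAt

theorem add_zsmul (h : IsCircleLift φ q p p') (n : ℤ) (θ : ℝ) :
    φ (θ + n • (2 * Real.pi)) = φ θ + n • (2 * Real.pi) := by
  have hp : Function.Periodic (fun x => φ x - x) (2 * Real.pi) := fun x => by
    simp only [h.add_period]; ring
  have : φ (θ + n • (2 * Real.pi)) - (θ + n • (2 * Real.pi)) = φ θ - θ := hp.zsmul n θ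
  linarith

theorem surjective (h : IsCircleLift φ q p p') : Function.Surjective φ := fun y => by
  obtain ⟨n, hn, -⟩ := existsUnique_sub_zsmul_mem_Ico Real.two_pi_pos y (φ 0)
  have h1 := h.add_zsmul n 0
  have h2 := h.add_zsmul n (2 * Real.pi)
  have h3 := h.add_period 0
  rw [zero_add] at h1 h3
  obtain ⟨x, -, hx⟩ := intermediate_value_Icc (a := n • (2 * Real.pi))
    (b := 2 * Real.pi + n • (2 * Real.pi)) (by linarith [Real.two_pi_pos]) h.continuous.continuousOn
    (show y ∈ _ by
      rw [h1, h2, h3]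
      exact ⟨by linarith [hn.1], by linarith [hn.2]⟩)
  exact ⟨x, hx⟩

/-- The inverse of a circle lift. -/
noncomputable def inverse (h : IsCircleLift φ q p p') : ℝ ≃o ℝ :=
  (h.strictMono.orderIsoOfSurjective φ h.surjective).symm

theorem inverse_apply (h : IsCircleLift φ q p p') (θ : ℝ) : h.inverse (φ θ) = θ :=
  (h.strictMono.orderIsoOfSurjective φ h.surjective).symm_apply_apply θ

theorem apply_inverse (h : IsCircleLift φ q p p') (y : ℝ) : φ (h.inverse y) = y :=
  (h.strictMono.orderIsoOfSurjective φ h.surjective).apply_symm_apply y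

theorem hasDerivAt_inverse (h : IsCircleLift φ q p p') (y : ℝ) :
    HasDerivAt h.inverse (q (h.inverse y))⁻¹ y :=
  (h.deriv_eq _).of_local_left_inverse h.inverse.continuous.continuousAt (h.pos _).ne'
    (Eventually.of_forall h.apply_inverse)

theorem inverse_add_period (h : IsCircleLift φ q p p') (y : ℝ) :
    h.inverse (y + 2 * Real.pi) = h.inverse y + 2 * Real.pi := by
  apply h.strictMono.injective
  rw [h.apply_inverse, h.add_period, h.apply_inverse]

/-- The weight √q makes the new density at φ(θ) equal to q(θ)ν(θ)². This is not a push-forward,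
which would divide by q: it is the law dictated by the Loewner equation. -/
theorem exists_transport (h : IsCircleLift φ q p p') (ν : S1 → ℝ) :
    ∃ ν' : S1 → ℝ, ∀ θ : ℝ, ν' (φ θ : ℝ) = √(q θ) * ν θ := by
  have hp : Function.Periodic (fun y : ℝ => √(q (h.inverse y)) * ν (h.inverse y))
      (2 * Real.pi) := fun y => by
    simp only [h.inverse_add_period, h.periodic_q _, AddCircle.coe_add_period]
  exact ⟨hp.lift, fun θ => by rw [hp.lift_coe, h.inverse_apply]⟩

theorem image_Icc (h : IsCircleLift φ q p p') :
    φ '' Icc 0 (2 * Real.pi) = Icc (φ 0) (φ 0 + 2 * Real.pi) := by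
  have h3 := h.add_period 0
  rw [zero_add] at h3
  rw [← h3]
  exact ((h.strictMono.orderIsoOfSurjective φ h.surjective).image_Icc 0 (2 * Real.pi))

/-- Change of variables carries [0, 2π] to a period starting at φ(0), and periodicity moves it back.
-/
theorem integral_comp (h : IsCircleLift φ q p p') {g : ℝ → ℝ}
    (hg : Function.Periodic g (2 * Real.pi)) :
    ∫ y in (0 : ℝ)..(2 * Real.pi), g y = ∫ θ in (0 : ℝ)..(2 * Real.pi), q θ * g (φ θ) := by
  have h1 := integral_image_eq_integral_abs_deriv_smul (s := Icc 0 (2 * Real.pi)) measurableSet_Icc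
    (fun x _ => (h.deriv_eq x).hasDerivWithinAt) h.strictMono.injective.injOn g
  have h2 := hg.intervalIntegral_add_eq 0 (φ 0)
  rw [zero_add] at h2
  rw [h2, intervalIntegral.integral_of_le (by linarith [Real.two_pi_pos]),
    intervalIntegral.integral_of_le Real.two_pi_pos.le, ← integral_Icc_eq_integral_Ioc,
    ← integral_Icc_eq_integral_Ioc, ← h.image_Icc, h1]
  simp only [abs_of_pos (h.pos _), smul_eq_mul]

theorem intervalIntegrable_comp (h : IsCircleLift φ q p p') {g : ℝ → ℝ}
    (hg : Function.Periodic g (2 * Real.pi))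
    (hi : IntervalIntegrable (fun θ => q θ * g (φ θ)) volume 0 (2 * Real.pi)) :
    IntervalIntegrable g volume 0 (2 * Real.pi) := by
  have h1 := integrableOn_image_iff_integrableOn_abs_deriv_smul (s := Icc 0 (2 * Real.pi))
    measurableSet_Icc (fun x _ => (h.deriv_eq x).hasDerivWithinAt) h.strictMono.injective.injOn g
  refine hg.intervalIntegrable (t := φ 0) Real.two_pi_pos.ne' ?_ _ _
  rw [intervalIntegrable_iff_integrableOn_Icc_of_le (by linarith [Real.two_pi_pos]),
    ← h.image_Icc, h1]
  simp only [abs_of_pos (h.pos _), smul_eq_mul]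
  rwa [intervalIntegrable_iff_integrableOn_Icc_of_le Real.two_pi_pos.le] at hi

variable {σ : Measure S1} {ν ν' : S1 → ℝ}

theorem absCont_transport (h : IsCircleLift φ q p p') (hν : IsSqrtDensity σ ν)
    (hν' : ∀ θ : ℝ, ν' (φ θ : ℝ) = √(q θ) * ν θ) :
    AbsolutelyContinuousOnInterval (fun y : ℝ => ν' y) 0 (2 * Real.pi) := by
  have hmono : MonotoneOn h.inverse (uIcc 0 (2 * Real.pi)) := h.inverse.monotone.monotoneOn _
  have hsqrt : ContDiff ℝ 1 fun θ => √(q θ) := by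
    rw [contDiff_one_iff_deriv]
    have hd : ∀ θ, HasDerivAt (fun θ => √(q θ)) (p θ * q θ / (2 * √(q θ))) θ := fun θ =>
      (h.deriv_log θ).sqrt (h.pos θ).ne'
    refine ⟨fun θ => (hd θ).differentiableAt, ?_⟩
    rw [funext fun θ => (hd θ).deriv]
    have := h.continuous_q
    have := h.continuous_p
    exact Continuous.div (by fun_prop) (by fun_prop) fun θ =>
      mul_ne_zero two_ne_zero (Real.sqrt_pos.2 (h.pos θ)).ne'
  have hη : AbsolutelyContinuousOnInterval (fun θ : ℝ => √(q θ) * ν θ)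
      (h.inverse 0) (h.inverse (2 * Real.pi)) :=
    (hsqrt.contDiffOn.absolutelyContinuousOnInterval).fun_mul (hν.absCont' _ _)
  have hlip : ContDiff ℝ 1 h.inverse := by
    rw [contDiff_one_iff_deriv]
    refine ⟨fun y => (h.hasDerivAt_inverse y).differentiableAt, ?_⟩
    rw [funext fun y => (h.hasDerivAt_inverse y).deriv]
    exact (h.continuous_q.comp h.inverse.continuous).inv₀ fun y => (h.pos _).ne'
  obtain ⟨K, hK⟩ := hlip.contDiffOn.exists_lipschitzOnWith (by decide)
    (convex_uIcc 0 (2 * Real.pi)) isCompact_uIcc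
  have := absolutelyContinuousOnInterval_comp_monotoneOn hη hmono hK
    (fun y hy => by
      rw [uIcc_of_le Real.two_pi_pos.le] at hy
      rw [uIcc_of_le (h.inverse.monotone Real.two_pi_pos.le)]
      exact ⟨h.inverse.monotone hy.1, h.inverse.monotone hy.2⟩)
  suffices e : (fun y : ℝ => ν' y) = (fun θ : ℝ => √(q θ) * ν θ) ∘ h.inverse by rwa [e]
  ext y
  rw [Function.comp_apply, ← hν', h.apply_inverse]

theorem deriv_transport (h : IsCircleLift φ q p p')
    (hν' : ∀ θ : ℝ, ν' (φ θ : ℝ) = √(q θ) * ν θ) {θ : ℝ}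
    (hd : DifferentiableAt ℝ (fun x : ℝ => ν x) θ) :
    q θ * deriv (fun y : ℝ => ν' y) (φ θ) ^ 2
      = (deriv (fun x : ℝ => ν x) θ + p θ / 2 * ν θ) ^ 2 := by
  have e : (fun y : ℝ => ν' y) = (fun θ : ℝ => √(q θ) * ν θ) ∘ h.inverse := by
    ext y
    rw [Function.comp_apply, ← hν', h.apply_inverse]
  have h1 : HasDerivAt (fun θ : ℝ => √(q θ) * ν θ)
      (p θ * q θ / (2 * √(q θ)) * ν θ + √(q θ) * deriv (fun x : ℝ => ν x) θ) θ :=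
    ((h.deriv_log θ).sqrt (h.pos θ).ne').mul hd.hasDerivAt
  have h2 := h.hasDerivAt_inverse (φ θ)
  rw [h.inverse_apply] at h2
  have h3 := (HasDerivAt.comp (φ θ) (by rw [h.inverse_apply]; exact h1) h2).deriv
  rw [e, h3]
  have hs : √(q θ) ≠ 0 := (Real.sqrt_pos.2 (h.pos θ)).ne'
  have hs2 : √(q θ) ^ 2 = q θ := Real.sq_sqrt (h.pos θ).le
  generalize √(q θ) = s at hs hs2
  rw [← hs2]
  field_simp
  ring

/-- In the variable θ the new Dirichlet integrand is (ν' + pν/2)². The cross term p νν' = ½ p (ν²)'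
is integrated by parts over a period, giving −½ p'ν², while the square term gives p²ν²/4. Together
they form the Schwarzian p' − p²/2 of φ. -/
theorem transport (h : IsCircleLift φ q p p') (hν : IsSqrtDensity σ ν)
    (hν' : ∀ θ : ℝ, ν' (φ θ : ℝ) = √(q θ) * ν θ) {σ' : Measure S1}
    (hσ' : σ' = volume.withDensity fun θ => ENNReal.ofReal (ν' θ ^ 2)) :
    IsSqrtDensity σ' ν' ∧
    (∫ y in (0 : ℝ)..(2 * Real.pi), deriv (fun y : ℝ => ν' y) y ^ 2)
      = (∫ θ in (0 : ℝ)..(2 * Real.pi), deriv (fun y : ℝ => ν y) θ ^ 2)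
        - 2⁻¹ * ∫ θ in (0 : ℝ)..(2 * Real.pi), ν θ ^ 2 * (p' θ - p θ ^ 2 / 2) := by
  have hac := h.absCont_transport hν hν'
  have hae : ∀ᵐ θ, θ ∈ uIcc 0 (2 * Real.pi) → q θ * deriv (fun y : ℝ => ν' y) (φ θ) ^ 2
      = deriv (fun x : ℝ => ν x) θ ^ 2 + p θ * (ν θ * deriv (fun x : ℝ => ν x) θ)
        + p θ ^ 2 / 4 * ν θ ^ 2 := by
    filter_upwards [hν.absCont.ae_differentiableAt] with θ hθ hm
    rw [h.deriv_transport hν' (hθ hm)]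
    ring
  have hνc := hν.continuous_coe
  have hpc := h.continuous_p
  have hp'c := h.cont
  have hνd : IntervalIntegrable (deriv fun x : ℝ => ν x) volume 0 (2 * Real.pi) :=
    hν.absCont.intervalIntegrable_deriv
  have i1 := hν.integrable_sq
  have i2 : IntervalIntegrable (fun θ : ℝ => p θ * (ν θ * deriv (fun x : ℝ => ν x) θ)) volume 0
      (2 * Real.pi) :=
    (hνd.continuousOn_mul hνc.continuousOn).continuousOn_mul hpc.continuousOn
  have i3 : IntervalIntegrable (fun θ : ℝ => p θ ^ 2 / 4 * ν θ ^ 2) volume 0 (2 * Real.pi) :=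
    (((hpc.pow 2).div_const 4).mul (hνc.pow 2)).intervalIntegrable _ _
  have i4 : IntervalIntegrable (fun θ : ℝ => p' θ * ν θ ^ 2) volume 0 (2 * Real.pi) :=
    (hp'c.mul (hνc.pow 2)).intervalIntegrable _ _
  have hper : Function.Periodic (fun y => deriv (fun y : ℝ => ν' y) y ^ 2) (2 * Real.pi) :=
    fun y => by
      have := periodic_deriv (periodic_coe_S1 ν') y
      simp only [this]
  have hsq : IntervalIntegrable (fun y => deriv (fun y : ℝ => ν' y) y ^ 2) volume 0
      (2 * Real.pi) := by
    refine h.intervalIntegrable_comp hper (((i1.add i2).add i3).congr_ae ?_)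
    rw [Filter.EventuallyEq, ae_restrict_iff' measurableSet_uIoc]
    filter_upwards [hae] with θ hθ hm
    exact (hθ (uIoc_subset_uIcc hm)).symm
  refine ⟨⟨fun y => ?_, hac, ?_, hσ'⟩, ?_⟩
  · induction y using QuotientAddGroup.induction_on with
    | H y =>
      have := hν' (h.inverse y)
      rw [h.apply_inverse] at this
      exact this ▸ mul_nonneg (Real.sqrt_nonneg _) (hν.nonneg _)
  · rw [memLp_two_iff_integrable_sq (measurable_deriv _).aestronglyMeasurable]
    exact (intervalIntegrable_iff_integrableOn_Ioc_of_le Real.two_pi_pos.le).1 hsq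
  -- Boundary terms cancel by periodicity of p and ν.
  · have hparts : (∫ θ in (0 : ℝ)..(2 * Real.pi), p θ * (ν θ * deriv (fun x : ℝ => ν x) θ))
        = - (2⁻¹ * ∫ θ in (0 : ℝ)..(2 * Real.pi), p' θ * ν θ ^ 2) := by
      have hpac : AbsolutelyContinuousOnInterval p 0 (2 * Real.pi) := by
        refine ContDiffOn.absolutelyContinuousOnInterval (ContDiff.contDiffOn ?_)
        rw [contDiff_one_iff_deriv]
        exact ⟨fun θ => (h.deriv_deriv_log θ).differentiableAt,
          by rw [funext fun θ => (h.deriv_deriv_log θ).deriv]; exact hp'c⟩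
      have hsqac : AbsolutelyContinuousOnInterval (fun θ : ℝ => ν θ * ν θ) 0 (2 * Real.pi) :=
        hν.absCont.fun_mul hν.absCont
      have hibp := hpac.integral_mul_deriv_eq_deriv_mul hsqac
      have e0 : p (2 * Real.pi) = p 0 := by simpa using h.periodic_p 0
      have e1 : ν ((2 * Real.pi : ℝ) : S1) = ν ((0 : ℝ) : S1) := by
        simpa using periodic_coe_S1 ν 0
      rw [e0, e1, sub_self, zero_sub] at hibp
      have e2 : (∫ θ in (0 : ℝ)..(2 * Real.pi), p θ * deriv (fun θ : ℝ => ν θ * ν θ) θ)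
          = ∫ θ in (0 : ℝ)..(2 * Real.pi), 2 * (p θ * (ν θ * deriv (fun x : ℝ => ν x) θ)) := by
        refine intervalIntegral.integral_congr_ae ?_
        filter_upwards [hν.absCont.ae_differentiableAt] with θ hθ hm
        have hd := (hθ (uIoc_subset_uIcc hm)).hasDerivAt
        rw [(hd.fun_mul hd).deriv]
        ring
      rw [e2, intervalIntegral.integral_const_mul] at hibp
      have e3 : (∫ θ in (0 : ℝ)..(2 * Real.pi), deriv p θ * (ν θ * ν θ))
          = ∫ θ in (0 : ℝ)..(2 * Real.pi), p' θ * ν θ ^ 2 := by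
        simp only [(h.deriv_deriv_log _).deriv, sq]
      rw [e3] at hibp
      linarith
    rw [h.integral_comp hper, intervalIntegral.integral_congr_ae
      (g := fun θ : ℝ => deriv (fun x : ℝ => ν x) θ ^ 2
        + p θ * (ν θ * deriv (fun x : ℝ => ν x) θ) + p θ ^ 2 / 4 * ν θ ^ 2)
      (hae.mono fun θ hθ hm => hθ (uIoc_subset_uIcc hm)),
      intervalIntegral.integral_add (i1.add i2) i3, intervalIntegral.integral_add i1 i2, hparts]
    have e4 : (∫ θ in (0 : ℝ)..(2 * Real.pi), ν θ ^ 2 * (p' θ - p θ ^ 2 / 2))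
        = (∫ θ in (0 : ℝ)..(2 * Real.pi), p' θ * ν θ ^ 2)
          - 2 * ∫ θ in (0 : ℝ)..(2 * Real.pi), p θ ^ 2 / 4 * ν θ ^ 2 := by
      rw [← intervalIntegral.integral_const_mul, ← intervalIntegral.integral_sub
        i4 (i3.const_mul 2)]
      congr 1
      ext θ
      ring
    rw [e4]
    ring

/-- One factor q comes from the transported density and one from dφ = q dθ. -/
theorem mass_transport (h : IsCircleLift φ q p p') (hν' : IsSqrtDensity σ ν')
    (hνν' : ∀ θ : ℝ, ν' (φ θ : ℝ) = √(q θ) * ν θ) :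
    σ.real univ = ∫ θ in (0 : ℝ)..(2 * Real.pi), ν θ ^ 2 * q θ ^ 2 := by
  have h1 := hν'.integral_eq (fun _ => (1 : ℝ))
  simp only [integral_const, smul_eq_mul, mul_one] at h1
  rw [h1, h.integral_comp (g := fun y : ℝ => ν' y ^ 2) fun y => by
    simp only [AddCircle.coe_add_period]]
  congr 1
  ext θ
  rw [hνν', mul_pow, Real.sq_sqrt (h.pos θ).le]
  ring

end IsCircleLift

end LoewnerKufarev

/-! ### The Schwarzian in the angular coordinate -/

namespace LoewnerKufarev

open Filter Topology ComplexConjugate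

theorem norm_expI (θ : S1) : ‖expI θ‖ = 1 := Circle.norm_coe _

theorem continuous_expI : Continuous expI :=
  continuous_subtype_val.comp AddCircle.continuous_toCircle

theorem hasDerivAt_expI (θ : ℝ) :
    HasDerivAt (fun x : ℝ => expI x) (Complex.I * expI θ) θ := by
  have : HasDerivAt (fun x : ℝ => Complex.exp (x * Complex.I))
      (Complex.exp (θ * Complex.I) * (1 * Complex.I)) θ :=
    (Complex.ofRealCLM.hasDerivAt.mul_const Complex.I).cexp
  simp only [expI_coe]
  convert this using 1
  ring

theorem hasDerivAt_comp_expI {G : ℂ → ℂ} {θ : ℝ} (hG : AnalyticAt ℂ G (expI θ)) :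
    HasDerivAt (fun x : ℝ => G (expI x)) (Complex.I * (expI θ * deriv G (expI θ))) θ := by
  have := HasDerivAt.comp (𝕜' := ℂ) (h₂ := G) θ hG.differentiableAt.hasDerivAt (hasDerivAt_expI θ)
  exact this.congr_deriv (by ring)

theorem hasDerivAt_of_ofReal {g : ℝ → ℝ} {c : ℂ} {θ : ℝ}
    (h : HasDerivAt (fun x => (g x : ℂ)) c θ) : HasDerivAt g c.re θ ∧ (c.re : ℂ) = c := by
  have h1 := Complex.reCLM.hasFDerivAt.comp_hasDerivAt θ h
  have h2 := Complex.imCLM.hasFDerivAt.comp_hasDerivAt θ h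
  refine ⟨h1, ?_⟩
  have h3 : (fun _ : ℝ => (0 : ℝ)) = Complex.imCLM ∘ fun x => (g x : ℂ) := by ext; simp
  rw [← h3] at h2
  have h4 : c.im = 0 := ((hasDerivAt_const θ (0 : ℝ)).unique h2).symm
  exact Complex.ext rfl h4.symm

namespace IsCircleMap

variable {E : ℂ → ℂ} {a : ℝ}

/-- The logarithmic derivative `z q'(z) / q(z)` of `q = angularDeriv E`. -/
noncomputable def angularLogDeriv (E : ℂ → ℂ) (z : ℂ) : ℂ :=
  z * deriv (angularDeriv E) z / angularDeriv E z

theorem angularDeriv_ne_zero (hE : IsCircleMap E a) {ζ : ℂ} (hζ : ‖ζ‖ = 1) :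
    angularDeriv E ζ ≠ 0 := fun h => by
  have := (hE.angularDeriv_re_pos hζ).1
  rw [h] at this
  simp at this

theorem analyticAt_angularDeriv (hE : IsCircleMap E a) {z : ℂ} (hz : z ∈ annulus a a⁻¹) :
    AnalyticAt ℂ (angularDeriv E) z :=
  (analyticAt_id.mul (hE.analyticAt hz).deriv).div (hE.analyticAt hz) (hE.ne_zero' hz)

theorem analyticAt_angularLogDeriv (hE : IsCircleMap E a) {ζ : ℂ} (hζ : ‖ζ‖ = 1) :
    AnalyticAt ℂ (angularLogDeriv E) ζ := by
  have h := hE.analyticAt_angularDeriv (hE.mem_annulus_of_norm hζ)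
  exact (analyticAt_id.mul h.deriv).div h (hE.angularDeriv_ne_zero hζ)

/-- Taking the logarithmic derivative of E' = qE/z gives E''/E' = (P + q − 1)/z with P = zq'/q. The
rest is the quotient rule together with zq' = Pq. -/
theorem sq_mul_schwarzian (hE : IsCircleMap E a) {ζ : ℂ} (hζ : ‖ζ‖ = 1) :
    ζ ^ 2 * schwarzian E ζ = ζ * deriv (angularLogDeriv E) ζ - angularLogDeriv E ζ ^ 2 / 2
      + 1 / 2 - angularDeriv E ζ ^ 2 / 2 := by
  have hζ0 : ζ ≠ 0 := by rw [← norm_pos_iff, hζ]; exact one_pos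
  have hq := hE.analyticAt_angularDeriv (hE.mem_annulus_of_norm hζ)
  have hP := hE.analyticAt_angularLogDeriv hζ
  have hderiv : ∀ᶠ w in 𝓝 ζ, deriv E w = angularDeriv E w * E w / w := by
    filter_upwards [hE.eventually_mem hζ] with w hw
    have h0 := hE.ne_zero' hw
    have hw0 : w ≠ 0 := norm_pos_iff.1 (hE.pos.trans hw.1)
    rw [angularDeriv]
    field_simp
  have hev : (fun w => deriv (deriv E) w / deriv E w)
      =ᶠ[𝓝 ζ] fun w => (angularLogDeriv E w + angularDeriv E w - 1) / w := by
    filter_upwards [hE.eventually_mem hζ, hderiv.eventually_nhds,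
      hq.continuousAt.eventually_ne (hE.angularDeriv_ne_zero hζ)] with w hw hdw hqw
    have h0 := hE.ne_zero' hw
    have hw0 : w ≠ 0 := norm_pos_iff.1 (hE.pos.trans hw.1)
    have hd2 : HasDerivAt (deriv E) (((deriv (angularDeriv E) w * E w
        + angularDeriv E w * deriv E w) * w - angularDeriv E w * E w * 1) / w ^ 2) w := by
      refine HasDerivAt.congr_of_eventuallyEq ?_ hdw
      exact ((hE.analyticAt_angularDeriv hw).differentiableAt.hasDerivAt.mul
        (hE.analyticAt hw).differentiableAt.hasDerivAt).div (hasDerivAt_id w) hw0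
    rw [hd2.deriv, hdw.self_of_nhds, angularLogDeriv]
    field_simp
  have hN : HasDerivAt (fun w => (angularLogDeriv E w + angularDeriv E w - 1) / w)
      (((deriv (angularLogDeriv E) ζ + deriv (angularDeriv E) ζ) * ζ
        - (angularLogDeriv E ζ + angularDeriv E ζ - 1) * 1) / ζ ^ 2) ζ :=
    ((hP.differentiableAt.hasDerivAt.add hq.differentiableAt.hasDerivAt).sub_const 1).fun_div
      (hasDerivAt_id ζ) hζ0
  have hPq : ζ * deriv (angularDeriv E) ζ = angularLogDeriv E ζ * angularDeriv E ζ := by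
    rw [angularLogDeriv, div_mul_cancel₀ _ (hE.angularDeriv_ne_zero hζ)]
  have hev0 : deriv (deriv E) ζ / deriv E ζ = (angularLogDeriv E ζ + angularDeriv E ζ - 1) / ζ :=
    hev.self_of_nhds
  rw [schwarzian, hev.deriv_eq, hN.deriv, hev0]
  field_simp
  linear_combination 2 * hPq

/-- The lift is φ = arg E(1) + ∫q, which is legitimate since q is real and positive on the circle.
With p = iP one has p' = −zP' and p² = −P², so the Schwarzian formula becomes an identity between
real functions. -/
theorem exists_lift (hE : IsCircleMap E a) : ∃ φ q p p' : ℝ → ℝ, IsCircleLift φ q p p' ∧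
    (∀ θ : ℝ, expI (φ θ : ℝ) = E (expI θ)) ∧ (∀ θ : ℝ, (q θ : ℂ) = angularDeriv E (expI θ)) ∧
    ∀ θ : ℝ, expI θ ^ 2 * schwarzian E (expI θ)
      = ((1 / 2 - q θ ^ 2 / 2 - (p' θ - p θ ^ 2 / 2) : ℝ) : ℂ) := by
  have hmem : ∀ θ : ℝ, expI θ ∈ annulus a a⁻¹ := fun θ => hE.mem_annulus_of_norm (norm_expI θ)
  set q : ℝ → ℝ := fun θ => (angularDeriv E (expI θ)).re with hq
  have hqC : ∀ θ : ℝ, (q θ : ℂ) = angularDeriv E (expI θ) := fun θ =>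
    Complex.ext rfl (hE.angularDeriv_re_pos (norm_expI θ)).2.symm
  have hqpos : ∀ θ, 0 < q θ := fun θ => (hE.angularDeriv_re_pos (norm_expI θ)).1
  set p : ℝ → ℝ := fun θ => (Complex.I * angularLogDeriv E (expI θ)).re with hp
  have hqd : ∀ θ : ℝ, HasDerivAt q (p θ * q θ) θ
      ∧ (p θ : ℂ) = Complex.I * angularLogDeriv E (expI θ) := fun θ => by
    have h1 := hasDerivAt_comp_expI (hE.analyticAt_angularDeriv (hmem θ))
    rw [← funext hqC] at h1
    obtain ⟨h2, h3⟩ := hasDerivAt_of_ofReal h1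
    have h4 : Complex.I * (expI θ * deriv (angularDeriv E) (expI θ))
        = Complex.I * angularLogDeriv E (expI θ) * (q θ : ℂ) := by
      rw [hqC, angularLogDeriv, mul_assoc, div_mul_cancel₀ _ (hE.angularDeriv_ne_zero (norm_expI θ))]
    rw [h4] at h2 h3
    rw [Complex.re_mul_ofReal] at h2 h3
    refine ⟨h2, ?_⟩
    rw [Complex.ofReal_mul] at h3
    exact mul_right_cancel₀ (by exact_mod_cast (hqpos θ).ne') h3
  set p' : ℝ → ℝ := fun θ => (-(expI θ * deriv (angularLogDeriv E) (expI θ))).re with hp'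
  have hpd : ∀ θ : ℝ, HasDerivAt p (p' θ) θ
      ∧ (p' θ : ℂ) = -(expI θ * deriv (angularLogDeriv E) (expI θ)) := fun θ => by
    have h1 := (hasDerivAt_comp_expI (hE.analyticAt_angularLogDeriv (norm_expI θ))).const_mul
      Complex.I
    rw [← funext fun θ => (hqd θ).2, ← mul_assoc, Complex.I_mul_I, neg_one_mul] at h1
    exact hasDerivAt_of_ofReal h1
  have hqc : Continuous q := continuous_iff_continuousAt.2 fun θ => (hqd θ).1.continuousAt
  have hexpc : Continuous fun θ : ℝ => expI θ :=
    continuous_iff_continuousAt.2 fun θ => (hasDerivAt_expI θ).continuousAt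
  have hp'c : Continuous p' := by
    refine Complex.continuous_re.comp (hexpc.mul ?_).neg
    exact continuous_iff_continuousAt.2 fun θ =>
      ((hE.analyticAt_angularLogDeriv (norm_expI θ)).deriv.continuousAt.comp
        (f := fun θ : ℝ => expI θ) hexpc.continuousAt)
  set φ : ℝ → ℝ := fun θ => (E (expI (0 : ℝ))).arg + ∫ u in (0 : ℝ)..θ, q u with hφ
  have hφd : ∀ θ, HasDerivAt φ (q θ) θ := fun θ =>
    (hqc.integral_hasStrictDerivAt 0 θ).hasDerivAt.const_add _
  have hφE : ∀ θ : ℝ, expI (φ θ : ℝ) = E (expI θ) := fun θ => by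
    -- E(e^{iθ}) e^{−iφ(θ)} has zero derivative because zE' = qE, and it equals 1 at θ = 0.
    have hd : ∀ θ : ℝ, HasDerivAt (fun θ : ℝ => E (expI θ) * Complex.exp (-(φ θ * Complex.I))) 0 θ :=
      fun θ => by
        have h1 := hasDerivAt_comp_expI (hE.analyticAt (hmem θ))
        have h2 : HasDerivAt (fun θ : ℝ => Complex.exp (-(φ θ * Complex.I)))
            (Complex.exp (-(φ θ * Complex.I)) * (-(q θ * Complex.I))) θ :=
          (((hφd θ).ofReal_comp.mul_const Complex.I).neg).cexp
        have h3 := h1.mul h2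
        have h4 : expI θ * deriv E (expI θ) = q θ * E (expI θ) := by
          rw [hqC, angularDeriv, div_mul_cancel₀ _ (hE.ne_zero' (hmem θ))]
        rw [h4] at h3
        exact h3.congr_deriv (by ring)
    have h5 := is_const_of_deriv_eq_zero (fun θ => (hd θ).differentiableAt)
      (fun θ => (hd θ).deriv) θ 0
    have h6 : Complex.exp (φ 0 * Complex.I) = E (expI (0 : ℝ)) := by
      have : φ 0 = (E (expI (0 : ℝ))).arg := by simp [hφ]
      rw [this]
      have := Complex.norm_mul_exp_arg_mul_I (E (expI (0 : ℝ)))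
      rwa [hE.norm_eq _ (norm_expI _), Complex.ofReal_one, one_mul] at this
    simp only [Complex.exp_neg] at h5
    rw [h6, mul_inv_cancel₀ (hE.ne_zero' (hmem 0)), mul_inv_eq_one₀ (Complex.exp_ne_zero _)] at h5
    rw [expI_coe, h5]
  have hqper : Function.Periodic q (2 * Real.pi) := fun θ => by
    simp only [hq, AddCircle.coe_add_period]
  have hmono : StrictMono φ := strictMono_of_deriv_pos fun x => by
    rw [(hφd x).deriv]; exact hqpos x
  have hφc : Continuous φ := continuous_iff_continuousAt.2 fun x => (hφd x).continuousAt
  -- The total turning is 2πk with k ≥ 1 by monotonicity. If k ≥ 2, an intermediate θ would have the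
  -- same image as 0, against injectivity on the circle.
  have hturn : φ (2 * Real.pi) = φ 0 + 2 * Real.pi := by
    have h1 : expI (φ (2 * Real.pi) : ℝ) = expI (φ 0 : ℝ) := by
      rw [hφE, hφE, AddCircle.coe_period, AddCircle.coe_zero]
    rw [expI_coe, expI_coe, Complex.exp_eq_exp_iff_exists_int] at h1
    obtain ⟨k, hk⟩ := h1
    have hk' : φ (2 * Real.pi) = φ 0 + k * (2 * Real.pi) := by
      have : ((φ (2 * Real.pi) : ℝ) : ℂ) * Complex.I
          = ((φ 0 + k * (2 * Real.pi) : ℝ) : ℂ) * Complex.I := by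
        rw [hk]; push_cast; ring
      exact_mod_cast mul_right_cancel₀ Complex.I_ne_zero this
    have hlt := hmono Real.two_pi_pos
    have hk0 : 0 < k := by
      by_contra! hk0
      have : (k : ℝ) ≤ 0 := by exact_mod_cast hk0
      nlinarith [Real.two_pi_pos]
    have hk1 : k = 1 := by
      by_contra hne
      have hk2 : (2 : ℝ) ≤ k := by exact_mod_cast (by omega : 2 ≤ k)
      obtain ⟨θ, hθ, hθφ⟩ := intermediate_value_Ioo Real.two_pi_pos.le hφc.continuousOn
        (show φ 0 + 2 * Real.pi ∈ Ioo (φ 0) (φ (2 * Real.pi)) by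
          rw [hk']
          constructor <;> nlinarith [Real.two_pi_pos])
      have h2 : E (expI θ) = E (expI (0 : ℝ)) := by
        rw [← hφE, ← hφE, hθφ, AddCircle.coe_add_period]
      have h3 := hE.injOn_sphere (by simp [norm_expI]) (by simp [norm_expI]) h2
      rw [expI_coe, expI_coe, Complex.ofReal_zero, zero_mul, Complex.exp_zero,
        Complex.exp_eq_one_iff] at h3
      obtain ⟨n, hn⟩ := h3
      have hn' : θ = n * (2 * Real.pi) := by
        have : (θ : ℂ) * Complex.I = ((n * (2 * Real.pi) : ℝ) : ℂ) * Complex.I := by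
          rw [hn]; push_cast; ring
        exact_mod_cast mul_right_cancel₀ Complex.I_ne_zero this
      rw [hn'] at hθ
      have h4 : (0 : ℝ) < n := by
        by_contra! h
        nlinarith [hθ.1, Real.two_pi_pos]
      have h5 : (n : ℝ) < 1 := by
        by_contra! h
        nlinarith [hθ.2, Real.two_pi_pos]
      have h6 : 0 < n := by exact_mod_cast h4
      have h7 : n < 1 := by exact_mod_cast h5
      omega
    rw [hk', hk1]; simp
  refine ⟨φ, q, p, p', ⟨hφd, fun θ => (hqd θ).1, fun θ => (hpd θ).1, hp'c, hqpos, fun θ => ?_,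
    hqper, fun θ => by simp only [hp, AddCircle.coe_add_period]⟩, hφE, hqC, fun θ => ?_⟩
  · have hd : ∀ x, HasDerivAt (fun x => φ (x + 2 * Real.pi) - φ x) 0 x := fun x => by
      have := ((hφd (x + 2 * Real.pi)).comp_add_const x (2 * Real.pi)).sub (hφd x)
      rw [hqper x, sub_self] at this
      exact this
    have h1 := is_const_of_deriv_eq_zero (fun x => (hd x).differentiableAt)
      (fun x => (hd x).deriv) θ 0
    simp only [zero_add] at h1
    linarith
  · rw [hE.sq_mul_schwarzian (norm_expI θ)]
    push_cast
    rw [hqC, (hqd θ).2, (hpd θ).2, mul_pow, Complex.I_sq]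
    ring

/-- In the Schwarzian integral the terms ½ and −q²/2 integrate to half the masses of σ and of σ'
with opposite signs. The correction ⅛(|σ'| − |σ|) removes exactly these and leaves −¼∫ν²(p' − p²/2).
-/
theorem localEnergy_sub {σ σ' : Measure S1} {ν ν' : S1 → ℝ}
    {φ q p p' : ℝ → ℝ} (hφ : IsCircleLift φ q p p')
    (hS : ∀ θ : ℝ, expI θ ^ 2 * schwarzian E (expI θ)
      = ((1 / 2 - q θ ^ 2 / 2 - (p' θ - p θ ^ 2 / 2) : ℝ) : ℂ))
    (hν : IsSqrtDensity σ ν) (hν' : ∀ θ : ℝ, ν' (φ θ : ℝ) = √(q θ) * ν θ)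
    (hσ' : σ' = volume.withDensity fun θ => ENNReal.ofReal (ν' θ ^ 2)) :
    localEnergy σ' ≠ ∞ ∧
    (((localEnergy σ').toReal - (localEnergy σ).toReal : ℝ) : ℂ)
      = 1 / 4 * schwarzianIntegral E σ + 1 / 8 * ((σ'.real univ - σ.real univ : ℝ) : ℂ) := by
  obtain ⟨h1, h2⟩ := hφ.transport hν hν' hσ'
  have hm' := hφ.mass_transport h1 hν'
  have hm := hν.integral_eq (fun _ => (1 : ℝ))
  simp only [integral_const, smul_eq_mul, mul_one] at hm
  refine ⟨h1.localEnergy_toReal.1, ?_⟩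
  have hνc := hν.continuous_coe
  have hqc := hφ.continuous_q
  have hpc := hφ.continuous_p
  have hp'c := hφ.cont
  have hI : schwarzianIntegral E σ = ((2⁻¹ * (∫ θ in (0 : ℝ)..(2 * Real.pi), ν θ ^ 2)
      - 2⁻¹ * (∫ θ in (0 : ℝ)..(2 * Real.pi), ν θ ^ 2 * q θ ^ 2)
      - ∫ θ in (0 : ℝ)..(2 * Real.pi), ν θ ^ 2 * (p' θ - p θ ^ 2 / 2) : ℝ) : ℂ) := by
    rw [schwarzianIntegral, hν.integral_eq]
    simp only [hS, Complex.real_smul, ← Complex.ofReal_mul]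
    rw [intervalIntegral.integral_ofReal, ← intervalIntegral.integral_const_mul,
      ← intervalIntegral.integral_const_mul,
      ← intervalIntegral.integral_sub, ← intervalIntegral.integral_sub]
    · congr 2
      ext θ
      ring
    · exact (((hνc.pow 2).const_mul _).sub
        (((hνc.pow 2).mul (hqc.pow 2)).const_mul _)).intervalIntegrable _ _
    · exact ((hνc.pow 2).mul (hp'c.sub ((hpc.pow 2).div_const 2))).intervalIntegrable _ _
    · exact ((hνc.pow 2).const_mul _).intervalIntegrable _ _
    · exact (((hνc.pow 2).mul (hqc.pow 2)).const_mul _).intervalIntegrable _ _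
  rw [hI, h1.localEnergy_toReal.2, hν.localEnergy_toReal.2, h2, hm', hm]
  push_cast
  ring

end IsCircleMap

end LoewnerKufarev

/-! ### Poisson integrals and recovery of a measure from its Herglotz integral -/

namespace LoewnerKufarev

open Filter Topology ComplexConjugate

/-- The Poisson kernel of the unit disk, as a function of the disk and the circle. -/
noncomputable def poisson (z : ℂ) (θ : S1) : ℝ := (1 - ‖z‖ ^ 2) / ‖expI θ - z‖ ^ 2

theorem expI_sub_ne_zero {z : ℂ} (hz : z ∈ ball (0 : ℂ) 1) (θ : S1) : expI θ - z ≠ 0 := fun h => by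
  rw [mem_ball_zero_iff, ← sub_eq_zero.1 h, norm_expI] at hz
  exact lt_irrefl _ hz

theorem re_herglotz_kernel (z : ℂ) (θ : S1) :
    ((expI θ + z) / (expI θ - z)).re = poisson z θ := by
  have h := congrFun (poissonKernel_eq_re_herglotzRieszKernel (c := 0) (w := z)) (expI θ)
  simp only [poissonKernel, herglotzRieszKernel, Function.comp_apply, sub_zero, norm_expI,
    one_pow] at h
  exact h.symm

theorem one_sub_norm_sq_pos {z : ℂ} (hz : z ∈ ball (0 : ℂ) 1) : 0 < 1 - ‖z‖ ^ 2 := by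
  rw [mem_ball_zero_iff] at hz
  nlinarith [norm_nonneg z]

theorem poisson_nonneg {z : ℂ} (hz : z ∈ ball (0 : ℂ) 1) (θ : S1) : 0 ≤ poisson z θ :=
  div_nonneg (one_sub_norm_sq_pos hz).le (sq_nonneg _)

theorem continuous_poisson {z : ℂ} (hz : z ∈ ball (0 : ℂ) 1) : Continuous (poisson z) :=
  continuous_const.div (((continuous_expI.sub continuous_const).norm).pow 2) fun θ =>
    pow_ne_zero 2 (norm_ne_zero_iff.2 (expI_sub_ne_zero hz θ))

theorem continuous_herglotz_kernel {z : ℂ} (hz : z ∈ ball (0 : ℂ) 1) :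
    Continuous fun θ => (expI θ + z) / (expI θ - z) :=
  (continuous_expI.add continuous_const).div (continuous_expI.sub continuous_const)
    (expI_sub_ne_zero hz)

theorem integrable_of_continuous {G : Type*} [NormedAddCommGroup G]
    {μ : Measure S1} [IsFiniteMeasure μ] {g : S1 → G} (hg : Continuous g) : Integrable g μ := by
  obtain ⟨C, hC⟩ := isCompact_univ.exists_bound_of_continuousOn hg.continuousOn
  exact Integrable.of_bound (hg.aestronglyMeasurable_of_compactSpace)
    C (Eventually.of_forall fun x => hC x (mem_univ x))

theorem integral_poisson_smul {f : ℂ → ℂ} (hf : DiffContOnCl ℂ f (ball 0 1)) {z : ℂ}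
    (hz : z ∈ ball (0 : ℂ) 1) : ∫ θ : S1, poisson z θ • f (expI θ) = (2 * Real.pi) • f z := by
  have h := hf.circleAverage_poissonKernel_smul' hz
  have h2 := AddCircle.intervalIntegral_preimage (2 * Real.pi) 0
    (fun θ : S1 => poisson z θ • f (expI θ))
  rw [zero_add] at h2
  rw [← h2, ← h, Real.circleAverage_def, smul_smul, mul_inv_cancel₀ Real.two_pi_pos.ne', one_smul]
  congr 1
  ext θ
  simp only [poisson, expI_coe, circleMap, sub_zero, zero_add, Complex.ofReal_one, one_mul,
    Complex.norm_exp_ofReal_mul_I, one_pow]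

theorem integral_poisson {z : ℂ} (hz : z ∈ ball (0 : ℂ) 1) :
    ∫ θ : S1, poisson z θ = 2 * Real.pi := by
  have h := integral_poisson_smul (f := fun _ => 1) diffContOnCl_const hz
  simp only [Complex.real_smul, mul_one] at h
  rw [integral_complex_ofReal] at h
  exact_mod_cast h

theorem two_pi_mul_eq_integral_poisson {z : ℂ} (hz : z ∈ ball (0 : ℂ) 1) (c : ℝ) :
    2 * Real.pi * c = ∫ θ : S1, poisson z θ * c := by
  rw [integral_mul_const, integral_poisson hz]

theorem norm_sub_sq_of_norm_one {u v : ℂ} (hu : ‖u‖ = 1) (hv : ‖v‖ = 1) :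
    ‖u - v‖ ^ 2 = 2 - 2 * (u * conj v).re := by
  rw [← Complex.normSq_eq_norm_sq, Complex.normSq_sub, Complex.normSq_eq_norm_sq,
    Complex.normSq_eq_norm_sq, hu, hv]
  ring

/-- On the circle |u − e^{iα}|² is the real part of the affine function 2 − 2u e^{−iα}, which the
Poisson kernel reproduces. This is the variance used to prove concentration. -/
theorem integral_poisson_mul_sq {z : ℂ} (hz : z ∈ ball (0 : ℂ) 1) (α : S1) :
    ∫ θ : S1, poisson z θ * ‖expI θ - expI α‖ ^ 2
      = 2 * Real.pi * (2 - 2 * (z * conj (expI α)).re) := by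
  have hd : Differentiable ℂ fun w : ℂ => 2 - 2 * (w * conj (expI α)) := by fun_prop
  have h := congrArg Complex.re (integral_poisson_smul hd.diffContOnCl hz)
  have hint : Integrable fun θ : S1 => poisson z θ • (2 - 2 * (expI θ * conj (expI α))) := by
    refine integrable_of_continuous ((continuous_poisson hz).smul ?_)
    exact continuous_const.sub (continuous_const.mul (continuous_expI.mul continuous_const))
  rw [← Complex.reCLM_apply, ← Complex.reCLM.integral_comp_comm hint] at h
  simp only [Complex.reCLM_apply, Complex.smul_re, smul_eq_mul] at h
  convert h using 2
  · ext θ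
    rw [norm_sub_sq_of_norm_one (norm_expI θ) (norm_expI α)]
    simp
  · simp

/-- A Korovkin argument: by compactness |k(θ) − k(α)| ≤ ε + C|e^{iθ} − e^{iα}|², and both terms on
the right have explicit Poisson integrals. -/
theorem abs_integral_poisson_sub_le {k : S1 → ℝ} (hk : Continuous k) (α : S1) {ε : ℝ}
    (hε : 0 < ε) : ∃ C, ∀ z ∈ ball (0 : ℂ) 1,
      |(∫ θ : S1, poisson z θ * k θ) - 2 * Real.pi * k α|
        ≤ 2 * Real.pi * ε + C * (2 * Real.pi * (2 - 2 * (z * conj (expI α)).re)) := by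
  have hinj : Function.Injective expI := fun x y h =>
    AddCircle.injective_toCircle Real.two_pi_pos.ne' (Subtype.ext h)
  set N : Set S1 := {θ | |k θ - k α| < ε} with hN
  have hNo : IsOpen N := isOpen_lt (by fun_prop) continuous_const
  have hαN : α ∈ N := by simp [hN, hε]
  have hc : ContinuousOn (fun θ => |k θ - k α| / ‖expI θ - expI α‖ ^ 2) Nᶜ := by
    refine ContinuousOn.div (by fun_prop)
      (((continuous_expI.sub continuous_const).norm.pow 2).continuousOn) fun θ hθ => ?_
    refine pow_ne_zero 2 (norm_ne_zero_iff.2 (sub_ne_zero.2 fun h => hθ ?_))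
    rw [hinj h]; exact hαN
  obtain ⟨C, hC⟩ := (hNo.isClosed_compl.isCompact).exists_bound_of_continuousOn hc
  have hbound : ∀ θ, |k θ - k α| ≤ ε + |C| * ‖expI θ - expI α‖ ^ 2 := fun θ => by
    by_cases hθ : θ ∈ N
    · have h1 : |k θ - k α| < ε := hθ
      have : 0 ≤ |C| * ‖expI θ - expI α‖ ^ 2 := by positivity
      linarith
    · have h1 := (hC θ hθ).trans (le_abs_self C)
      have hpos : 0 < ‖expI θ - expI α‖ ^ 2 := by
        refine pow_pos (norm_pos_iff.2 (sub_ne_zero.2 fun h => hθ ?_)) 2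
        rw [hinj h]; exact hαN
      rw [Real.norm_of_nonneg (by positivity), div_le_iff₀ hpos] at h1
      linarith
  refine ⟨|C|, fun z hz => ?_⟩
  have hp := continuous_poisson hz
  have hec : Continuous fun θ : S1 => ‖expI θ - expI α‖ ^ 2 :=
    (continuous_expI.sub continuous_const).norm.pow 2
  rw [← integral_poisson_mul_sq hz α, two_pi_mul_eq_integral_poisson hz ε,
    two_pi_mul_eq_integral_poisson hz (k α), ← integral_const_mul, ← integral_sub, ← integral_add]
  · rw [← Real.norm_eq_abs]
    refine (norm_integral_le_integral_norm _).trans (integral_mono ?_ ?_ fun θ => ?_)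
    · exact integrable_of_continuous (by fun_prop)
    · exact integrable_of_continuous (by fun_prop)
    · simp only [Real.norm_eq_abs]
      rw [← mul_sub, abs_mul, abs_of_nonneg (poisson_nonneg hz θ)]
      have := mul_le_mul_of_nonneg_left (hbound θ) (poisson_nonneg hz θ)
      linarith
  all_goals exact integrable_of_continuous (by fun_prop)

theorem tendsto_integral_poisson {k : S1 → ℝ} (hk : Continuous k) (α : S1) :
    Tendsto (fun z => ∫ θ : S1, poisson z θ * k θ) (𝓝[ball 0 1] (expI α))
      (𝓝 (2 * Real.pi * k α)) := by
  rw [Metric.tendsto_nhds]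
  intro η hη
  obtain ⟨C, hC⟩ := abs_integral_poisson_sub_le hk α (ε := η / (4 * Real.pi))
    (by have := Real.pi_pos; positivity)
  have hlim : Tendsto (fun z => C * (2 * Real.pi * (2 - 2 * (z * conj (expI α)).re)))
      (𝓝[ball 0 1] (expI α)) (𝓝 0) := by
    have hc : Continuous fun z => C * (2 * Real.pi * (2 - 2 * (z * conj (expI α)).re)) := by
      fun_prop
    have h := hc.tendsto (expI α)
    rw [Complex.mul_conj', norm_expI] at h
    simp only [Complex.ofReal_one, one_pow, Complex.one_re, mul_one, sub_self, mul_zero] at h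
    exact h.mono_left nhdsWithin_le_nhds
  filter_upwards [hlim.eventually (gt_mem_nhds (half_pos hη)), self_mem_nhdsWithin] with z h1 h2
  rw [Real.dist_eq]
  refine (hC z h2).trans_lt ?_
  have : 2 * Real.pi * (η / (4 * Real.pi)) = η / 2 := by
    have := Real.pi_pos.ne'
    field_simp
    ring
  linarith

theorem re_herglotz (σ : Measure S1) [IsFiniteMeasure σ] {z : ℂ} (hz : z ∈ ball (0 : ℂ) 1) :
    (herglotz σ z).re = ∫ θ, poisson z θ ∂σ := by
  rw [herglotz, ← Complex.reCLM_apply, ← Complex.reCLM.integral_comp_comm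
    (integrable_of_continuous (continuous_herglotz_kernel hz))]
  simp only [Complex.reCLM_apply, re_herglotz_kernel]

/-- This symmetry lets Fubini move the Poisson average from the measure to the test function. -/
theorem poisson_symm (r : ℝ) (θ α : S1) :
    poisson (r * expI θ) α = poisson (r * expI α) θ := by
  simp only [poisson, norm_mul, norm_expI]
  congr 2
  rw [← sq_eq_sq₀ (norm_nonneg _) (norm_nonneg _), ← Complex.normSq_eq_norm_sq,
    ← Complex.normSq_eq_norm_sq, Complex.normSq_sub, Complex.normSq_sub]
  simp only [Complex.normSq_eq_norm_sq, norm_expI, map_mul, Complex.conj_ofReal,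
    Complex.mul_re, Complex.mul_im, Complex.conj_re, Complex.conj_im, Complex.ofReal_re,
    Complex.ofReal_im]
  ring

theorem mul_expI_mem_ball {r : ℝ} (hr : r ∈ Ioo (0 : ℝ) 1) (θ : S1) :
    r * expI θ ∈ ball (0 : ℂ) 1 := by
  rw [mem_ball_zero_iff, norm_mul, norm_expI, mul_one, Complex.norm_real,
    Real.norm_of_nonneg hr.1.le]
  exact hr.2

theorem tendsto_mul_expI (θ : S1) :
    Tendsto (fun r : ℝ => r * expI θ) (𝓝[<] 1) (𝓝[ball 0 1] (expI θ)) := by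
  refine tendsto_nhdsWithin_iff.2 ⟨?_, ?_⟩
  · have h : ContinuousAt (fun r : ℝ => r * expI θ) 1 := by fun_prop
    have := h.tendsto
    simp only [Complex.ofReal_one, one_mul] at this
    exact this.mono_left nhdsWithin_le_nhds
  · filter_upwards [nhdsWithin_le_nhds (lt_mem_nhds one_pos), self_mem_nhdsWithin] with r h1 h2
    exact mul_expI_mem_ball ⟨h1, h2⟩ θ

theorem continuous_poisson_prod {r : ℝ} (hr : r ∈ Ioo (0 : ℝ) 1) :
    Continuous fun x : S1 × S1 => poisson (r * expI x.1) x.2 := by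
  have h1 : Continuous fun x : S1 × S1 => expI x.1 := continuous_expI.comp continuous_fst
  have h2 : Continuous fun x : S1 × S1 => expI x.2 := continuous_expI.comp continuous_snd
  refine Continuous.div (by fun_prop) (by fun_prop) fun x => ?_
  exact pow_ne_zero 2 (norm_ne_zero_iff.2 (expI_sub_ne_zero (mul_expI_mem_ball hr x.1) x.2))

theorem integral_mul_re_herglotz (σ : Measure S1) [IsFiniteMeasure σ] {k : S1 → ℝ}
    (hk : Continuous k) {r : ℝ} (hr : r ∈ Ioo (0 : ℝ) 1) :
    ∫ θ : S1, k θ * (herglotz σ (r * expI θ)).re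
      = ∫ α, (∫ θ : S1, poisson (r * expI α) θ * k θ) ∂σ := by
  have h1 : ∀ θ : S1, k θ * (herglotz σ (r * expI θ)).re
      = ∫ α, k θ * poisson (r * expI θ) α ∂σ := fun θ => by
    rw [re_herglotz σ (mul_expI_mem_ball hr θ), integral_const_mul]
  simp only [h1]
  rw [integral_integral_swap]
  · simp only [poisson_symm r, mul_comm (k _)]
  · have hc : Continuous fun x : S1 × S1 => k x.1 * poisson (r * expI x.1) x.2 :=
      (hk.comp continuous_fst).mul (continuous_poisson_prod hr)
    obtain ⟨C, hC⟩ := isCompact_univ.exists_bound_of_continuousOn hc.continuousOn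
    exact Integrable.of_bound hc.aestronglyMeasurable C
      (Eventually.of_forall fun x => hC x (mem_univ x))

/-- Test both measures against a continuous k. By Fubini ∫k Re H[σ](re^{iθ}) dθ is the σ-integral of
the Poisson integral of k, which tends to 2π∫k dσ as r → 1. By the hypothesis on boundary values it
also tends to 2π∫kB dθ. -/
theorem eq_withDensity_of_tendsto_re_herglotz {σ : Measure S1} [IsFiniteMeasure σ] {B : S1 → ℝ}
    (hB : Continuous B) (hB0 : ∀ θ, 0 ≤ B θ)
    (hlim : ∀ θ, Tendsto (fun z => (herglotz σ z).re) (𝓝[ball 0 1] (expI θ))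
      (𝓝 (2 * Real.pi * B θ)))
    (hcont : ContinuousOn (fun z => (herglotz σ z).re) (ball 0 1)) :
    σ = volume.withDensity fun θ => ENNReal.ofReal (B θ) := by
  have hfin : IsFiniteMeasure (volume.withDensity fun θ => ENNReal.ofReal (B θ)) := by
    refine isFiniteMeasure_withDensity ?_
    exact (integrable_of_continuous hB).lintegral_lt_top.ne
  refine ext_of_forall_integral_eq_of_IsFiniteMeasure fun k => ?_
  have hkc : Continuous k := k.continuous
  rw [integral_withDensity_eq_integral_toReal_smul (by fun_prop) (by simp)]
  simp only [ENNReal.toReal_ofReal (hB0 _), smul_eq_mul]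
  have hin : ∀ᶠ r : ℝ in 𝓝[<] 1, r ∈ Ioo (0 : ℝ) 1 := by
    filter_upwards [nhdsWithin_le_nhds (lt_mem_nhds one_pos), self_mem_nhdsWithin] with r h1 h2
    exact ⟨h1, h2⟩
  have L1 : Tendsto (fun r : ℝ => ∫ α, (∫ θ : S1, poisson (r * expI α) θ * k θ) ∂σ) (𝓝[<] 1)
      (𝓝 (∫ α, 2 * Real.pi * k α ∂σ)) := by
    refine tendsto_integral_filter_of_dominated_convergence (fun _ => 2 * Real.pi * ‖k‖) ?_ ?_
      (integrable_const _) (Eventually.of_forall fun α =>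
        (tendsto_integral_poisson hkc α).comp (tendsto_mul_expI α))
    · filter_upwards [hin] with r hr
      have hc : Continuous fun x : S1 × S1 => poisson (r * expI x.1) x.2 * k x.2 :=
        (continuous_poisson_prod hr).mul (hkc.comp continuous_snd)
      exact hc.stronglyMeasurable.integral_prod_right.aestronglyMeasurable
    · filter_upwards [hin] with r hr
      refine Eventually.of_forall fun α => ?_
      have hz := mul_expI_mem_ball hr α
      have hpc := continuous_poisson hz
      rw [two_pi_mul_eq_integral_poisson hz]
      refine (norm_integral_le_integral_norm _).trans (integral_mono
        (integrable_of_continuous (by fun_prop)) (integrable_of_continuous (by fun_prop))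
        fun θ => ?_)
      simp only [norm_mul, Real.norm_of_nonneg (poisson_nonneg hz θ)]
      exact mul_le_mul_of_nonneg_left (k.norm_coe_le_norm θ) (poisson_nonneg hz θ)
  have L2 : Tendsto (fun r : ℝ => ∫ θ : S1, k θ * (herglotz σ (r * expI θ)).re) (𝓝[<] 1)
      (𝓝 (∫ θ : S1, k θ * (2 * Real.pi * B θ))) := by
    -- Limits along the whole disk at every boundary point give a continuous extension to the closed
    -- disk, hence the uniform bound needed for dominated convergence.
    have hext : ContinuousOn (extendFrom (ball (0 : ℂ) 1) fun z => (herglotz σ z).re)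
        (closedBall 0 1) := by
      refine continuousOn_extendFrom (by rw [closure_ball _ one_ne_zero]) fun z hz => ?_
      rcases (mem_closedBall_zero_iff.1 hz).lt_or_eq with h | h
      · exact ⟨_, hcont z (by simpa using h)⟩
      · have : z = expI (z.arg : ℝ) := by
          rw [expI_coe]
          have := Complex.norm_mul_exp_arg_mul_I z
          rw [h, Complex.ofReal_one, one_mul] at this
          exact this.symm
        rw [this]
        exact ⟨_, hlim _⟩
    obtain ⟨C, hC⟩ := (isCompact_closedBall (0 : ℂ) 1).exists_bound_of_continuousOn hext
    have hC' : ∀ z ∈ ball (0 : ℂ) 1, ‖(herglotz σ z).re‖ ≤ C := fun z hz => by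
      have h1 := hC z (ball_subset_closedBall hz)
      rwa [extendFrom_eq (subset_closure hz) (hcont z hz)] at h1
    refine tendsto_integral_filter_of_dominated_convergence (fun _ => ‖k‖ * C) ?_ ?_
      (integrable_const _) (Eventually.of_forall fun θ =>
        ((hlim θ).comp (tendsto_mul_expI θ)).const_mul _)
    · filter_upwards [hin] with r hr
      refine (hkc.mul (hcont.comp_continuous (continuous_const.mul continuous_expI)
        fun θ => mul_expI_mem_ball hr θ)).aestronglyMeasurable
    · filter_upwards [hin] with r hr
      refine Eventually.of_forall fun θ => ?_
      rw [norm_mul]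
      exact mul_le_mul (k.norm_coe_le_norm θ) (hC' _ (mul_expI_mem_ball hr θ)) (norm_nonneg _)
        (norm_nonneg _)
  have L3 := L1.congr' (hin.mono fun r hr => (integral_mul_re_herglotz σ hkc hr).symm)
  have h := tendsto_nhds_unique L3 L2
  rw [integral_const_mul] at h
  have h2 : ∫ θ : S1, k θ * (2 * Real.pi * B θ) = 2 * Real.pi * ∫ θ : S1, B θ * k θ := by
    rw [← integral_const_mul]
    congr 1
    ext θ
    ring
  rw [h2] at h
  exact mul_left_cancel₀ Real.two_pi_pos.ne' h

end LoewnerKufarev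

/-! ### Boundary growth of the Herglotz integral and the transported density -/

namespace LoewnerKufarev

open Filter Topology ComplexConjugate

theorem one_sub_norm_le_norm_expI_sub (z : ℂ) (θ : S1) : 1 - ‖z‖ ≤ ‖expI θ - z‖ := by
  have := norm_sub_norm_le (expI θ) z
  rwa [norm_expI] at this

theorem norm_herglotz_kernel_le {z : ℂ} (hz : z ∈ ball (0 : ℂ) 1) (θ : S1) :
    ‖(expI θ + z) / (expI θ - z)‖ ≤ 2 / ‖expI θ - z‖ := by
  rw [norm_div]
  rw [mem_ball_zero_iff] at hz
  gcongr
  calc ‖expI θ + z‖ ≤ ‖expI θ‖ + ‖z‖ := norm_add_le _ _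
    _ ≤ 2 := by rw [norm_expI]; linarith

theorem norm_herglotz_kernel_le' {z : ℂ} (hz : z ∈ ball (0 : ℂ) 1) (θ : S1) :
    ‖(expI θ + z) / (expI θ - z)‖ ≤ 2 / (1 - ‖z‖) := by
  refine (norm_herglotz_kernel_le hz θ).trans ?_
  have h1 := one_sub_norm_le_norm_expI_sub z θ
  have h2 : 0 < 1 - ‖z‖ := sub_pos.2 (mem_ball_zero_iff.1 hz)
  gcongr

theorem norm_herglotz_le (σ : Measure S1) [IsFiniteMeasure σ] {z : ℂ} (hz : z ∈ ball (0 : ℂ) 1) :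
    ‖herglotz σ z‖ ≤ 2 / (1 - ‖z‖) * σ.real univ :=
  norm_integral_le_of_norm_le_const (Eventually.of_forall (norm_herglotz_kernel_le' hz))

theorem continuousOn_herglotz (σ : Measure S1) [IsFiniteMeasure σ] :
    ContinuousOn (herglotz σ) (ball 0 1) := by
  intro z₀ hz₀
  obtain ⟨r, hr0, hr1⟩ := exists_between (mem_ball_zero_iff.1 hz₀)
  have hn : ball (0 : ℂ) r ∈ 𝓝 z₀ := isOpen_ball.mem_nhds (mem_ball_zero_iff.2 hr0)
  have hsub : ball (0 : ℂ) r ⊆ ball 0 1 := ball_subset_ball hr1.le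
  refine ContinuousAt.continuousWithinAt (continuousAt_of_dominated
    (bound := fun _ => 2 / (1 - r)) ?_ ?_ (integrable_const _) (Eventually.of_forall fun θ => ?_))
  · filter_upwards [hn] with z hz
    exact (continuous_herglotz_kernel (hsub hz)).aestronglyMeasurable
  · filter_upwards [hn] with z hz
    refine Eventually.of_forall fun θ => (norm_herglotz_kernel_le' (hsub hz) θ).trans ?_
    rw [mem_ball_zero_iff] at hz
    have : 0 < 1 - r := sub_pos.2 hr1
    gcongr
  · exact ContinuousAt.div (by fun_prop) (by fun_prop) (expI_sub_ne_zero hz₀ θ)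

namespace IsSqrtDensity

variable {σ : Measure S1} {ν : S1 → ℝ}

theorem integral_eq_volume {G : Type*} [NormedAddCommGroup G] [NormedSpace ℝ G]
    (h : IsSqrtDensity σ ν) (g : S1 → G) : ∫ θ, g θ ∂σ = ∫ θ : S1, (ν θ ^ 2) • g θ := by
  have hc := h.continuous
  rw [h.density, integral_withDensity_eq_integral_toReal_smul (by fun_prop) (by simp)]
  simp only [ENNReal.toReal_ofReal (sq_nonneg _)]

theorem tendsto_re_herglotz [IsFiniteMeasure σ] (h : IsSqrtDensity σ ν) (α : S1) :
    Tendsto (fun z => (herglotz σ z).re) (𝓝[ball 0 1] (expI α))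
      (𝓝 (2 * Real.pi * ν α ^ 2)) := by
  have hc := h.continuous
  refine (tendsto_integral_poisson (k := fun θ => ν θ ^ 2) (by fun_prop) α).congr' ?_
  filter_upwards [self_mem_nhdsWithin] with z hz
  rw [re_herglotz σ hz, h.integral_eq_volume]
  simp only [smul_eq_mul, mul_comm]

/-- With s = √(1 − |z|²), the arithmetic-geometric mean inequality gives 2/|e^{iθ} − z| ≤ (1 +
P_z(θ))/s, where P_z is the Poisson kernel of integral 2π. A bounded density then costs only a
factor 1/s. -/
theorem exists_norm_herglotz_le (h : IsSqrtDensity σ ν) : ∃ C, ∀ z ∈ ball (0 : ℂ) 1,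
    ‖herglotz σ z‖ ≤ C / √(1 - ‖z‖ ^ 2) := by
  have hc := h.continuous
  obtain ⟨M, hM⟩ := isCompact_univ.exists_bound_of_continuousOn (f := fun θ => ν θ ^ 2)
    (by fun_prop)
  refine ⟨M * (4 * Real.pi), fun z hz => ?_⟩
  have hM0 : 0 ≤ M := (norm_nonneg _).trans (hM 0 (mem_univ _))
  have hpos := one_sub_norm_sq_pos hz
  set s := √(1 - ‖z‖ ^ 2) with hs
  have hs0 : 0 < s := Real.sqrt_pos.2 hpos
  have hpc := continuous_poisson hz
  have hkc := continuous_herglotz_kernel hz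
  have hk : ∀ θ, ‖(expI θ + z) / (expI θ - z)‖ ≤ (1 + poisson z θ) / s := fun θ => by
    refine (norm_herglotz_kernel_le hz θ).trans ?_
    have hn : 0 < ‖expI θ - z‖ := norm_pos_iff.2 (expI_sub_ne_zero hz θ)
    have hp : poisson z θ = s ^ 2 / ‖expI θ - z‖ ^ 2 := by
      rw [poisson, hs, Real.sq_sqrt hpos.le]
    rw [hp, div_le_div_iff₀ hn hs0]
    have : 0 ≤ (s - ‖expI θ - z‖) ^ 2 / ‖expI θ - z‖ := by positivity
    have e : (1 + s ^ 2 / ‖expI θ - z‖ ^ 2) * ‖expI θ - z‖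
        = 2 * s + (s - ‖expI θ - z‖) ^ 2 / ‖expI θ - z‖ := by
      field_simp
      ring
    linarith
  have e : M * (4 * Real.pi) / s = ∫ θ : S1, M * ((1 + poisson z θ) / s) := by
    rw [integral_const_mul, integral_div, integral_add (integrable_const _)
      (integrable_of_continuous hpc), integral_poisson hz]
    simp only [integral_const, Measure.real, AddCircle.measure_univ,
      ENNReal.toReal_ofReal Real.two_pi_pos.le, smul_eq_mul]
    ring
  rw [herglotz, h.integral_eq_volume, e]
  refine (norm_integral_le_integral_norm _).trans (integral_mono
    (integrable_of_continuous (by fun_prop)) (integrable_of_continuous (by fun_prop)) fun θ => ?_)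
  simp only [norm_smul]
  exact mul_le_mul (hM θ (mem_univ θ)) (hk θ) (norm_nonneg _) hM0

/-- Only Re H has known boundary values. Im H may grow like (1 − |z|²)^{−1/2}, but q is real on the
circle, so Im q = O(1 − |z|) and the product of imaginary parts vanishes in the limit. -/
theorem tendsto_re_mul_herglotz [IsFiniteMeasure σ] (h : IsSqrtDensity σ ν) {q : ℂ → ℂ} (α : S1)
    (hq : AnalyticAt ℂ q (expI α)) (hq0 : ∀ ζ : ℂ, ‖ζ‖ = 1 → (q ζ).im = 0) :
    Tendsto (fun z => (q z * herglotz σ z).re) (𝓝[ball 0 1] (expI α))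
      (𝓝 ((q (expI α)).re * (2 * Real.pi * ν α ^ 2))) := by
  set ζ := expI α with hζ
  have hζ1 : ‖ζ‖ = 1 := norm_expI α
  have hζ0 : ζ ≠ 0 := by rw [← norm_pos_iff, hζ1]; exact one_pos
  obtain ⟨C, hC⟩ := h.exists_norm_herglotz_le
  have hC0 : 0 ≤ C := by
    have := hC 0 (mem_ball_self one_pos)
    rw [norm_zero] at this
    norm_num at this
    exact (norm_nonneg _).trans this
  obtain ⟨K, N, hN, hK⟩ := (hq.contDiffAt (n := 1)).exists_lipschitzOnWith (𝕂 := ℂ)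
  have hproj : Tendsto (fun z : ℂ => z / (‖z‖ : ℂ)) (𝓝 ζ) (𝓝 ζ) := by
    have hc : ContinuousAt (fun z : ℂ => z / (‖z‖ : ℂ)) ζ :=
      ContinuousAt.div (by fun_prop) (by fun_prop) (by rw [hζ1]; simp)
    have := hc.tendsto
    rwa [hζ1, Complex.ofReal_one, div_one] at this
  have him : Tendsto (fun z => (q z).im * (herglotz σ z).im) (𝓝[ball 0 1] ζ) (𝓝 0) := by
    have hlim : Tendsto (fun z : ℂ => K * C * √(1 - ‖z‖ ^ 2)) (𝓝[ball 0 1] ζ) (𝓝 0) := by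
      have hc : Continuous fun z : ℂ => K * C * √(1 - ‖z‖ ^ 2) := by fun_prop
      have := hc.tendsto ζ
      rw [hζ1] at this
      simp only [one_pow, sub_self, Real.sqrt_zero, mul_zero] at this
      exact this.mono_left nhdsWithin_le_nhds
    refine squeeze_zero_norm' ?_ hlim
    filter_upwards [self_mem_nhdsWithin, nhdsWithin_le_nhds hN,
      nhdsWithin_le_nhds (hproj.eventually hN),
      nhdsWithin_le_nhds (isOpen_compl_singleton.mem_nhds hζ0)] with z hz hzN hzN' hz0
    have hz0' : ‖z‖ ≠ 0 := norm_ne_zero_iff.2 hz0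
    have hpos := one_sub_norm_sq_pos hz
    have hs0 : 0 < √(1 - ‖z‖ ^ 2) := Real.sqrt_pos.2 hpos
    have hz1 : ‖z‖ < 1 := mem_ball_zero_iff.1 hz
    -- Comparison with the radial projection z/|z|, where Im q = 0, by a local Lipschitz bound.
    have h1 : |(q z).im| ≤ K * (1 - ‖z‖) := by
      have hn : ‖z / (‖z‖ : ℂ)‖ = 1 := by
        rw [norm_div, Complex.norm_real, norm_norm, div_self hz0']
      have h2 := hK.dist_le_mul z hzN _ hzN'
      have h3 : dist z (z / (‖z‖ : ℂ)) = 1 - ‖z‖ := by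
        have e : z - z / (‖z‖ : ℂ) = ((1 - ‖z‖ : ℝ) : ℂ) * -(z / (‖z‖ : ℂ)) := by
          have : (‖z‖ : ℂ) ≠ 0 := by exact_mod_cast hz0'
          push_cast
          field_simp
          ring
        rw [dist_eq_norm, e, norm_mul, norm_neg, hn, mul_one, Complex.norm_real,
          Real.norm_of_nonneg (sub_nonneg.2 hz1.le)]
      rw [h3, dist_eq_norm] at h2
      have h4 : (q z).im = (q z - q (z / (‖z‖ : ℂ))).im := by
        rw [Complex.sub_im, hq0 _ hn, sub_zero]
      rw [h4]
      exact (Complex.abs_im_le_norm _).trans h2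
    have h5 : |(herglotz σ z).im| ≤ C / √(1 - ‖z‖ ^ 2) := (Complex.abs_im_le_norm _).trans (hC z hz)
    rw [norm_mul, Real.norm_eq_abs, Real.norm_eq_abs]
    calc |(q z).im| * |(herglotz σ z).im| ≤ K * (1 - ‖z‖) * (C / √(1 - ‖z‖ ^ 2)) := by
          gcongr
      _ ≤ K * (√(1 - ‖z‖ ^ 2) * √(1 - ‖z‖ ^ 2)) * (C / √(1 - ‖z‖ ^ 2)) := by
          rw [Real.mul_self_sqrt hpos.le]
          gcongr
          nlinarith [norm_nonneg z]
      _ = K * C * √(1 - ‖z‖ ^ 2) := by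
          field_simp
  have hre : Tendsto (fun z => (q z).re * (herglotz σ z).re) (𝓝[ball 0 1] ζ)
      (𝓝 ((q ζ).re * (2 * Real.pi * ν α ^ 2))) :=
    ((Complex.continuous_re.tendsto _).comp (hq.continuousAt.tendsto.mono_left
      nhdsWithin_le_nhds)).mul (h.tendsto_re_herglotz α)
  have := hre.sub him
  rw [sub_zero] at this
  simpa only [Complex.mul_re] using this

end IsSqrtDensity

theorem IsCircleLift.continuous_transport {φ q p p' : ℝ → ℝ} (h : IsCircleLift φ q p p')
    {ν ν' : S1 → ℝ} (hν : Continuous ν) (hν' : ∀ θ : ℝ, ν' (φ θ : ℝ) = √(q θ) * ν θ) :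
    Continuous ν' := by
  refine continuous_of_continuous_coe ?_
  have e : (fun y : ℝ => ν' y) = fun y => √(q (h.inverse y)) * ν (h.inverse y : ℝ) := by
    ext y
    rw [← hν', h.apply_inverse]
  rw [e]
  have h1 := h.continuous_q
  have h2 : Continuous h.inverse := h.inverse.continuous
  have h3 : Continuous fun y => ((h.inverse y : ℝ) : S1) :=
    (AddCircle.continuous_mk' _).comp h2
  exact (h1.comp h2).sqrt.mul (hν.comp h3)

namespace IsCircleMap

variable {E : ℂ → ℂ} {a : ℝ}

theorem norm_lt_one_iff (hE : IsCircleMap E a) {z : ℂ} (hz : z ∈ annulus a a⁻¹) :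
    ‖E z‖ < 1 ↔ ‖z‖ < 1 := by
  refine ⟨fun h => lt_of_not_ge fun hge => ?_, fun h => hE.norm_lt z ⟨hz.1, h⟩⟩
  rcases hge.eq_or_lt with h1 | h1
  · exact h.ne (hE.norm_eq z h1.symm)
  · exact lt_asymm h (hE.norm_gt z ⟨h1, hz.2⟩)

/-- Every approach to E(ζ) from inside the disk is the image of an approach to ζ from inside, so a
limit of H[σ'] ∘ E at ζ is a limit of H[σ'] at E(ζ). -/
theorem nhdsWithin_ball_le_map (hE : IsCircleMap E a) {ζ : ℂ} (hζ : ‖ζ‖ = 1) :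
    𝓝[ball 0 1] (E ζ) ≤ map E (𝓝[ball 0 1] ζ) := by
  intro S hS
  rw [mem_map, mem_nhdsWithin_iff_exists_mem_nhds_inter] at hS
  obtain ⟨N, hN, hNS⟩ := hS
  have hs := (hE.analyticAt (hE.mem_annulus_of_norm hζ)).hasStrictDerivAt
  have h1 : E '' (N ∩ annulus a a⁻¹) ∈ 𝓝 (E ζ) := by
    rw [← hs.map_nhds_eq (hE.deriv_ne_zero hζ)]
    exact image_mem_map (inter_mem hN (hE.eventually_mem hζ))
  refine mem_of_superset (inter_mem (mem_nhdsWithin_of_mem_nhds h1) self_mem_nhdsWithin) ?_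
  rintro _ ⟨⟨z, ⟨hzN, hza⟩, rfl⟩, hb⟩
  rw [mem_ball_zero_iff, hE.norm_lt_one_iff hza] at hb
  exact hNS ⟨hzN, mem_ball_zero_iff.2 hb⟩

/-- J is the normalized time derivative of the conjugated map. Since Re J vanishes at the circle, Re
H[σ'](E) and Re(qH[σ]) have the same boundary values 2πqν², and these determine σ'. -/
theorem eq_withDensity_transport (hE : IsCircleMap E a) {φ q p p' : ℝ → ℝ}
    (hφ : IsCircleLift φ q p p') (hφE : ∀ θ : ℝ, expI (φ θ : ℝ) = E (expI θ))
    (hq : ∀ θ : ℝ, (q θ : ℂ) = angularDeriv E (expI θ)) {σ σ' : Measure S1} [IsFiniteMeasure σ]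
    [IsFiniteMeasure σ'] {ν ν' : S1 → ℝ} (hν : IsSqrtDensity σ ν)
    (hν' : ∀ θ : ℝ, ν' (φ θ : ℝ) = √(q θ) * ν θ) {J : ℂ → ℂ}
    (hJ : ∀ z ∈ annulus a 1, J z = herglotz σ' (E z) - angularDeriv E z * herglotz σ z)
    (hJ0 : ∀ ζ : ℂ, ‖ζ‖ = 1 → Tendsto (fun z => (J z).re) (𝓝[ball 0 1] ζ) (𝓝 0)) :
    σ' = volume.withDensity fun θ => ENNReal.ofReal (ν' θ ^ 2) := by
  have hc := hφ.continuous_transport hν.continuous hν'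
  refine eq_withDensity_of_tendsto_re_herglotz (by fun_prop) (fun _ => sq_nonneg _) (fun y => ?_)
    (Complex.continuous_re.comp_continuousOn (continuousOn_herglotz σ'))
  induction y using QuotientAddGroup.induction_on with
  | H y =>
    obtain ⟨θ, rfl⟩ := hφ.surjective y
    rw [hφE, hν', mul_pow, Real.sq_sqrt (hφ.pos θ).le]
    refine Tendsto.mono_left ?_ (hE.nhdsWithin_ball_le_map (norm_expI θ))
    rw [tendsto_map'_iff]
    have h1 := hν.tendsto_re_mul_herglotz θ
      (hE.analyticAt_angularDeriv (hE.mem_annulus_of_norm (norm_expI θ)))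
      fun ζ hζ => (hE.angularDeriv_re_pos hζ).2
    have h2 := (hJ0 _ (norm_expI θ)).add h1
    rw [← hq, Complex.ofReal_re, zero_add] at h2
    have h3 : q θ * (2 * Real.pi * ν θ ^ 2) = 2 * Real.pi * (q θ * ν θ ^ 2) := by ring
    rw [h3] at h2
    refine h2.congr' ?_
    filter_upwards [self_mem_nhdsWithin, nhdsWithin_le_nhds (hE.eventually_mem (norm_expI θ))]
      with z hz hza
    rw [hJ z ⟨hza.1, mem_ball_zero_iff.1 hz⟩, Function.comp_apply, Complex.sub_re]
    ring

end IsCircleMap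

end LoewnerKufarev

/-! ### Tools for differentiation in time -/

namespace LoewnerKufarev

open Filter Topology ComplexConjugate

section AbsolutelyContinuous

variable {a b : ℝ}

theorem absolutelyContinuousOnInterval_of_dist_le {X Y : Type*} [PseudoMetricSpace X]
    [PseudoMetricSpace Y] {f : ℝ → X} {g : ℝ → Y} {K : ℝ} (hK : 0 ≤ K)
    (hf : AbsolutelyContinuousOnInterval f a b)
    (h : ∀ x ∈ uIcc a b, ∀ y ∈ uIcc a b, dist (g x) (g y) ≤ K * dist (f x) (f y)) :
    AbsolutelyContinuousOnInterval g a b := by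
  rw [absolutelyContinuousOnInterval_iff] at hf ⊢
  intro ε hε
  obtain ⟨δ, hδ, H⟩ := hf (ε / (K + 1)) (by positivity)
  refine ⟨δ, hδ, fun E hE hsum => ?_⟩
  calc ∑ i ∈ Finset.range E.1, dist (g (E.2 i).1) (g (E.2 i).2)
      ≤ ∑ i ∈ Finset.range E.1, K * dist (f (E.2 i).1) (f (E.2 i).2) :=
        Finset.sum_le_sum fun i hi => h _ (hE.1 i hi).1 _ (hE.1 i hi).2
    _ = K * ∑ i ∈ Finset.range E.1, dist (f (E.2 i).1) (f (E.2 i).2) := by rw [Finset.mul_sum]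
    _ ≤ K * (ε / (K + 1)) := by
        gcongr
        exact (H E hE hsum).le
    _ < ε := by
        rw [← mul_div_assoc, div_lt_iff₀ (by positivity)]
        nlinarith

/-- Rotating by a unimodular constant makes the increment real and nonnegative, which reduces the
bound to the real fundamental theorem of calculus. -/
theorem norm_sub_le_integral_of_ae_hasDerivAt {h : ℝ → ℂ} {k : ℝ → ℝ} (hab : a ≤ b)
    (hac : AbsolutelyContinuousOnInterval h a b) (hk : IntervalIntegrable k volume a b)
    (hd : ∀ᵐ x ∂volume.restrict (Icc a b), ∃ d, HasDerivAt h d x ∧ ‖d‖ ≤ k x) :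
    ‖h b - h a‖ ≤ ∫ x in a..b, k x := by
  obtain ⟨c, hc1, hc⟩ : ∃ c : ℂ, ‖c‖ = 1 ∧ ‖h b - h a‖ = (c * (h b - h a)).re := by
    obtain ⟨c, hc1, hc⟩ := RCLike.exists_norm_eq_mul_self (h b - h a)
    exact ⟨c, hc1, by rw [← hc]; simp⟩
  have hL : LipschitzWith 1 (fun z : ℂ => (c * z).re) := by
    refine LipschitzWith.of_dist_le_mul fun x y => ?_
    rw [Real.dist_eq, ← Complex.sub_re, ← mul_sub, dist_eq_norm, NNReal.coe_one, one_mul]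
    exact (Complex.abs_re_le_norm _).trans (by rw [norm_mul, hc1, one_mul])
  have hac' := absolutelyContinuousOnInterval_lipschitz_comp hL hac
  have e := hac'.integral_deriv_eq_sub
  have e2 : (c * (h b - h a)).re = (c * h b).re - (c * h a).re := by rw [mul_sub, Complex.sub_re]
  rw [hc, e2]
  simp only [Function.comp_apply] at e
  rw [← e]
  refine intervalIntegral.integral_mono_ae_restrict hab hac'.intervalIntegrable_deriv hk ?_
  filter_upwards [hd] with x ⟨d, hd, hdk⟩
  have h1 : HasDerivAt (fun y => (c * h y).re) (c * d).re x :=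
    Complex.reCLM.hasFDerivAt.comp_hasDerivAt x (hd.const_mul c)
  have h2 : deriv ((fun z : ℂ => (c * z).re) ∘ h) x = (c * d).re := h1.deriv
  rw [h2]
  refine (Complex.re_le_norm _).trans ?_
  rwa [norm_mul, hc1, one_mul]

end AbsolutelyContinuous

theorem differentiableOn_herglotz (σ : Measure S1) [IsFiniteMeasure σ] :
    DifferentiableOn ℂ (herglotz σ) (ball 0 1) := by
  intro z₀ hz₀
  obtain ⟨r, hr0, hr1⟩ := exists_between (mem_ball_zero_iff.1 hz₀)
  have hn : ball (0 : ℂ) r ∈ 𝓝 z₀ := isOpen_ball.mem_nhds (mem_ball_zero_iff.2 hr0)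
  have hsub : ball (0 : ℂ) r ⊆ ball 0 1 := ball_subset_ball hr1.le
  have hr : 0 < 1 - r := sub_pos.2 hr1
  refine ((hasDerivAt_integral_of_dominated_loc_of_deriv_le (𝕜 := ℂ) (μ := σ)
    (F := fun z θ => (expI θ + z) / (expI θ - z))
    (F' := fun z θ => (1 * (expI θ - z) - (expI θ + z) * (-1)) / (expI θ - z) ^ 2)
    (bound := fun _ => 2 / (1 - r) ^ 2) hn ?_ ?_ ?_ ?_ (integrable_const _)
    ?_).2.differentiableAt).differentiableWithinAt
  · filter_upwards [hn] with z hz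
    exact (continuous_herglotz_kernel (hsub hz)).aestronglyMeasurable
  · exact integrable_of_continuous (continuous_herglotz_kernel hz₀)
  · refine Continuous.aestronglyMeasurable (Continuous.div ?_ ?_ fun θ =>
      pow_ne_zero 2 (expI_sub_ne_zero hz₀ θ))
    · have := continuous_expI; fun_prop
    · have := continuous_expI; fun_prop
  · refine Eventually.of_forall fun θ z hz => ?_
    have h1 := one_sub_norm_le_norm_expI_sub z θ
    have h2 : ‖z‖ < r := mem_ball_zero_iff.1 hz
    have e : 1 * (expI θ - z) - (expI θ + z) * (-1) = 2 * expI θ := by ring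
    rw [e, norm_div, norm_mul, norm_expI, norm_pow, mul_one, Complex.norm_two]
    have h3 : 1 - r ≤ ‖expI θ - z‖ := by linarith
    gcongr
  · refine Eventually.of_forall fun θ z hz => ?_
    exact ((hasDerivAt_id z).const_add _).div ((hasDerivAt_id z).const_sub _)
      (expI_sub_ne_zero (hsub hz) θ)

/-- A derivative is required only at the single time t, with a Lipschitz bound based at t. The usual
version with derivatives at all nearby times does not apply, since the Loewner equation holds only
almost everywhere. -/
theorem hasDerivAt_circleIntegral_param {G : ℝ → ℂ → ℂ} {k D : ℂ → ℂ} {R t C : ℝ}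
    (hR : 0 ≤ R) (hG : ∀ᶠ s in 𝓝 t, ContinuousOn (G s) (sphere 0 R))
    (hk : ContinuousOn k (sphere 0 R)) (hD : ContinuousOn D (sphere 0 R))
    (hC : ∀ᶠ s in 𝓝 t, ∀ w ∈ sphere (0 : ℂ) R, ‖G s w - G t w‖ ≤ C * |s - t|)
    (hd : ∀ w ∈ sphere (0 : ℂ) R, HasDerivAt (fun s => G s w) (D w) t) :
    HasDerivAt (fun s => ∮ w in C(0, R), k w • G s w) (∮ w in C(0, R), k w • D w) t := by
  have hcm : Continuous (circleMap 0 R) := continuous_circleMap 0 R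
  have hm : ∀ θ, circleMap 0 R θ ∈ sphere (0 : ℂ) R := fun θ => circleMap_mem_sphere 0 hR θ
  have hkc : Continuous fun θ => k (circleMap 0 R θ) := hk.comp_continuous hcm hm
  have hdc : Continuous (deriv (circleMap 0 R)) := by
    have : deriv (circleMap 0 R) = fun θ => circleMap 0 R θ * Complex.I := by
      ext θ; exact deriv_circleMap 0 R θ
    rw [this]; fun_prop
  obtain ⟨M, hM⟩ := (isCompact_sphere (0 : ℂ) R).exists_bound_of_continuousOn hk
  obtain ⟨S, hS, hSp⟩ := eventually_iff_exists_mem.1 (hG.and hC)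
  have key := hasFDerivAt_integral_of_dominated_loc_of_lip' (𝕜 := ℝ)
    (μ := volume.restrict (Ioc 0 (2 * Real.pi)))
    (F := fun s θ => deriv (circleMap 0 R) θ • (k (circleMap 0 R θ) • G s (circleMap 0 R θ)))
    (F' := fun θ => ContinuousLinearMap.toSpanSingleton ℝ
      (deriv (circleMap 0 R) θ • (k (circleMap 0 R θ) • D (circleMap 0 R θ))))
    (x₀ := t) (bound := fun θ => R * (M * C)) hS ?_ ?_ ?_ ?_ (integrable_const _) ?_
  · have h2 := key.2.hasDerivAt
    simp only [circleIntegral, intervalIntegral.integral_of_le Real.two_pi_pos.le]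
    refine h2.congr_deriv ?_
    rw [ContinuousLinearMap.integral_apply key.1]
    simp
  · intro s hs
    have hGc : Continuous fun θ => G s (circleMap 0 R θ) := (hSp s hs).1.comp_continuous hcm hm
    exact (hdc.smul (hkc.smul hGc)).aestronglyMeasurable
  · have hGc : Continuous fun θ => G t (circleMap 0 R θ) :=
      (hSp t (mem_of_mem_nhds hS)).1.comp_continuous hcm hm
    exact ((hdc.smul (hkc.smul hGc)).integrableOn_Icc).mono_set Ioc_subset_Icc_self
  · have hDc : Continuous fun θ => D (circleMap 0 R θ) := hD.comp_continuous hcm hm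
    refine Continuous.aestronglyMeasurable ?_
    exact (ContinuousLinearMap.toSpanSingletonCLE (𝕜 := ℝ) (E := ℂ)).continuous.comp
      (hdc.smul (hkc.smul hDc))
  · refine Eventually.of_forall fun θ s hs => ?_
    rw [← smul_sub, ← smul_sub, norm_smul, norm_smul, deriv_circleMap, norm_mul, Complex.norm_I,
      mul_one, norm_circleMap_zero, abs_of_nonneg hR, Real.norm_eq_abs, mul_assoc, mul_assoc]
    have h1 := (hSp s hs).2 _ (hm θ)
    have h2 := hM _ (hm θ)
    have h3 : 0 ≤ M := (norm_nonneg _).trans h2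
    gcongr
  · refine Eventually.of_forall fun θ => ?_
    have := ((hd _ (hm θ)).const_smul (k (circleMap 0 R θ))).const_smul
      (deriv (circleMap 0 R) θ)
    exact this.hasFDerivAt

end LoewnerKufarev

/-! ### Loewner chains: regularity in time and the derivative at the origin -/

namespace LoewnerKufarev

open Filter Topology ComplexConjugate

/-- The total mass of `ρ` up to time `t`. -/
noncomputable def cumMass (ρ : Kernel ℝ S1) (t : ℝ) : ℝ := ∫ u in (0 : ℝ)..t, (ρ u).real univ

section Mass

variable {ρ : Kernel ℝ S1}

theorem ae_isFiniteMeasure (hρ : ∫⁻ t in Icc (0 : ℝ) 1, ρ t univ ≠ ∞) :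
    ∀ᵐ t ∂volume.restrict (Icc (0 : ℝ) 1), IsFiniteMeasure (ρ t) := by
  filter_upwards [ae_lt_top (Kernel.measurable_coe ρ MeasurableSet.univ) hρ] with t ht
  exact ⟨ht⟩

theorem intervalIntegrable_real_univ (hρ : ∫⁻ t in Icc (0 : ℝ) 1, ρ t univ ≠ ∞) :
    IntervalIntegrable (fun t => (ρ t).real univ) volume 0 1 := by
  rw [intervalIntegrable_iff_integrableOn_Icc_of_le zero_le_one]
  exact integrable_toReal_of_lintegral_ne_top
    (Kernel.measurable_coe ρ MeasurableSet.univ).aemeasurable hρ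

theorem intervalIntegrable_real_univ_of_mem (hρ : ∫⁻ t in Icc (0 : ℝ) 1, ρ t univ ≠ ∞)
    {s t : ℝ} (hs : s ∈ Icc (0 : ℝ) 1) (ht : t ∈ Icc (0 : ℝ) 1) :
    IntervalIntegrable (fun t => (ρ t).real univ) volume s t := by
  refine (intervalIntegrable_real_univ hρ).mono_set ?_
  rw [uIcc_of_le zero_le_one]
  exact (uIcc_subset_Icc hs ht)

theorem cumMass_sub (hρ : ∫⁻ t in Icc (0 : ℝ) 1, ρ t univ ≠ ∞) {s t : ℝ}
    (hs : s ∈ Icc (0 : ℝ) 1) (ht : t ∈ Icc (0 : ℝ) 1) :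
    cumMass ρ t - cumMass ρ s = ∫ u in s..t, (ρ u).real univ :=
  intervalIntegral.integral_interval_sub_left
    (intervalIntegrable_real_univ_of_mem hρ ⟨le_rfl, zero_le_one⟩ ht)
    (intervalIntegrable_real_univ_of_mem hρ ⟨le_rfl, zero_le_one⟩ hs)

theorem absolutelyContinuousOnInterval_cumMass (hρ : ∫⁻ t in Icc (0 : ℝ) 1, ρ t univ ≠ ∞) :
    AbsolutelyContinuousOnInterval (cumMass ρ) 0 1 :=
  (intervalIntegrable_real_univ hρ).absolutelyContinuousOnInterval_intervalIntegral
    left_mem_uIcc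

theorem ae_hasDerivAt_cumMass (hρ : ∫⁻ t in Icc (0 : ℝ) 1, ρ t univ ≠ ∞) :
    ∀ᵐ t ∂volume.restrict (Icc (0 : ℝ) 1), HasDerivAt (cumMass ρ) ((ρ t).real univ) t := by
  rw [ae_restrict_iff' measurableSet_Icc]
  filter_upwards [(intervalIntegrable_real_univ hρ).ae_hasDerivAt_integral] with t ht h
  rw [uIcc_of_le zero_le_one] at ht
  exact ht h 0 ⟨le_rfl, zero_le_one⟩

end Mass

/-- Cauchy's estimate on the disk of radius 1 − |z| about z; the 2 is the diameter of the target. -/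
theorem norm_deriv_le_of_mapsTo {g : ℂ → ℂ} (hg : DifferentiableOn ℂ g (ball 0 1))
    (hm : MapsTo g (ball 0 1) (ball 0 1)) {z : ℂ} (hz : z ∈ ball (0 : ℂ) 1) :
    ‖deriv g z‖ ≤ 2 / (1 - ‖z‖) := by
  have hz1 := mem_ball_zero_iff.1 hz
  have hsub : ball z (1 - ‖z‖) ⊆ ball 0 1 := ball_subset_ball' (by simp)
  refine Complex.norm_deriv_le_div_of_mapsTo_ball (hg.mono hsub) (fun w hw => ?_)
    (sub_pos.2 hz1)
  rw [mem_closedBall, dist_eq_norm]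
  have h1 := mem_ball_zero_iff.1 (hm (hsub hw))
  have h2 := mem_ball_zero_iff.1 (hm hz)
  linarith [norm_sub_le (g w) (g z)]

namespace IsLoewnerChain

variable {ρ : Kernel ℝ S1} {f : ℝ → ℂ → ℂ} {s t : ℝ}

theorem mapsTo (hf : IsLoewnerChain ρ f) (ht : t ∈ Icc (0 : ℝ) 1) :
    MapsTo (f t) (ball 0 1) (ball 0 1) := by
  intro z hz
  have h := hf.decreasing ⟨le_rfl, zero_le_one⟩ ht ht.1 (mem_image_of_mem (f t) hz)
  obtain ⟨w, hw, h⟩ := h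
  rw [hf.initial w hw] at h
  rwa [← h]

theorem deriv_ne_zero (hf : IsLoewnerChain ρ f) (ht : t ∈ Icc (0 : ℝ) 1) {z : ℂ}
    (hz : z ∈ ball (0 : ℂ) 1) : deriv (f t) z ≠ 0 :=
  deriv_ne_zero_of_injOn isOpen_ball (hf.holomorphic t ht) (hf.injective t ht) hz

theorem lipschitzOnWith (hf : IsLoewnerChain ρ f) (ht : t ∈ Icc (0 : ℝ) 1) {b : ℝ} (hb : b < 1) :
    LipschitzOnWith (Real.toNNReal (2 / (1 - b))) (f t) (ball 0 b) := by
  refine (convex_ball _ _).lipschitzOnWith_of_nnnorm_deriv_le (𝕜 := ℂ) (fun z hz => ?_)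
    fun z hz => ?_
  · exact (hf.holomorphic t ht).differentiableAt
      (isOpen_ball.mem_nhds (ball_subset_ball hb.le hz))
  · have h1 := norm_deriv_le_of_mapsTo (hf.holomorphic t ht) (hf.mapsTo ht)
      (ball_subset_ball hb.le hz)
    have hz' := mem_ball_zero_iff.1 hz
    rw [← NNReal.coe_le_coe, coe_nnnorm]
    refine h1.trans (le_trans ?_ (Real.le_coe_toNNReal _))
    have : 0 < 1 - b := sub_pos.2 hb
    gcongr

/-- Continuity in t for fixed z, combined with a Lipschitz bound in z that is uniform in t. -/
theorem continuousOn_prod (hf : IsLoewnerChain ρ f) :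
    ContinuousOn (fun p : ℝ × ℂ => f p.1 p.2) (Icc (0 : ℝ) 1 ×ˢ ball 0 1) := by
  rintro ⟨t, z⟩ ⟨ht, hz⟩
  obtain ⟨b, hzb, hb⟩ := exists_between (mem_ball_zero_iff.1 hz)
  have h := continuousOn_prod_of_continuousOn_lipschitzOnWith' (fun p : ℝ × ℂ => f p.1 p.2)
    (s := Icc (0 : ℝ) 1) (t := ball 0 b) _ (fun t ht => hf.lipschitzOnWith ht hb) fun z hz => by
      have := (hf.absCont z (ball_subset_ball hb.le hz)).continuousOn
      rwa [uIcc_of_le zero_le_one] at this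
  refine (h (t, z) ⟨ht, mem_ball_zero_iff.2 hzb⟩).mono_of_mem_nhdsWithin ?_
  have h2 : (univ ×ˢ ball 0 b : Set (ℝ × ℂ)) ∈ 𝓝 (t, z) :=
    prod_mem_nhds univ_mem (isOpen_ball.mem_nhds (mem_ball_zero_iff.2 hzb))
  filter_upwards [self_mem_nhdsWithin, nhdsWithin_le_nhds h2] with p hp hp2
  exact ⟨hp.1, hp2.2⟩

/-- Time increments are controlled by accumulated mass, uniformly on smaller disks: one factor 2/(1
− b) bounds f_u' and the other bounds the Herglotz kernel. -/
theorem norm_sub_le (hf : IsLoewnerChain ρ f) (hρ : ∫⁻ t in Icc (0 : ℝ) 1, ρ t univ ≠ ∞)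
    (hs : s ∈ Icc (0 : ℝ) 1) (ht : t ∈ Icc (0 : ℝ) 1) {b : ℝ} (hb : b < 1) {z : ℂ}
    (hz : ‖z‖ ≤ b) :
    ‖f t z - f s z‖ ≤ (2 / (1 - b)) ^ 2 * |cumMass ρ t - cumMass ρ s| := by
  wlog hst : s ≤ t generalizing s t
  · rw [norm_sub_rev, abs_sub_comm]
    exact this ht hs (le_of_not_ge hst)
  have hzb : z ∈ ball (0 : ℂ) 1 := mem_ball_zero_iff.2 (hz.trans_lt hb)
  have hsub : Icc s t ⊆ Icc 0 1 := Icc_subset_Icc hs.1 ht.2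
  have hi := intervalIntegrable_real_univ_of_mem hρ hs ht
  refine (norm_sub_le_integral_of_ae_hasDerivAt (h := fun u => f u z)
    (k := fun u => (2 / (1 - b)) ^ 2 * (ρ u).real univ) hst ?_ (hi.const_mul _) ?_).trans ?_
  · refine (hf.absCont z hzb).mono ?_
    rwa [uIcc_of_le hst, uIcc_of_le zero_le_one]
  · filter_upwards [ae_restrict_of_ae_restrict_of_subset hsub hf.equation,
      ae_restrict_of_ae_restrict_of_subset hsub (ae_isFiniteMeasure hρ),
      ae_restrict_mem measurableSet_Icc] with u hu hfin hum
    refine ⟨_, hu z hzb, ?_⟩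
    rw [norm_mul, norm_mul, norm_neg]
    have h1 := norm_deriv_le_of_mapsTo (hf.holomorphic u (hsub hum)) (hf.mapsTo (hsub hum)) hzb
    have h2 := norm_herglotz_le (ρ u) hzb
    have h3 : 0 < 1 - b := sub_pos.2 hb
    have h4 : 2 / (1 - ‖z‖) ≤ 2 / (1 - b) := by gcongr
    calc ‖z‖ * ‖deriv (f u) z‖ * ‖herglotz (ρ u) z‖
        ≤ 1 * (2 / (1 - b)) * (2 / (1 - b) * (ρ u).real univ) := by
          gcongr
          · exact hz.trans hb.le
          · exact h1.trans h4
          · exact h2.trans (by gcongr)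
      _ = _ := by ring
  · rw [intervalIntegral.integral_const_mul, cumMass_sub hρ hs ht]
    gcongr
    exact le_abs_self _

/-- The times of `[0, 1]` at which the Loewner equation holds and the mass is differentiable. -/
structure IsRegularTime (ρ : Kernel ℝ S1) (f : ℝ → ℂ → ℂ) (t : ℝ) : Prop where
  mem : t ∈ Ioo (0 : ℝ) 1
  finite : IsFiniteMeasure (ρ t)
  mass : HasDerivAt (cumMass ρ) ((ρ t).real univ) t
  equation : ∀ z ∈ ball (0 : ℂ) 1,
    HasDerivAt (fun s => f s z) (-z * deriv (f t) z * herglotz (ρ t) z) t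

theorem ae_isRegularTime (hf : IsLoewnerChain ρ f) (hρ : ∫⁻ t in Icc (0 : ℝ) 1, ρ t univ ≠ ∞) :
    ∀ᵐ t ∂volume.restrict (Icc (0 : ℝ) 1), IsRegularTime ρ f t := by
  have h0 : ∀ᵐ t ∂volume.restrict (Icc (0 : ℝ) 1), t ∈ Ioo (0 : ℝ) 1 := by
    rw [restrict_Ioo_eq_restrict_Icc.symm]
    exact ae_restrict_mem measurableSet_Ioo
  filter_upwards [h0, hf.equation, ae_isFiniteMeasure hρ, ae_hasDerivAt_cumMass hρ]
    with t h1 h2 h3 h4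
  exact ⟨h1, h3, h4, h2⟩

/-- Differentiability of the accumulated mass at t turns the mass bound into a Lipschitz bound in
time, based at t. The added 1 absorbs the error term. -/
theorem IsRegularTime.exists_norm_sub_le (hf : IsLoewnerChain ρ f)
    (hρ : ∫⁻ t in Icc (0 : ℝ) 1, ρ t univ ≠ ∞) (h : IsRegularTime ρ f t) {b : ℝ} (hb : b < 1) :
    ∃ C, 0 ≤ C ∧ ∀ᶠ s in 𝓝 t, ∀ z : ℂ, ‖z‖ ≤ b → ‖f s z - f t z‖ ≤ C * |s - t| := by
  refine ⟨(2 / (1 - b)) ^ 2 * ((ρ t).real univ + 1), by positivity, ?_⟩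
  have h1 := h.mass.isLittleO.def (c := 1) one_pos
  filter_upwards [h1, isOpen_Ioo.mem_nhds h.mem] with s hs hsm z hz
  refine (hf.norm_sub_le hρ (Ioo_subset_Icc_self h.mem) (Ioo_subset_Icc_self hsm) hb hz).trans ?_
  rw [mul_assoc]
  gcongr
  rw [Real.norm_eq_abs, Real.norm_eq_abs, one_mul, smul_eq_mul] at hs
  have h2 : |(s - t) * (ρ t).real univ| = |s - t| * (ρ t).real univ := by
    rw [abs_mul, abs_of_nonneg measureReal_nonneg]
  have h3 := abs_sub_abs_le_abs_sub (cumMass ρ s - cumMass ρ t) ((s - t) * (ρ t).real univ)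
  rw [h2] at h3
  linarith

theorem deriv_zero_eq (hf : IsLoewnerChain ρ f) (ht : t ∈ Icc (0 : ℝ) 1) :
    deriv (f t) 0 = (2 * Real.pi * Complex.I)⁻¹ * ∮ w in C(0, 1 / 2), (w ^ 2)⁻¹ • f t w := by
  have h := (hf.holomorphic t ht).mono (closedBall_subset_ball (by norm_num : (1 / 2 : ℝ) < 1))
    |>.deriv_eq_smul_circleIntegral (by norm_num : (0 : ℝ) < 1 / 2)
  have h2 : (∮ w in C(0, 1 / 2), (w ^ 2)⁻¹ • f t w) = (2 * Real.pi * Complex.I) • deriv (f t) 0 := by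
    rw [← h]; simp
  rw [h2, smul_eq_mul, inv_mul_cancel_left₀ Complex.two_pi_I_ne_zero]

/-- Cauchy's formula on |w| = 1/2 turns the derivative at 0 into an integral that can be
differentiated in time. Evaluating the result uses H[ρ_t](0) = |ρ_t|. -/
theorem hasDerivAt_deriv_zero (hf : IsLoewnerChain ρ f)
    (hρ : ∫⁻ t in Icc (0 : ℝ) 1, ρ t univ ≠ ∞) (h : IsRegularTime ρ f t) :
    HasDerivAt (fun s => deriv (f s) 0) (-(deriv (f t) 0 * (ρ t).real univ)) t := by
  have := h.finite
  obtain ⟨C, hC0, hC⟩ := h.exists_norm_sub_le hf hρ (by norm_num : (1 / 2 : ℝ) < 1)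
  have htm := Ioo_subset_Icc_self h.mem
  have hsub : closedBall (0 : ℂ) (1 / 2) ⊆ ball 0 1 := closedBall_subset_ball (by norm_num)
  have hsub' : sphere (0 : ℂ) (1 / 2) ⊆ ball 0 1 := sphere_subset_closedBall.trans hsub
  have hw0 : ∀ w ∈ sphere (0 : ℂ) (1 / 2), w ≠ 0 := by
    rintro w hw rfl
    rw [mem_sphere_zero_iff_norm, norm_zero] at hw
    norm_num at hw
  have hfd := (hf.holomorphic t htm).deriv isOpen_ball
  have key := hasDerivAt_circleIntegral_param (G := f) (k := fun w => (w ^ 2)⁻¹) (t := t) (C := C)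
    (R := 1 / 2) (D := fun w => -w * deriv (f t) w * herglotz (ρ t) w) (by norm_num) ?_ ?_ ?_ ?_ ?_
  · have h2 := key.const_mul (2 * Real.pi * Complex.I)⁻¹
    refine (h2.congr_of_eventuallyEq ?_).congr_deriv ?_
    · filter_upwards [isOpen_Ioo.mem_nhds h.mem] with s hs
      exact hf.deriv_zero_eq (Ioo_subset_Icc_self hs)
    · have e : (∮ w in C(0, 1 / 2), (w ^ 2)⁻¹ • (-w * deriv (f t) w * herglotz (ρ t) w))
          = ∮ w in C(0, 1 / 2), (w - 0)⁻¹ • (-(deriv (f t) w * herglotz (ρ t) w)) := by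
        refine circleIntegral.integral_congr (by norm_num) fun w hw => ?_
        have := hw0 w hw
        simp only [smul_eq_mul, sub_zero]
        field_simp
      have hd : DifferentiableOn ℂ (fun w => -(deriv (f t) w * herglotz (ρ t) w))
          (closedBall 0 (1 / 2)) := ((hfd.mul (differentiableOn_herglotz (ρ t))).neg).mono hsub
      rw [e, hd.circleIntegral_sub_inv_smul (by simp), smul_eq_mul,
        inv_mul_cancel_left₀ Complex.two_pi_I_ne_zero]
      have hH : herglotz (ρ t) 0 = (ρ t).real univ := by
        have hn : ∀ θ, expI θ ≠ 0 := fun θ => by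
          rw [← norm_pos_iff, norm_expI]; exact one_pos
        simp [herglotz, div_self (hn _)]
      rw [hH]
  · filter_upwards [isOpen_Ioo.mem_nhds h.mem] with s hs
    exact (hf.holomorphic s (Ioo_subset_Icc_self hs)).continuousOn.mono hsub'
  · exact ContinuousOn.inv₀ (by fun_prop) fun w hw => pow_ne_zero 2 (hw0 w hw)
  · exact (((continuousOn_id.neg).mul hfd.continuousOn).mul
      (continuousOn_herglotz (ρ t))).mono hsub'
  · filter_upwards [hC] with s hs w hw
    exact hs w (mem_sphere_zero_iff_norm.1 hw).le
  · exact fun w hw => h.equation w (hsub' hw)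

/-- With m the accumulated mass, f_t'(0) e^{m(t)} is absolutely continuous with zero derivative
almost everywhere, hence constantly 1. -/
theorem log_deriv_zero (hf : IsLoewnerChain ρ f) (hρ : ∫⁻ t in Icc (0 : ℝ) 1, ρ t univ ≠ ∞) :
    Real.log (deriv (f 1) 0).re = -cumMass ρ 1 := by
  have hI : uIcc (0 : ℝ) 1 = Icc 0 1 := uIcc_of_le zero_le_one
  have h0 : (0 : ℝ) ∈ Icc (0 : ℝ) 1 := ⟨le_rfl, zero_le_one⟩
  have h1 : (1 : ℝ) ∈ Icc (0 : ℝ) 1 := ⟨zero_le_one, le_rfl⟩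
  have hm := absolutelyContinuousOnInterval_cumMass hρ
  have hA : AbsolutelyContinuousOnInterval (fun t => (deriv (f t) 0).re) 0 1 := by
    refine absolutelyContinuousOnInterval_of_dist_le (K := (2 / (1 - 1 / 2)) ^ 2 / (1 / 2))
      (by norm_num) hm fun x hx y hy => ?_
    rw [hI] at hx hy
    rw [Real.dist_eq, Real.dist_eq, ← Complex.sub_re]
    refine (Complex.abs_re_le_norm _).trans ?_
    have hd : ∀ u ∈ Icc (0 : ℝ) 1, DifferentiableAt ℂ (f u) 0 := fun u hu =>
      (hf.holomorphic u hu).differentiableAt (ball_mem_nhds 0 one_pos)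
    rw [← deriv_fun_sub (hd x hx) (hd y hy), div_mul_eq_mul_div]
    refine Complex.norm_deriv_le_of_forall_mem_sphere_norm_le (by norm_num) ?_ fun z hz => ?_
    · refine (((hf.holomorphic x hx).sub (hf.holomorphic y hy)).mono ?_).diffContOnCl_ball
        (R := 1 / 2) (U := closedBall 0 (1 / 2)) subset_rfl
      exact closedBall_subset_ball (by norm_num)
    · exact hf.norm_sub_le hρ hy hx (by norm_num) (mem_sphere_zero_iff_norm.1 hz).le
  obtain ⟨B, hB⟩ := hm.exists_bound
  have hE : AbsolutelyContinuousOnInterval (fun t => Real.exp (cumMass ρ t)) 0 1 := by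
    refine absolutelyContinuousOnInterval_of_dist_le (K := Real.exp B) (Real.exp_pos _).le hm
      fun x hx y hy => ?_
    have hx' := hB x hx
    have hy' := hB y hy
    rw [Real.norm_eq_abs] at hx' hy'
    refine (convex_Iic B).norm_image_sub_le_of_norm_deriv_le (f := Real.exp)
      (fun u _ => Real.differentiableAt_exp) (fun u hu => ?_) (le_of_abs_le hy') (le_of_abs_le hx')
    rw [Real.deriv_exp, Real.norm_eq_abs, abs_of_pos (Real.exp_pos _)]
    exact Real.exp_le_exp.2 hu
  obtain ⟨c, hc⟩ := (hA.fun_mul hE).const_of_ae_hasDerivAt_zero (by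
    rw [hI, ← ae_restrict_iff' measurableSet_Icc]
    filter_upwards [hf.ae_isRegularTime hρ] with t ht
    have e1 := Complex.reCLM.hasFDerivAt.comp_hasDerivAt t (hf.hasDerivAt_deriv_zero hρ ht)
    have e2 := e1.mul ht.mass.exp
    refine e2.congr_deriv ?_
    simp
    ring)
  have hc0 := hc 0 left_mem_uIcc
  have hc1 := hc 1 right_mem_uIcc
  have hi : deriv (f 0) 0 = 1 := by
    have : f 0 =ᶠ[𝓝 0] id := by
      filter_upwards [ball_mem_nhds (0 : ℂ) one_pos] with z hz using hf.initial z hz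
    rw [this.deriv_eq, deriv_id]
  rw [hi] at hc0
  simp only [cumMass, intervalIntegral.integral_same, Real.exp_zero, Complex.one_re, mul_one]
    at hc0
  rw [← hc0] at hc1
  have hpos := (hf.deriv_zero_pos 1 h1).1
  have := congrArg Real.log hc1
  rw [Real.log_mul hpos.ne' (Real.exp_pos _).ne', Real.log_exp, Real.log_one] at this
  exact eq_neg_of_add_eq_zero_left this

theorem log_deriv_uniformizing_zero (hf : IsLoewnerChain ρ f)
    (hρ : ∫⁻ t in Icc (0 : ℝ) 1, ρ t univ ≠ ∞) :
    Real.log (deriv (uniformizing f 1) 0).re = cumMass ρ 1 := by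
  have h1 : (1 : ℝ) ∈ Icc (0 : ℝ) 1 := ⟨zero_le_one, le_rfl⟩
  have h0 : (0 : ℂ) ∈ ball (0 : ℂ) 1 := by simp
  have h := hasDerivAt_invFunOn_of_ne isOpen_ball (hf.holomorphic 1 h1) (hf.injective 1 h1) h0
    (hf.deriv_ne_zero h1 h0)
  rw [hf.map_zero 1 h1] at h
  have hr : deriv (f 1) 0 = ((deriv (f 1) 0).re : ℂ) := by
    apply Complex.ext <;> simp [(hf.deriv_zero_pos 1 h1).2]
  rw [uniformizing, h.deriv, hr, ← Complex.ofReal_inv, Complex.ofReal_re, Real.log_inv,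
    hf.log_deriv_zero hρ, neg_neg]

end IsLoewnerChain

end LoewnerKufarev

/-! ### The conjugated maps near the circle -/

namespace LoewnerKufarev

open Filter Topology ComplexConjugate

theorem IsLoewnerChain.hull_mono {ρ : Kernel ℝ S1} {f : ℝ → ℂ → ℂ} (hf : IsLoewnerChain ρ f)
    {s t : ℝ} (hs : s ∈ Icc (0 : ℝ) 1) (ht : t ∈ Icc (0 : ℝ) 1) (hst : s ≤ t) :
    hull f s ⊆ hull f t :=
  sdiff_subset_sdiff_right (hf.decreasing hs ht hst)

theorem IsLoewnerChain.uniformizing_apply {ρ : Kernel ℝ S1} {f : ℝ → ℂ → ℂ}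
    (hf : IsLoewnerChain ρ f) {t : ℝ} (ht : t ∈ Icc (0 : ℝ) 1) {z : ℂ}
    (hz : z ∈ ball (0 : ℂ) 1) : uniformizing f t (f t z) = z :=
  (hf.injective t ht).leftInvOn_invFunOn hz

theorem IsLoewnerChain.differentiableOn_uniformizing {ρ : Kernel ℝ S1} {f : ℝ → ℂ → ℂ}
    (hf : IsLoewnerChain ρ f) {t : ℝ} (ht : t ∈ Icc (0 : ℝ) 1) :
    DifferentiableOn ℂ (uniformizing f t) (f t '' ball 0 1) :=
  differentiableOn_invFunOn isOpen_ball (hf.holomorphic t ht) (hf.injective t ht)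

/-- The conjugated map `ψ_t = g'_t ∘ ψ ∘ f_t`. -/
noncomputable def conjMap (f f' : ℝ → ℂ → ℂ) (ψ : ℂ → ℂ) (t : ℝ) (z : ℂ) : ℂ :=
  uniformizing f' t (ψ (f t z))

/-- The conformal map `ψ`, defined on a neighbourhood of the hulls of the chain `f`, maps them to
the hulls of the chain `f'`. -/
structure IsConjugation (ρ ρ' : Kernel ℝ S1) (f f' : ℝ → ℂ → ℂ) (ψ : ℂ → ℂ) (U U' : Set ℂ) :
    Prop where
  chain : IsLoewnerChain ρ f
  chain' : IsLoewnerChain ρ' f'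
  conformal : IsConformalMap ψ U U'
  hull_subset : hull f 1 ⊆ U
  hull_eq : ∀ t ∈ Icc (0 : ℝ) 1, hull f' t = ψ '' hull f t

namespace IsConjugation

variable {ρ ρ' : Kernel ℝ S1} {f f' : ℝ → ℂ → ℂ} {ψ : ℂ → ℂ} {U U' : Set ℂ} {t : ℝ} {z : ℂ}

/-- If ψ(x) lay in the image hull it would be ψ(y) with y in the hull, and injectivity would force x
= y. -/
theorem map_mem (h : IsConjugation ρ ρ' f f' ψ U U') (ht : t ∈ Icc (0 : ℝ) 1)
    {x : ℂ} (hxU : x ∈ U) (hx : x ∈ f t '' ball 0 1) : ψ x ∈ f' t '' ball 0 1 := by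
  by_contra hn
  have hb : ψ x ∈ closedBall (0 : ℂ) 1 := by
    obtain ⟨V, -, hV⟩ := h.conformal.target_open
    have := h.conformal.bijective.mapsTo hxU
    rw [hV] at this
    exact this.2
  have h1 : ψ x ∈ hull f' t := ⟨hb, hn⟩
  rw [h.hull_eq t ht] at h1
  obtain ⟨y, hy, hyx⟩ := h1
  have hyU := h.hull_subset (h.chain.hull_mono ht ⟨zero_le_one, le_rfl⟩ ht.2 hy)
  rw [h.conformal.bijective.injOn hyU hxU hyx] at hy
  exact hy.2 hx

theorem conjMap_mem (h : IsConjugation ρ ρ' f f' ψ U U') (ht : t ∈ Icc (0 : ℝ) 1)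
    (hz : z ∈ ball (0 : ℂ) 1) (hzU : f t z ∈ U) : conjMap f f' ψ t z ∈ ball (0 : ℂ) 1 :=
  Function.invFunOn_mem (h.map_mem ht hzU (mem_image_of_mem _ hz))

theorem map_conjMap (h : IsConjugation ρ ρ' f f' ψ U U') (ht : t ∈ Icc (0 : ℝ) 1)
    (hz : z ∈ ball (0 : ℂ) 1) (hzU : f t z ∈ U) : f' t (conjMap f f' ψ t z) = ψ (f t z) :=
  Function.invFunOn_eq (h.map_mem ht hzU (mem_image_of_mem _ hz))

theorem injOn_conjMap (h : IsConjugation ρ ρ' f f' ψ U U') (ht : t ∈ Icc (0 : ℝ) 1) :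
    InjOn (conjMap f f' ψ t) {z ∈ ball (0 : ℂ) 1 | f t z ∈ U} := by
  rintro z ⟨hz, hzU⟩ w ⟨hw, hwU⟩ e
  have e2 := h.map_conjMap ht hz hzU
  rw [e, h.map_conjMap ht hw hwU] at e2
  exact h.chain.injective t ht hz hw (h.conformal.bijective.injOn hzU hwU e2.symm)

theorem isOpen_source (h : IsConjugation ρ ρ' f f' ψ U U') : IsOpen (U ∩ ball 0 1) := by
  obtain ⟨V, hV, rfl⟩ := h.conformal.source_open
  have : V ∩ closedBall (0 : ℂ) 1 ∩ ball 0 1 = V ∩ ball 0 1 := by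
    rw [inter_assoc, inter_eq_right.2 ball_subset_closedBall]
  rw [this]
  exact hV.inter isOpen_ball

theorem differentiableOn_conjMap (h : IsConjugation ρ ρ' f f' ψ U U') (ht : t ∈ Icc (0 : ℝ) 1) :
    DifferentiableOn ℂ (conjMap f f' ψ t) {z ∈ ball (0 : ℂ) 1 | f t z ∈ U} := by
  refine (h.chain'.differentiableOn_uniformizing ht).comp (t := f' t '' ball 0 1)
    (h.conformal.holomorphic.comp ((h.chain.holomorphic t ht).mono fun z hz => hz.1)
      fun z hz => ⟨hz.2, h.chain.mapsTo ht hz.1⟩)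
    fun z hz => h.map_mem ht hz.2 (mem_image_of_mem _ hz.1)

/-- The condition is an implication, so all points of the closed disk outside U are included. The
complement is then relatively open, whether or not U is closed. -/
theorem isCompact_preimage (h : IsConjugation ρ ρ' f f' ψ U U') {Q : Set ℂ} (hQ : IsClosed Q) :
    IsCompact {x ∈ closedBall (0 : ℂ) 1 | x ∈ U → ψ x ∈ Q} := by
  obtain ⟨V, hV, hUV⟩ := h.conformal.source_open
  obtain ⟨W, hW, hWU⟩ := continuousOn_iff'.1 h.conformal.continuous Qᶜ hQ.isOpen_compl
  have e : {x ∈ closedBall (0 : ℂ) 1 | x ∈ U → ψ x ∈ Q} = closedBall 0 1 \ (W ∩ V) := by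
    ext x
    have h1 : x ∈ ψ ⁻¹' Qᶜ ∩ U ↔ x ∈ W ∩ U := by rw [hWU]
    have h2 : x ∈ U ↔ x ∈ V ∧ x ∈ closedBall (0 : ℂ) 1 := by rw [hUV]; rfl
    simp only [mem_inter_iff, mem_preimage, mem_compl_iff, mem_ofPred_eq, Set.mem_sdiff] at *
    tauto
  rw [e]
  exact (isCompact_closedBall _ _).diff (hW.inter hV)

/-- Hull points lie in U and are sent into the image hull, so they cannot satisfy the implication.
-/
theorem preimage_subset (h : IsConjugation ρ ρ' f f' ψ U U') (ht : t ∈ Icc (0 : ℝ) 1) {Q : Set ℂ}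
    (hQ : Q ⊆ f' t '' ball 0 1) :
    {x ∈ closedBall (0 : ℂ) 1 | x ∈ U → ψ x ∈ Q} ⊆ f t '' ball 0 1 := by
  rintro x ⟨hx, hxQ⟩
  by_contra hn
  have hxh : x ∈ hull f t := ⟨hx, hn⟩
  have hxU := h.hull_subset (h.chain.hull_mono ht ⟨zero_le_one, le_rfl⟩ ht.2 hxh)
  have h1 : ψ x ∈ hull f' t := by
    rw [h.hull_eq t ht]
    exact mem_image_of_mem _ hxh
  exact h1.2 (hQ (hxQ hxU))

/-- Properness of f_1, applied with Q = {0}, gives r at time 1. The same r serves all t: g_t ∘ f_1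
is a self-map of the disk fixing 0, so by Schwarz's lemma f_t(z) = f_1(w) implies |z| ≤ |w|. -/
theorem exists_radius (h : IsConjugation ρ ρ' f f' ψ U U') :
    ∃ r ∈ Ioo (0 : ℝ) 1, ∀ t ∈ Icc (0 : ℝ) 1, ∀ z : ℂ, r < ‖z‖ → ‖z‖ < 1 →
      f t z ∈ U ∧ conjMap f f' ψ t z ≠ 0 := by
  have h1 : (1 : ℝ) ∈ Icc (0 : ℝ) 1 := ⟨zero_le_one, le_rfl⟩
  have hQ : ({0} : Set ℂ) ⊆ f' 1 '' ball 0 1 := by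
    rw [singleton_subset_iff]
    exact ⟨0, by simp, h.chain'.map_zero 1 h1⟩
  have hsub := h.preimage_subset h1 hQ
  obtain ⟨r, hr, hrM⟩ := exists_radius_of_isCompact_subset_image (h.chain.holomorphic 1 h1)
    (h.chain.injective 1 h1) (h.isCompact_preimage isClosed_singleton) hsub
  refine ⟨r, hr, fun t ht z hrz hz1 => ?_⟩
  have hz : z ∈ ball (0 : ℂ) 1 := mem_ball_zero_iff.2 hz1
  have hn : f t z ∉ {x ∈ closedBall (0 : ℂ) 1 | x ∈ U → ψ x ∈ ({0} : Set ℂ)} := by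
    intro hM
    obtain ⟨w, hw, hwz⟩ := hsub hM
    have hg : MapsTo (fun w => uniformizing f t (f 1 w)) (ball 0 1) (closedBall 0 1) :=
      fun w hw => ball_subset_closedBall (Function.invFunOn_mem
        (h.chain.decreasing ht h1 ht.2 (mem_image_of_mem _ hw)))
    have hd : DifferentiableOn ℂ (fun w => uniformizing f t (f 1 w)) (ball 0 1) :=
      (h.chain.differentiableOn_uniformizing ht).comp (h.chain.holomorphic 1 h1)
        fun w hw => h.chain.decreasing ht h1 ht.2 (mem_image_of_mem _ hw)
    have h0 : uniformizing f t (f 1 0) = 0 := by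
      have h2 := h.chain.uniformizing_apply ht (z := 0) (by simp)
      rw [h.chain.map_zero t ht] at h2
      rwa [h.chain.map_zero 1 h1]
    have h2 := Complex.norm_le_norm_of_mapsTo_ball hd hg h0 (mem_ball_zero_iff.1 hw)
    rw [hwz, h.chain.uniformizing_apply ht hz] at h2
    have h3 := hrM w hw (by rwa [hwz])
    linarith
  have hzU : f t z ∈ U ∧ ψ (f t z) ≠ 0 := by
    by_contra hcon
    exact hn ⟨ball_subset_closedBall (h.chain.mapsTo ht hz), fun hU =>
      by_contra fun h0 => hcon ⟨hU, h0⟩⟩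
  refine ⟨hzU.1, fun h0 => hzU.2 ?_⟩
  rw [← h.map_conjMap ht hz hzU.1, h0, h.chain'.map_zero t ht]

/-- Properness of f_t again: the points whose image under ψ_t has modulus at most 1 − min(ε, 1),
together with those sent by f_t outside U, lie in a smaller disk. -/
theorem norm_conjMap_tendsto (h : IsConjugation ρ ρ' f f' ψ U U') (ht : t ∈ Icc (0 : ℝ) 1) :
    ∀ ε > 0, ∃ s < 1, ∀ z : ℂ, s < ‖z‖ → ‖z‖ < 1 → |‖conjMap f f' ψ t z‖ - 1| < ε := by
  intro ε hε
  have hb : 1 - min ε 1 < 1 := by simp [hε]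
  have hsub : closedBall (0 : ℂ) (1 - min ε 1) ⊆ ball 0 1 := closedBall_subset_ball hb
  have hQ : IsCompact (f' t '' closedBall 0 (1 - min ε 1)) :=
    (isCompact_closedBall _ _).image_of_continuousOn
      ((h.chain'.holomorphic t ht).continuousOn.mono hsub)
  obtain ⟨s, hs, hsM⟩ := exists_radius_of_isCompact_subset_image (h.chain.holomorphic t ht)
    (h.chain.injective t ht) (h.isCompact_preimage hQ.isClosed)
    (h.preimage_subset ht (image_mono hsub))
  refine ⟨s, hs.2, fun z hsz hz1 => ?_⟩
  have hz : z ∈ ball (0 : ℂ) 1 := mem_ball_zero_iff.2 hz1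
  have hzU : f t z ∈ U ∧ ψ (f t z) ∉ f' t '' closedBall 0 (1 - min ε 1) := by
    by_contra hcon
    refine absurd (hsM z hz ⟨ball_subset_closedBall (h.chain.mapsTo ht hz), fun hU =>
      by_contra fun h0 => hcon ⟨hU, h0⟩⟩) (not_lt.2 hsz.le)
  have h1 := mem_ball_zero_iff.1 (h.conjMap_mem ht hz hzU.1)
  have h2 : 1 - min ε 1 < ‖conjMap f f' ψ t z‖ := by
    by_contra hcon
    refine hzU.2 ⟨_, mem_closedBall_zero_iff.2 (not_lt.1 hcon), h.map_conjMap ht hz hzU.1⟩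
  rw [abs_sub_lt_iff]
  have := min_le_left ε 1
  constructor <;> linarith

/-- Near the circle, all the conjugated maps are defined and do not vanish. -/
structure IsRadius (f f' : ℝ → ℂ → ℂ) (ψ : ℂ → ℂ) (U : Set ℂ) (r : ℝ) : Prop where
  pos : 0 < r
  lt_one : r < 1
  mem : ∀ t ∈ Icc (0 : ℝ) 1, ∀ z ∈ annulus r 1, f t z ∈ U
  ne_zero : ∀ t ∈ Icc (0 : ℝ) 1, ∀ z ∈ annulus r 1, conjMap f f' ψ t z ≠ 0

theorem exists_isRadius (h : IsConjugation ρ ρ' f f' ψ U U') : ∃ r, IsRadius f f' ψ U r := by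
  obtain ⟨r, hr, hr2⟩ := h.exists_radius
  exact ⟨r, hr.1, hr.2, fun t ht z hz => (hr2 t ht z hz.1 hz.2).1,
    fun t ht z hz => (hr2 t ht z hz.1 hz.2).2⟩

theorem annulus_subset {r : ℝ} (hr : IsRadius f f' ψ U r) (ht : t ∈ Icc (0 : ℝ) 1) :
    annulus r 1 ⊆ {w ∈ ball (0 : ℂ) 1 | f t w ∈ U} :=
  fun _ hz => ⟨mem_ball_zero_iff.2 hz.2, hr.mem t ht _ hz⟩

theorem isCircleMap (h : IsConjugation ρ ρ' f f' ψ U U') {r a : ℝ} (hr : IsRadius f f' ψ U r)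
    (hra : r < a) (ha : a < 1) (ht : t ∈ Icc (0 : ℝ) 1) :
    IsCircleMap (reflectExt (conjMap f f' ψ t) a) a :=
  isCircleMap_reflectExt hr.pos hra ha ((h.differentiableOn_conjMap ht).mono (annulus_subset hr ht))
    (hr.ne_zero t ht)
    (fun _ hz => mem_ball_zero_iff.1 (h.conjMap_mem ht (annulus_subset hr ht hz).1
      (annulus_subset hr ht hz).2))
    ((h.injOn_conjMap ht).mono (annulus_subset hr ht)) (h.norm_conjMap_tendsto ht)

theorem reflectExt_conjMap (h : IsConjugation ρ ρ' f f' ψ U U') {r a : ℝ}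
    (hr : IsRadius f f' ψ U r) (hra : r < a) (ht : t ∈ Icc (0 : ℝ) 1)
    (hz : z ∈ annulus a 1) : reflectExt (conjMap f f' ψ t) a z = conjMap f f' ψ t z :=
  reflectExt_eq_of_lt_one hr.pos hra ((h.differentiableOn_conjMap ht).mono (annulus_subset hr ht))
    (hr.ne_zero t ht) (h.norm_conjMap_tendsto ht) hz

end IsConjugation

end LoewnerKufarev

/-! ### Joint continuity in time and space -/

namespace LoewnerKufarev

open Filter Topology ComplexConjugate

section Param

variable {X : Type*} [TopologicalSpace X]

theorem continuous_circleIntegral_param {G : X → ℂ → ℂ} {R : ℝ} (hR : 0 ≤ R)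
    (hG : ContinuousOn (fun p : X × ℂ => G p.1 p.2) (univ ×ˢ sphere 0 R)) :
    Continuous fun x => ∮ w in C(0, R), G x w := by
  simp only [circleIntegral, deriv_circleMap]
  refine intervalIntegral.continuous_parametric_intervalIntegral_of_continuous' ?_ _ _
  have h1 : Continuous fun p : X × ℝ => G p.1 (circleMap 0 R p.2) :=
    hG.comp_continuous (f := fun p : X × ℝ => (p.1, circleMap 0 R p.2)) (by fun_prop)
      fun p => ⟨mem_univ _, circleMap_mem_sphere 0 hR p.2⟩
  have h2 : Continuous fun p : X × ℝ => circleMap 0 R p.2 * Complex.I := by fun_prop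
  exact h2.smul h1

/-- Locally the z-derivative is a Cauchy integral over a circle of fixed radius, which is jointly
continuous because the integrand is. -/
theorem continuousOn_deriv_param {G : X → ℂ → ℂ} {Ω : Set ℂ} (hΩ : IsOpen Ω)
    (hG : ContinuousOn (Function.uncurry G) (univ ×ˢ Ω))
    (hd : ∀ x, DifferentiableOn ℂ (G x) Ω) :
    ContinuousOn (Function.uncurry fun x => deriv (G x)) (univ ×ˢ Ω) := by
  rintro ⟨x₀, z₀⟩ ⟨-, hz₀⟩
  obtain ⟨ε, hε, hεΩ⟩ := Metric.isOpen_iff.1 hΩ z₀ hz₀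
  have hδ : 0 < ε / 3 := by positivity
  have hsub : ∀ z ∈ ball z₀ (ε / 3), closedBall z (ε / 3) ⊆ Ω := fun z hz w hw => by
    refine hεΩ ?_
    rw [mem_ball] at hz ⊢
    rw [mem_closedBall] at hw
    linarith [dist_triangle w z z₀]
  have key : ContinuousOn (fun p : X × ℂ => Complex.cderiv (ε / 3) (G p.1) p.2)
      (univ ×ˢ ball z₀ (ε / 3)) := by
    rw [continuousOn_iff_continuous_domRestrict]
    simp only [domRestrict_def, Complex.cderiv, circleIntegral, deriv_circleMap,
      circleMap_sub_center]
    have hint := fun hc => (intervalIntegral.continuous_parametric_intervalIntegral_of_continuous'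
      (μ := volume) (f := fun (p : ↥((univ : Set X) ×ˢ ball z₀ (ε / 3))) θ =>
        (circleMap 0 (ε / 3) θ * Complex.I) • (circleMap 0 (ε / 3) θ ^ 2)⁻¹ •
          G p.1.1 (circleMap p.1.2 (ε / 3) θ)) hc 0 (2 * Real.pi))
    refine Continuous.const_smul (hint ?_) (2 * Real.pi * Complex.I : ℂ)⁻¹
    have h1 : Continuous fun p : ↥((univ : Set X) ×ˢ ball z₀ (ε / 3)) × ℝ =>
        G p.1.1.1 (circleMap p.1.1.2 (ε / 3) p.2) := by
      refine hG.comp_continuous (f := fun p : ↥((univ : Set X) ×ˢ ball z₀ (ε / 3)) × ℝ =>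
        (p.1.1.1, circleMap p.1.1.2 (ε / 3) p.2)) ?_ fun p => ⟨mem_univ _, ?_⟩
      · simp only [circleMap]
        fun_prop
      · exact hsub _ p.1.2.2 (sphere_subset_closedBall (circleMap_mem_sphere _ hδ.le _))
    have h2 : Continuous fun p : ↥((univ : Set X) ×ˢ ball z₀ (ε / 3)) × ℝ =>
        (circleMap 0 (ε / 3) p.2 ^ 2)⁻¹ := by
      refine Continuous.inv₀ (by fun_prop) fun p => pow_ne_zero 2 ?_
      exact circleMap_ne_center hδ.ne'
    have h3 : Continuous fun p : ↥((univ : Set X) ×ˢ ball z₀ (ε / 3)) × ℝ =>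
        circleMap 0 (ε / 3) p.2 * Complex.I := by fun_prop
    exact h3.smul (h2.smul h1)
  have hmem : (univ ×ˢ ball z₀ (ε / 3) : Set (X × ℂ)) ∈ 𝓝 (x₀, z₀) :=
    prod_mem_nhds univ_mem (ball_mem_nhds z₀ hδ)
  refine ((key.continuousAt hmem).congr ?_).continuousWithinAt
  filter_upwards [hmem] with p hp
  exact Complex.cderiv_eq_deriv hΩ (hd p.1) hδ (hsub _ hp.2)

theorem schwarzian_eq {E : ℂ → ℂ} {z : ℂ} (hE : AnalyticAt ℂ E z) (h0 : deriv E z ≠ 0) :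
    schwarzian E z = deriv (deriv (deriv E)) z / deriv E z
      - 3 / 2 * (deriv (deriv E) z / deriv E z) ^ 2 := by
  have h1 := hE.deriv.differentiableAt
  have h2 := hE.deriv.deriv.differentiableAt
  rw [schwarzian, deriv_fun_div h2 h1 h0]
  field_simp
  ring

theorem continuous_schwarzian_param {E : X → ℂ → ℂ} {a : ℝ} (hE : ∀ x, IsCircleMap (E x) a)
    (hc : ContinuousOn (Function.uncurry E) (univ ×ˢ annulus a a⁻¹)) :
    Continuous fun p : X × S1 => expI p.2 ^ 2 * schwarzian (E p.1) (expI p.2) := by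
  have ho := isOpen_annulus (a := a) (b := a⁻¹)
  have hd1 := fun x => (hE x).diff
  have hd2 := fun x => (hd1 x).deriv ho
  have hd3 := fun x => (hd2 x).deriv ho
  have h1 := continuousOn_deriv_param ho hc hd1
  have h2 := continuousOn_deriv_param ho h1 hd2
  have h3 := continuousOn_deriv_param ho h2 hd3
  have he := continuous_expI
  have hmap : ∀ p : X × S1, (p.1, expI p.2) ∈ (univ ×ˢ annulus a a⁻¹ : Set (X × ℂ)) := fun p =>
    ⟨mem_univ _, (hE p.1).mem_annulus_of_norm (norm_expI p.2)⟩
  have hm : Continuous fun p : X × S1 => (p.1, expI p.2) := by fun_prop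
  have c1 := h1.comp_continuous hm hmap
  have c2 := h2.comp_continuous hm hmap
  have c3 := h3.comp_continuous hm hmap
  have hne : ∀ p : X × S1, deriv (E p.1) (expI p.2) ≠ 0 := fun p =>
    (hE p.1).deriv_ne_zero (norm_expI p.2)
  have e : (fun p : X × S1 => schwarzian (E p.1) (expI p.2)) = fun p =>
      deriv (deriv (deriv (E p.1))) (expI p.2) / deriv (E p.1) (expI p.2)
      - 3 / 2 * (deriv (deriv (E p.1)) (expI p.2) / deriv (E p.1) (expI p.2)) ^ 2 := by
    ext p
    exact schwarzian_eq ((hE p.1).analyticAt (hmap p).2) (hne p)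
  have hs : Continuous fun p : X × S1 => schwarzian (E p.1) (expI p.2) := by
    rw [e]
    exact (c3.div c1 hne).sub (continuous_const.mul ((c2.div c1 hne).pow 2))
  exact ((he.comp continuous_snd).pow 2).mul hs

end Param

/-- A quantitative open mapping theorem, uniform for s near t: f_t stays away from f_t(w) on the
circle of radius δ about w, and f_s is uniformly close to f_t. It makes the inverse maps g_s depend
continuously on s. -/
theorem IsLoewnerChain.exists_ball_subset_image {ρ : Kernel ℝ S1} {f : ℝ → ℂ → ℂ}
    (hf : IsLoewnerChain ρ f) (hρ : ∫⁻ t in Icc (0 : ℝ) 1, ρ t univ ≠ ∞) {t : ℝ}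
    (ht : t ∈ Icc (0 : ℝ) 1) {w : ℂ} {δ : ℝ} (hδ : 0 < δ) (hwδ : ‖w‖ + δ < 1) :
    ∃ η > 0, ∀ s ∈ Icc (0 : ℝ) 1, |s - t| < η → ball (f t w) η ⊆ f s '' closedBall w δ := by
  have hsub : closedBall w δ ⊆ ball 0 1 := fun z hz => by
    rw [mem_ball_zero_iff]
    rw [mem_closedBall, dist_eq_norm] at hz
    linarith [norm_sub_norm_le z w]
  have hw : w ∈ closedBall w δ := mem_closedBall_self hδ.le
  have hn : ∀ z ∈ closedBall w δ, ‖z‖ ≤ ‖w‖ + δ := fun z hz => by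
    rw [mem_closedBall, dist_eq_norm] at hz
    linarith [norm_sub_norm_le z w]
  obtain ⟨ε, hε, hεs⟩ : ∃ ε > 0, ∀ z ∈ sphere w δ, ε ≤ ‖f t z - f t w‖ := by
    obtain ⟨z₁, hz₁, hmin⟩ := (isCompact_sphere w δ).exists_isMinOn
      (NormedSpace.sphere_nonempty.2 hδ.le) (f := fun z => ‖f t z - f t w‖)
      (((hf.holomorphic t ht).continuousOn.mono
        (sphere_subset_closedBall.trans hsub)).sub continuousOn_const).norm
    refine ⟨_, norm_pos_iff.2 (sub_ne_zero.2 fun e => ?_), fun z hz => hmin hz⟩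
    have := hf.injective t ht (hsub (sphere_subset_closedBall hz₁)) (hsub hw) e
    rw [this, mem_sphere, dist_self] at hz₁
    exact hδ.ne hz₁
  have hm : ContinuousOn (cumMass ρ) (Icc 0 1) := by
    have := (absolutelyContinuousOnInterval_cumMass hρ).continuousOn
    rwa [uIcc_of_le zero_le_one] at this
  obtain ⟨C, hC, hCf⟩ : ∃ C > 0, ∀ s ∈ Icc (0 : ℝ) 1, ∀ z ∈ closedBall w δ,
      ‖f s z - f t z‖ ≤ C * |cumMass ρ s - cumMass ρ t| := by
    have : 0 < 1 - (‖w‖ + δ) := sub_pos.2 hwδ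
    exact ⟨(2 / (1 - (‖w‖ + δ))) ^ 2, by positivity, fun s hs z hz =>
      hf.norm_sub_le hρ ht hs hwδ (hn z hz)⟩
  obtain ⟨η, hη, hηm⟩ := Metric.continuousOn_iff.1 hm t ht (ε / (8 * C)) (by positivity)
  -- If f_s and f_t differ by at most ε/8, then |f_s(z) − f_s(w)| ≥ ε/2 on the circle. The image
  -- covers the ball of radius ε/4 about f_s(w), hence that of radius ε/8 about f_t(w).
  refine ⟨min η (ε / 8), by positivity, fun s hs hst => ?_⟩
  have hd : ∀ z ∈ closedBall w δ, ‖f s z - f t z‖ ≤ ε / 8 := fun z hz => by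
    refine (hCf s hs z hz).trans ?_
    have h1 := (hηm s hs (hst.trans_le (min_le_left _ _))).le
    rw [Real.dist_eq, le_div_iff₀ (by positivity)] at h1
    linarith
  have hdw := hd w hw
  have key := ((hf.holomorphic s hs).mono hsub).diffContOnCl_ball subset_rfl
    |>.ball_subset_image_closedBall hδ (ε := ε / 2) (fun z hz => ?_) ?_
  · refine Subset.trans (ball_subset_ball' ?_) key
    rw [dist_comm, dist_eq_norm]
    linarith [min_le_right η (ε / 8)]
  · have h1 := hεs z hz
    have h2 := hd z (sphere_subset_closedBall hz)
    have h3 : f t z - f t w = (f s z - f s w) - (f s z - f t z) + (f s w - f t w) := by ring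
    rw [h3] at h1
    have h4 := norm_add_le ((f s z - f s w) - (f s z - f t z)) (f s w - f t w)
    have h5 := _root_.norm_sub_le (f s z - f s w) (f s z - f t z)
    linarith
  · have h1 : ∀ᶠ z in 𝓝[≠] w, f s z ≠ f s w := by
      filter_upwards [self_mem_nhdsWithin, nhdsWithin_le_nhds (closedBall_mem_nhds w hδ)]
        with z hz hzb e
      exact hz (hf.injective s hs (hsub hzb) (hsub hw) e)
    exact h1.frequently.filter_mono nhdsWithin_le_nhds

namespace IsConjugation

variable {ρ ρ' : Kernel ℝ S1} {f f' : ℝ → ℂ → ℂ} {ψ : ℂ → ℂ} {U U' : Set ℂ} {t r a : ℝ} {z : ℂ}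

theorem continuousOn_comp (h : IsConjugation ρ ρ' f f' ψ U U') (hr : IsRadius f f' ψ U r) :
    ContinuousOn (fun p : ℝ × ℂ => ψ (f p.1 p.2)) (Icc (0 : ℝ) 1 ×ˢ annulus r 1) := by
  refine h.conformal.holomorphic.continuousOn.comp (h.chain.continuousOn_prod.mono ?_) ?_
  · exact prod_mono subset_rfl fun z hz => mem_ball_zero_iff.2 hz.2
  · exact fun p hp => ⟨hr.mem _ hp.1 _ hp.2,
      h.chain.mapsTo hp.1 (mem_ball_zero_iff.2 hp.2.2)⟩

/-- For (s, x) near (t, z) the point ψ(f_s(x)) is near f'_t(ψ_t(z)), so by the uniform open mapping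
bound its preimage under f'_s is near ψ_t(z). -/
theorem continuousOn_conjMap (h : IsConjugation ρ ρ' f f' ψ U U')
    (hρ' : ∫⁻ t in Icc (0 : ℝ) 1, ρ' t univ ≠ ∞) (hr : IsRadius f f' ψ U r) :
    ContinuousOn (fun p : ℝ × ℂ => conjMap f f' ψ p.1 p.2) (Icc (0 : ℝ) 1 ×ˢ annulus r 1) := by
  rintro ⟨t, z⟩ ⟨ht, hz⟩
  obtain ⟨hzb, hzU⟩ := annulus_subset hr ht hz
  have hw := mem_ball_zero_iff.1 (h.conjMap_mem ht hzb hzU)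
  have hfw := h.map_conjMap ht hzb hzU
  rw [ContinuousWithinAt, Metric.tendsto_nhds]
  intro ε hε
  set w := conjMap f f' ψ t z with hwdef
  have hδ : 0 < min (ε / 2) ((1 - ‖w‖) / 2) := by
    have := sub_pos.2 hw
    positivity
  obtain ⟨η, hη, hηs⟩ := h.chain'.exists_ball_subset_image hρ' ht (w := w) hδ (by
    have := min_le_right (ε / 2) ((1 - ‖w‖) / 2)
    linarith)
  have hc := h.continuousOn_comp hr (t, z) ⟨ht, hz⟩
  have h1 := hc (ball_mem_nhds _ hη)
  have h2 : ∀ᶠ p : ℝ × ℂ in 𝓝[Icc (0 : ℝ) 1 ×ˢ annulus r 1] (t, z), |p.1 - t| < η :=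
    nhdsWithin_le_nhds
      ((isOpen_lt (by fun_prop) continuous_const).mem_nhds (by simpa using hη))
  filter_upwards [h1, h2, self_mem_nhdsWithin] with p hp1 hp2 hp
  simp only [mem_preimage] at hp1
  rw [← hfw] at hp1
  obtain ⟨y, hy, hyp⟩ := hηs p.1 hp.1 hp2 hp1
  have hyb : y ∈ ball (0 : ℂ) 1 := by
    rw [mem_ball_zero_iff]
    rw [mem_closedBall, dist_eq_norm] at hy
    linarith [norm_sub_norm_le y w, min_le_right (ε / 2) ((1 - ‖w‖) / 2)]
  rw [conjMap, ← hyp, h.chain'.uniformizing_apply hp.1 hyb]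
  refine (mem_closedBall.1 hy).trans_lt ?_
  linarith [min_le_left (ε / 2) ((1 - ‖w‖) / 2)]

theorem inv_conj_mem_sphere {w : ℂ}
    (hw : w ∈ sphere (0 : ℂ) a⁻¹) : (conj w)⁻¹ ∈ sphere (0 : ℂ) a := by
  rw [mem_sphere_zero_iff_norm] at hw ⊢
  rw [norm_inv, RCLike.norm_conj, hw, inv_inv]

/-- The defining integrals run over circles on which only values of ψ_t with |w| = a occur, so
continuity inside the disk suffices. -/
theorem continuousOn_reflectExt (h : IsConjugation ρ ρ' f f' ψ U U')
    (hρ' : ∫⁻ t in Icc (0 : ℝ) 1, ρ' t univ ≠ ∞) (hr : IsRadius f f' ψ U r)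
    (hra : r < a) (ha : a < 1) :
    ContinuousOn (Function.uncurry fun (t : Icc (0 : ℝ) 1) =>
      reflectExt (conjMap f f' ψ (t : ℝ)) a) (univ ×ˢ annulus a a⁻¹) := by
  have ha0 : 0 < a := hr.pos.trans hra
  have hF := h.continuousOn_conjMap hρ' hr
  have hsph : ∀ w ∈ sphere (0 : ℂ) a, w ∈ annulus r 1 := fun w hw => by
    rw [mem_sphere_zero_iff_norm] at hw
    exact ⟨hw ▸ hra, hw ▸ ha⟩
  have hinv := fun w (hw : w ∈ sphere (0 : ℂ) a⁻¹) => inv_conj_mem_sphere hw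
  rw [continuousOn_iff_continuous_domRestrict]
  simp only [domRestrict_def, reflectExt, Function.uncurry_def]
  refine continuous_const.mul (Continuous.sub ?_ ?_)
  · refine continuous_circleIntegral_param (by positivity) (ContinuousOn.fun_smul ?_ ?_)
    · refine ContinuousOn.inv₀ (by fun_prop) fun p hp e => ?_
      have h1 := mem_sphere_zero_iff_norm.1 hp.2
      rw [sub_eq_zero.1 e] at h1
      exact p.1.2.2.2.ne h1
    · simp only [reflect]
      refine ContinuousOn.inv₀ (Complex.continuous_conj.comp_continuousOn ?_) fun p hp => ?_
      · refine hF.comp (f := fun p : ↥((univ : Set (Icc (0 : ℝ) 1)) ×ˢ annulus a a⁻¹) × ℂ =>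
          ((p.1.1.1 : ℝ), (conj p.2)⁻¹)) ?_ fun p hp => ⟨p.1.1.1.2, hsph _ (hinv _ hp.2)⟩
        refine ContinuousOn.prodMk (by fun_prop) (ContinuousOn.inv₀ ?_ fun p hp e => ?_)
        · exact (Complex.continuous_conj.comp continuous_snd).continuousOn
        · have h1 := mem_sphere_zero_iff_norm.1 hp.2
          rw [← RCLike.norm_conj, e, norm_zero] at h1
          exact (inv_pos.2 ha0).ne h1
      · exact (map_ne_zero _).2 (hr.ne_zero _ p.1.1.1.2 _ (hsph _ (hinv _ hp.2)))
  · refine continuous_circleIntegral_param ha0.le (ContinuousOn.fun_smul ?_ ?_)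
    · refine ContinuousOn.inv₀ (by fun_prop) fun p hp e => ?_
      have h1 := mem_sphere_zero_iff_norm.1 hp.2
      rw [sub_eq_zero.1 e] at h1
      exact p.1.2.2.1.ne' h1
    · refine hF.comp (f := fun p : ↥((univ : Set (Icc (0 : ℝ) 1)) ×ˢ annulus a a⁻¹) × ℂ =>
          ((p.1.1.1 : ℝ), p.2)) (by fun_prop) fun p hp => ⟨p.1.1.1.2, hsph _ hp.2⟩

theorem continuous_schwarzian_reflectExt (h : IsConjugation ρ ρ' f f' ψ U U')
    (hρ' : ∫⁻ t in Icc (0 : ℝ) 1, ρ' t univ ≠ ∞) (hr : IsRadius f f' ψ U r)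
    (hra : r < a) (ha : a < 1) :
    Continuous fun p : Icc (0 : ℝ) 1 × S1 =>
      expI p.2 ^ 2 * schwarzian (reflectExt (conjMap f f' ψ p.1) a) (expI p.2) :=
  continuous_schwarzian_param (X := Icc (0 : ℝ) 1)
    (E := fun t => reflectExt (conjMap f f' ψ (t : ℝ)) a) (fun t => h.isCircleMap hr hra ha t.2)
    (h.continuousOn_reflectExt hρ' hr hra ha)

end IsConjugation

end LoewnerKufarev

/-! ### Time derivative of the conjugated map inside the disk -/

namespace LoewnerKufarev

open Filter Topology ComplexConjugate

open IsLoewnerChain (IsRegularTime)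

/-- A holomorphic map of a disk into the unit disk is Lipschitz on the concentric disk of half the
radius. -/
theorem norm_sub_le_of_mapsTo_ball {g : ℂ → ℂ} {x₀ : ℂ} {η : ℝ}
    (hg : DifferentiableOn ℂ g (ball x₀ η)) (hm : MapsTo g (ball x₀ η) (ball 0 1)) {x y : ℂ}
    (hx : x ∈ ball x₀ (η / 2)) (hy : y ∈ ball x₀ (η / 2)) :
    ‖g x - g y‖ ≤ 4 / η * ‖x - y‖ := by
  have hη : 0 < η / 2 := pos_of_mem_ball hx
  have hsub : ∀ z ∈ ball x₀ (η / 2), ball z (η / 2) ⊆ ball x₀ η := fun z hz =>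
    ball_subset_ball' (by rw [mem_ball] at hz; linarith)
  have hsub2 : ball x₀ (η / 2) ⊆ ball x₀ η := ball_subset_ball (by linarith)
  refine (convex_ball x₀ (η / 2)).norm_image_sub_le_of_norm_deriv_le (𝕜 := ℂ)
    (fun z hz => hg.differentiableAt (isOpen_ball.mem_nhds (hsub2 hz))) (fun z hz => ?_) hy hx
  have h1 : ‖deriv g z‖ ≤ 2 / (η / 2) := by
    refine Complex.norm_deriv_le_div_of_mapsTo_ball (hg.mono (hsub z hz)) (fun w hw => ?_) hη
    rw [mem_closedBall, dist_eq_norm]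
    have h1 := mem_ball_zero_iff.1 (hm (hsub z hz hw))
    have h2 := mem_ball_zero_iff.1 (hm (hsub2 hz))
    linarith [norm_sub_le (g w) (g z)]
  refine h1.trans_eq ?_
  field_simp
  norm_num

theorem hasDerivAt_zero_of_norm_le_sq {R : ℝ → ℂ} {t C : ℝ} (h0 : R t = 0)
    (h : ∀ᶠ s in 𝓝 t, ‖R s‖ ≤ C * |s - t| ^ 2) : HasDerivAt R 0 t := by
  rw [hasDerivAt_iff_isLittleO]
  simp only [smul_zero, sub_zero, h0]
  have h1 : R =O[𝓝 t] fun s => (s - t) ^ 2 := by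
    refine Asymptotics.IsBigO.of_bound C ?_
    filter_upwards [h] with s hs
    rwa [norm_pow, Real.norm_eq_abs]
  refine h1.trans_isLittleO ?_
  have h2 : (fun s : ℝ => (s - t) ^ 2) = (fun x : ℝ => x ^ 2) ∘ fun s => s - t := rfl
  have h3 : (fun s : ℝ => s - t) = (fun x : ℝ => x) ∘ fun s => s - t := rfl
  rw [h2, h3]
  refine Asymptotics.IsLittleO.comp_tendsto (l := 𝓝 0) ?_ ?_
  · simpa using Asymptotics.isLittleO_pow_pow (𝕜 := ℝ) one_lt_two
  · have : Continuous fun s : ℝ => s - t := by fun_prop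
    simpa [Function.comp_def] using this.tendsto t

namespace IsConjugation

variable {ρ ρ' : Kernel ℝ S1} {f f' : ℝ → ℂ → ℂ} {ψ : ℂ → ℂ} {U U' : Set ℂ} {t r a : ℝ} {z : ℂ}

theorem prod_mem_nhds_of_annulus (ht : t ∈ Ioo (0 : ℝ) 1) (hz : z ∈ annulus r 1) :
    Icc (0 : ℝ) 1 ×ˢ annulus r 1 ∈ 𝓝 (t, z) :=
  prod_mem_nhds (Icc_mem_nhds ht.1 ht.2) ((isOpen_annulus (a := r) (b := 1)).mem_nhds hz)

/-- Apply g'_s to ψ(f_s(x)) and to f'_s(ψ_t(x)): both are within O(|s − t|) of ψ(f_t(x)). The maps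
g'_s are uniformly Lipschitz near that point, being maps into the unit disk defined on a common
ball. -/
theorem exists_norm_conjMap_sub_le (h : IsConjugation ρ ρ' f f' ψ U U')
    (hρ : ∫⁻ t in Icc (0 : ℝ) 1, ρ t univ ≠ ∞) (hρ' : ∫⁻ t in Icc (0 : ℝ) 1, ρ' t univ ≠ ∞)
    (hr : IsRadius f f' ψ U r) (ht : IsRegularTime ρ f t) (ht' : IsRegularTime ρ' f' t)
    (hz : z ∈ annulus r 1) :
    ∃ C, ∀ᶠ p : ℝ × ℂ in 𝓝 (t, z),
      ‖conjMap f f' ψ p.1 p.2 - conjMap f f' ψ t p.2‖ ≤ C * |p.1 - t| := by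
  have htm := Ioo_subset_Icc_self ht.mem
  obtain ⟨hzb, hzU⟩ := annulus_subset hr htm hz
  have hw := h.conjMap_mem htm hzb hzU
  have hfw := h.map_conjMap htm hzb hzU
  have hN := prod_mem_nhds_of_annulus (r := r) ht.mem hz
  set w := conjMap f f' ψ t z with hwdef
  obtain ⟨b', hwb', hb'⟩ := exists_between (mem_ball_zero_iff.1 hw)
  obtain ⟨b, hzb1, hb⟩ := exists_between (mem_ball_zero_iff.1 hzb)
  obtain ⟨C, hC0, hC⟩ := ht.exists_norm_sub_le h.chain hρ hb
  obtain ⟨C', hC0', hC'⟩ := ht'.exists_norm_sub_le h.chain' hρ' hb'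
  have hδ : 0 < (1 - ‖w‖) / 2 := by linarith [mem_ball_zero_iff.1 hw]
  obtain ⟨η, hη, hηs⟩ := h.chain'.exists_ball_subset_image hρ' htm (w := w) hδ (by linarith)
  have hη2 : 0 < η / 2 := by positivity
  -- `ψ` is Lipschitz near `f t z`
  have hsrc : U ∩ ball 0 1 ∈ 𝓝 (f t z) := h.isOpen_source.mem_nhds ⟨hzU, h.chain.mapsTo htm hzb⟩
  obtain ⟨K, S, hS, hK⟩ :=
    (h.conformal.holomorphic.analyticAt hsrc).hasStrictDerivAt.hasStrictFDerivAt.exists_lipschitzOnWith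
  -- continuity of the maps involved
  have hfc : ContinuousAt (fun p : ℝ × ℂ => f p.1 p.2) (t, z) :=
    (h.chain.continuousOn_prod.mono (prod_mono subset_rfl fun x hx =>
      mem_ball_zero_iff.2 hx.2)).continuousAt hN
  have hψc : ContinuousAt (fun p : ℝ × ℂ => ψ (f p.1 p.2)) (t, z) :=
    (h.continuousOn_comp hr).continuousAt hN
  have hsnd : Tendsto (fun p : ℝ × ℂ => (t, p.2)) (𝓝 (t, z)) (𝓝 (t, z)) := by
    have : Continuous fun p : ℝ × ℂ => (t, p.2) := by fun_prop
    exact this.tendsto (t, z)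
  have hFc : ContinuousAt (fun p : ℝ × ℂ => conjMap f f' ψ t p.2) (t, z) :=
    ((h.continuousOn_conjMap hρ' hr).continuousAt hN).tendsto.comp hsnd
  have hf'c : ContinuousAt (fun p : ℝ × ℂ => f' p.1 (conjMap f f' ψ t p.2)) (t, z) := by
    have h1 : ContinuousAt (fun p : ℝ × ℂ => f' p.1 p.2) (t, w) :=
      h.chain'.continuousOn_prod.continuousAt
        (prod_mem_nhds (Icc_mem_nhds ht.mem.1 ht.mem.2) (isOpen_ball.mem_nhds hw))
    exact h1.comp (f := fun p : ℝ × ℂ => (p.1, conjMap f f' ψ t p.2))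
      (continuousAt_fst.prodMk hFc)
  have e1 : ∀ᶠ p : ℝ × ℂ in 𝓝 (t, z), ψ (f p.1 p.2) ∈ ball (f' t w) (η / 2) := by
    refine hψc (isOpen_ball.mem_nhds ?_)
    simp only [← hfw]
    exact mem_ball_self hη2
  have e2 : ∀ᶠ p : ℝ × ℂ in 𝓝 (t, z), f' p.1 (conjMap f f' ψ t p.2) ∈ ball (f' t w) (η / 2) :=
    hf'c (isOpen_ball.mem_nhds (mem_ball_self hη2))
  have e3 : ∀ᶠ p : ℝ × ℂ in 𝓝 (t, z), f p.1 p.2 ∈ S := hfc hS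
  have e4 : ∀ᶠ p : ℝ × ℂ in 𝓝 (t, z), f t p.2 ∈ S := (hfc.tendsto.comp hsnd) hS
  have e5 : ∀ᶠ p : ℝ × ℂ in 𝓝 (t, z), ‖conjMap f f' ψ t p.2‖ < b' :=
    hFc.norm.eventually_lt_const hwb'
  have e6 : ∀ᶠ p : ℝ × ℂ in 𝓝 (t, z), ‖p.2‖ < b :=
    continuousAt_snd.norm.eventually_lt_const hzb1
  have e7 : ∀ᶠ p : ℝ × ℂ in 𝓝 (t, z), |p.1 - t| < η :=
    (isOpen_lt (by fun_prop) continuous_const).mem_nhds (by simpa using hη)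
  refine ⟨4 / η * (K * C + C'), ?_⟩
  filter_upwards [e1, e2, e3, e4, e5, e6, e7, hN, continuousAt_fst.eventually hC,
    continuousAt_fst.eventually hC'] with p h1 h2 h3 h4 h5 h6 h7 h8 h9 h10
  have him := hηs p.1 h8.1 h7
  have hsub : closedBall w ((1 - ‖w‖) / 2) ⊆ ball 0 1 := fun y hy => by
    rw [mem_ball_zero_iff]
    rw [mem_closedBall, dist_eq_norm] at hy
    linarith [norm_sub_norm_le y w]
  have him' : ball (f' t w) η ⊆ f' p.1 '' ball 0 1 := him.trans (image_mono hsub)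
  have hgd := (h.chain'.differentiableOn_uniformizing h8.1).mono him'
  have hgm : MapsTo (uniformizing f' p.1) (ball (f' t w) η) (ball 0 1) := fun y hy =>
    Function.invFunOn_mem (him' hy)
  have hFb : conjMap f f' ψ t p.2 ∈ ball (0 : ℂ) 1 := mem_ball_zero_iff.2 (h5.trans hb')
  have key := norm_sub_le_of_mapsTo_ball hgd hgm h1 h2
  rw [h.chain'.uniformizing_apply h8.1 hFb] at key
  refine key.trans ?_
  rw [mul_assoc]
  gcongr
  have hp2 := annulus_subset hr htm h8.2
  have k1 : ‖ψ (f p.1 p.2) - ψ (f t p.2)‖ ≤ K * (C * |p.1 - t|) :=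
    (hK.norm_sub_le h3 h4).trans (by gcongr; exact h9 _ h6.le)
  have k2 := h10 _ h5.le
  rw [h.map_conjMap htm hp2.1 hp2.2] at k2
  have k3 : ψ (f p.1 p.2) - f' p.1 (conjMap f f' ψ t p.2) = (ψ (f p.1 p.2) - ψ (f t p.2))
      - (f' p.1 (conjMap f f' ψ t p.2) - ψ (f t p.2)) := by ring
  rw [k3]
  refine (norm_sub_le _ _).trans ?_
  linarith

theorem exists_norm_conjMap_sub_le_of_isCompact (h : IsConjugation ρ ρ' f f' ψ U U')
    (hρ : ∫⁻ t in Icc (0 : ℝ) 1, ρ t univ ≠ ∞) (hρ' : ∫⁻ t in Icc (0 : ℝ) 1, ρ' t univ ≠ ∞)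
    (hr : IsRadius f f' ψ U r) (ht : IsRegularTime ρ f t) (ht' : IsRegularTime ρ' f' t)
    {M : Set ℂ} (hM : IsCompact M) (hMr : M ⊆ annulus r 1) :
    ∃ C, ∀ᶠ s in 𝓝 t, ∀ z ∈ M,
      ‖conjMap f f' ψ s z - conjMap f f' ψ t z‖ ≤ C * |s - t| := by
  refine hM.induction_on (p := fun M => ∃ C, ∀ᶠ s in 𝓝 t, ∀ z ∈ M,
      ‖conjMap f f' ψ s z - conjMap f f' ψ t z‖ ≤ C * |s - t|) ⟨0, by simp⟩ ?_ ?_ ?_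
  · rintro S T hST ⟨C, hC⟩
    exact ⟨C, hC.mono fun s hs z hz => hs z (hST hz)⟩
  · rintro S T ⟨C, hC⟩ ⟨C', hC'⟩
    refine ⟨max C C', ?_⟩
    filter_upwards [hC, hC'] with s h1 h2 z hz
    rcases hz with hz | hz
    · exact (h1 z hz).trans (by gcongr; exact le_max_left _ _)
    · exact (h2 z hz).trans (by gcongr; exact le_max_right _ _)
  · intro z hz
    obtain ⟨C, hC⟩ := h.exists_norm_conjMap_sub_le hρ hρ' hr ht ht' (hMr hz)
    rw [nhds_prod_eq, eventually_prod_iff] at hC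
    obtain ⟨pa, ha, pb, hb, hab⟩ := hC
    exact ⟨{z | pb z}, nhdsWithin_le_nhds hb, C, ha.mono fun s hs z hz => hab hs hz⟩

/-- The time derivative of the conjugated map. -/
noncomputable def conjMapDot (ρ ρ' : Kernel ℝ S1) (f f' : ℝ → ℂ → ℂ) (ψ : ℂ → ℂ) (t : ℝ) (z : ℂ) :
    ℂ :=
  conjMap f f' ψ t z * herglotz (ρ' t) (conjMap f f' ψ t z)
    - z * deriv (conjMap f f' ψ t) z * herglotz (ρ t) z

/-- Differentiate f'_s(ψ_s(z)) = ψ(f_s(z)). Both the map and its argument move with s, while f'_s is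
differentiable in s only at fixed points, so the mixed increment is shown to be of second order. -/
theorem hasDerivAt_conjMap (h : IsConjugation ρ ρ' f f' ψ U U')
    (hρ : ∫⁻ t in Icc (0 : ℝ) 1, ρ t univ ≠ ∞) (hρ' : ∫⁻ t in Icc (0 : ℝ) 1, ρ' t univ ≠ ∞)
    (hr : IsRadius f f' ψ U r) (ht : IsRegularTime ρ f t) (ht' : IsRegularTime ρ' f' t)
    (hz : z ∈ annulus r 1) :
    HasDerivAt (fun s => conjMap f f' ψ s z) (conjMapDot ρ ρ' f f' ψ t z) t := by
  have htm := Ioo_subset_Icc_self ht.mem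
  obtain ⟨hzb, hzU⟩ := annulus_subset hr htm hz
  have hw := h.conjMap_mem htm hzb hzU
  have hfw := h.map_conjMap htm hzb hzU
  set w := conjMap f f' ψ t z with hwdef
  have hsrc : U ∩ ball 0 1 ∈ 𝓝 (f t z) := h.isOpen_source.mem_nhds ⟨hzU, h.chain.mapsTo htm hzb⟩
  have hψd := (h.conformal.holomorphic.differentiableAt hsrc).hasDerivAt
  have hy : HasDerivAt (fun s => ψ (f s z))
      (deriv ψ (f t z) * (-z * deriv (f t) z * herglotz (ρ t) z)) t :=
    hψd.comp t (ht.equation z hzb)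
  have hf'0 := h.chain'.deriv_ne_zero htm hw
  have hginv := hasDerivAt_invFunOn_of_ne isOpen_ball (h.chain'.holomorphic t htm)
    (h.chain'.injective t htm) hw hf'0
  have hF' : deriv (conjMap f f' ψ t) z
      = (deriv (f' t) w)⁻¹ * (deriv ψ (f t z) * deriv (f t) z) := by
    have h1 : HasDerivAt (f t) (deriv (f t) z) z :=
      ((h.chain.holomorphic t htm).differentiableAt (isOpen_ball.mem_nhds hzb)).hasDerivAt
    rw [hfw] at hginv
    exact (hginv.comp z (hψd.comp z h1)).deriv
  obtain ⟨C, hC⟩ := h.exists_norm_conjMap_sub_le_of_isCompact hρ hρ' hr ht ht'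
    (isCompact_singleton (x := z)) (singleton_subset_iff.2 hz)
  have hIcc := Icc_mem_nhds ht.mem.1 ht.mem.2
  have hcont : ContinuousAt (fun s => conjMap f f' ψ s z) t := by
    have h1 := (h.continuousOn_conjMap hρ' hr).continuousAt (prod_mem_nhds_of_annulus ht.mem hz)
    exact ContinuousAt.comp (f := fun s : ℝ => (s, z)) h1 (by fun_prop)
  -- the remainder term
  obtain ⟨b, hwb, hb⟩ := exists_between (mem_ball_zero_iff.1 hw)
  obtain ⟨C', hC0', hC'⟩ := ht'.exists_norm_sub_le h.chain' hρ' hb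
  set δ := b - ‖w‖ with hδ
  have hδ0 : 0 < δ := sub_pos.2 hwb
  -- On a disk of radius δ about w, f'_s − f'_t is O(|s − t|), so by Schwarz's lemma its Lipschitz
  -- constant is too. Since ψ_s(z) − w = O(|s − t|), the remainder is quadratic.
  have hR : HasDerivAt (fun s => (f' s (conjMap f f' ψ s z) - f' t (conjMap f f' ψ s z))
      - (f' s w - f' t w)) 0 t := by
    refine hasDerivAt_zero_of_norm_le_sq (C := 2 * C' / δ * C) (by simp [hwdef]) ?_
    filter_upwards [hC, hC', hIcc, hcont (ball_mem_nhds w hδ0)] with s h1 h2 h3 h4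
    have hbb : ∀ y ∈ ball w δ, ‖y‖ ≤ b := fun y hy => by
      rw [mem_ball, dist_eq_norm] at hy
      linarith [norm_sub_norm_le y w]
    have hsub : ball w δ ⊆ ball 0 1 := fun y hy =>
      mem_ball_zero_iff.2 ((hbb y hy).trans_lt hb)
    have key := Complex.dist_le_div_mul_dist_of_mapsTo_ball
      (f := fun y => f' s y - f' t y) (c := w) (R₁ := δ) (R₂ := 2 * C' * |s - t|)
      (((h.chain'.holomorphic s h3).sub (h.chain'.holomorphic t htm)).mono hsub)
      (fun y hy => ?_) h4
    · rw [dist_eq_norm, dist_eq_norm] at key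
      have h5 := h1 z rfl
      refine key.trans ?_
      calc 2 * C' * |s - t| / δ * ‖conjMap f f' ψ s z - w‖
          ≤ 2 * C' * |s - t| / δ * (C * |s - t|) := by gcongr
        _ = _ := by ring
    · rw [mem_closedBall, dist_eq_norm]
      refine (norm_sub_le _ _).trans ?_
      have := h2 y (hbb y hy)
      have := h2 w hwb.le
      linarith
  -- Uses f'_t(ψ_s(z)) = ψ(f_s(z)) − (f'_s(w) − f'_t(w)) − remainder, where every term on the right
  -- is differentiable at t.
  have hA : HasDerivAt (fun s => f' t (conjMap f f' ψ s z))
      (deriv ψ (f t z) * (-z * deriv (f t) z * herglotz (ρ t) z)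
        - (-w * deriv (f' t) w * herglotz (ρ' t) w)) t := by
    have h1 := (hy.sub ((ht'.equation w hw).sub_const (f' t w))).sub hR
    rw [sub_zero] at h1
    refine h1.congr_of_eventuallyEq ?_
    filter_upwards [hIcc] with s hs
    have := h.map_conjMap hs hzb (hr.mem s hs z hz)
    simp only [Pi.sub_apply]
    rw [this]
    ring
  have hfin : HasDerivAt (fun s => uniformizing f' t (f' t (conjMap f f' ψ s z)))
      ((deriv (f' t) w)⁻¹ * (deriv ψ (f t z) * (-z * deriv (f t) z * herglotz (ρ t) z)
        - (-w * deriv (f' t) w * herglotz (ρ' t) w))) t := hginv.comp t hA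
  refine (hfin.congr_of_eventuallyEq ?_).congr_deriv ?_
  · filter_upwards [hIcc] with s hs
    rw [h.chain'.uniformizing_apply htm (h.conjMap_mem hs hzb (hr.mem s hs z hz))]
  · rw [conjMapDot, hF', ← hwdef]
    field_simp
    ring

end IsConjugation

end LoewnerKufarev

/-! ### Time derivative on the circle and the pointwise distortion formula -/

namespace LoewnerKufarev

open Filter Topology ComplexConjugate

open IsLoewnerChain (IsRegularTime)

namespace IsConjugation

variable {ρ ρ' : Kernel ℝ S1} {f f' : ℝ → ℂ → ℂ} {ψ : ℂ → ℂ} {U U' : Set ℂ} {t r a : ℝ} {z : ℂ}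

theorem continuousOn_conjMapDot (h : IsConjugation ρ ρ' f f' ψ U U') (hr : IsRadius f f' ψ U r)
    (ht : IsRegularTime ρ f t) (ht' : IsRegularTime ρ' f' t) :
    ContinuousOn (conjMapDot ρ ρ' f f' ψ t) (annulus r 1) := by
  have htm := Ioo_subset_Icc_self ht.mem
  have := ht.finite
  have := ht'.finite
  have hd := (h.differentiableOn_conjMap htm).mono (annulus_subset hr htm)
  have hH' : ContinuousOn (fun z => herglotz (ρ' t) (conjMap f f' ψ t z)) (annulus r 1) :=
    (continuousOn_herglotz (ρ' t)).comp hd.continuousOn fun z hz =>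
      h.conjMap_mem htm (annulus_subset hr htm hz).1 (annulus_subset hr htm hz).2
  have hH : ContinuousOn (herglotz (ρ t)) (annulus r 1) :=
    (continuousOn_herglotz (ρ t)).mono fun z hz => mem_ball_zero_iff.2 hz.2
  exact (hd.continuousOn.mul hH').sub
    ((continuousOn_id.mul (hd.deriv (isOpen_annulus r 1)).continuousOn).mul hH)

/-- The time derivative of the reflected conjugated map. -/
noncomputable def reflectDot (F D : ℂ → ℂ) (w : ℂ) : ℂ :=
  -conj (D (conj w)⁻¹) / conj (F (conj w)⁻¹) ^ 2

/-- The time derivative of the extended conjugated map. -/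
noncomputable def extDot (F D : ℂ → ℂ) (a : ℝ) (z : ℂ) : ℂ :=
  (2 * Real.pi * Complex.I)⁻¹ * ((∮ w in C(0, a⁻¹), (w - z)⁻¹ • reflectDot F D w)
    - ∮ w in C(0, a), (w - z)⁻¹ • D w)

theorem sphere_subset_annulus (hra : r < a) (ha : a < 1) : sphere (0 : ℂ) a ⊆ annulus r 1 :=
  fun w hw => by
    rw [mem_sphere_zero_iff_norm] at hw
    exact ⟨hw ▸ hra, hw ▸ ha⟩

theorem continuousOn_inv_conj (ha : 0 < a) :
    ContinuousOn (fun w : ℂ => (conj w)⁻¹) (sphere 0 a⁻¹) :=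
  Complex.continuous_conj.continuousOn.inv₀ fun w hw e => by
    have h1 := mem_sphere_zero_iff_norm.1 hw
    rw [← RCLike.norm_conj, e, norm_zero] at h1
    exact (inv_pos.2 ha).ne h1

theorem continuousOn_reflectDot (ha : 0 < a) {F D : ℂ → ℂ} (hF : ContinuousOn F (sphere 0 a))
    (hF0 : ∀ w ∈ sphere 0 a, F w ≠ 0) (hD : ContinuousOn D (sphere 0 a)) :
    ContinuousOn (reflectDot F D) (sphere 0 a⁻¹) := by
  have hi := continuousOn_inv_conj ha
  have hm : MapsTo (fun w : ℂ => (conj w)⁻¹) (sphere 0 a⁻¹) (sphere 0 a) :=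
    fun w hw => inv_conj_mem_sphere hw
  refine ((Complex.continuous_conj.comp_continuousOn (hD.comp hi hm)).neg).div
    ((Complex.continuous_conj.comp_continuousOn (hF.comp hi hm)).pow 2) fun w hw => ?_
  exact pow_ne_zero 2 ((map_ne_zero _).2 (hF0 _ (hm hw)))

theorem continuousOn_extDot (ha : 0 < a) {F D : ℂ → ℂ} (hF : ContinuousOn F (sphere 0 a))
    (hF0 : ∀ w ∈ sphere 0 a, F w ≠ 0) (hD : ContinuousOn D (sphere 0 a)) :
    ContinuousOn (extDot F D a) (annulus a a⁻¹) := fun z hz => by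
  refine ContinuousAt.continuousWithinAt (continuousAt_const.mul (ContinuousAt.sub ?_ ?_))
  · exact (differentiableAt_circleIntegral_cauchy (inv_pos.2 ha)
      (continuousOn_reflectDot ha hF hF0 hD) hz.2.ne).continuousAt
  · exact (differentiableAt_circleIntegral_cauchy ha hD hz.1.ne').continuousAt

/-- The Cauchy integrals see ψ_s only on |w| = a, where its time derivative is known.
Differentiating them gives the time derivative on the whole annulus, the unit circle included. -/
theorem hasDerivAt_reflectExt_conjMap (h : IsConjugation ρ ρ' f f' ψ U U')
    (hρ : ∫⁻ t in Icc (0 : ℝ) 1, ρ t univ ≠ ∞) (hρ' : ∫⁻ t in Icc (0 : ℝ) 1, ρ' t univ ≠ ∞)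
    (hr : IsRadius f f' ψ U r) (hra : r < a) (ha : a < 1)
    (ht : IsRegularTime ρ f t) (ht' : IsRegularTime ρ' f' t) (hz : z ∈ annulus a a⁻¹) :
    HasDerivAt (fun s => reflectExt (conjMap f f' ψ s) a z)
      (extDot (conjMap f f' ψ t) (conjMapDot ρ ρ' f f' ψ t) a z) t := by
  have htm := Ioo_subset_Icc_self ht.mem
  have hIcc := Icc_mem_nhds ht.mem.1 ht.mem.2
  have ha0 : 0 < a := hr.pos.trans hra
  have hsph := sphere_subset_annulus hra ha
  have hFc : ∀ s ∈ Icc (0 : ℝ) 1, ContinuousOn (conjMap f f' ψ s) (sphere 0 a) := fun s hs =>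
    ((h.differentiableOn_conjMap hs).mono (annulus_subset hr hs)).continuousOn.mono hsph
  have hF0 : ∀ s ∈ Icc (0 : ℝ) 1, ∀ w ∈ sphere (0 : ℂ) a, conjMap f f' ψ s w ≠ 0 :=
    fun s hs w hw => hr.ne_zero s hs w (hsph hw)
  have hDc := (h.continuousOn_conjMapDot hr ht ht').mono hsph
  obtain ⟨C, hC⟩ := h.exists_norm_conjMap_sub_le_of_isCompact hρ hρ' hr ht ht'
    (isCompact_sphere 0 a) hsph
  -- A lower bound c for |ψ_t|, and c/2 for |ψ_s| when s is close to t, makes the reflected map 1/ψ̄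
  -- Lipschitz in time.
  obtain ⟨c, hc, hcF⟩ : ∃ c > 0, ∀ w ∈ sphere (0 : ℂ) a, c ≤ ‖conjMap f f' ψ t w‖ := by
    obtain ⟨z₁, hz₁, hmin⟩ := (isCompact_sphere (0 : ℂ) a).exists_isMinOn
      (NormedSpace.sphere_nonempty.2 ha0.le) (hFc t htm).norm
    exact ⟨_, norm_pos_iff.2 (hF0 t htm z₁ hz₁), fun w hw => hmin hw⟩
  have hsmall : ∀ᶠ s in 𝓝 t, C * |s - t| < c / 2 := by
    refine (isOpen_lt (by fun_prop) continuous_const).mem_nhds ?_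
    simpa using hc
  have hk : ∀ R : ℝ, ‖z‖ ≠ R → ContinuousOn (fun w => (w - z)⁻¹) (sphere (0 : ℂ) R) :=
    fun R hR => ContinuousOn.inv₀ (by fun_prop) fun w hw e => hR (by
      rw [← sub_eq_zero.1 e]; exact mem_sphere_zero_iff_norm.1 hw)
  refine HasDerivAt.const_mul _ (HasDerivAt.sub ?_ ?_)
  · refine hasDerivAt_circleIntegral_param (G := fun s => reflect (conjMap f f' ψ s))
      (C := C / (c / 2 * c)) (inv_pos.2 ha0).le ?_ (hk _ hz.2.ne)
      (continuousOn_reflectDot ha0 (hFc t htm) (hF0 t htm) hDc) ?_ fun w hw => ?_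
    · filter_upwards [hIcc] with s hs
      refine ContinuousOn.inv₀ (Complex.continuous_conj.comp_continuousOn
        ((hFc s hs).comp (continuousOn_inv_conj ha0) fun w hw => inv_conj_mem_sphere hw))
        fun w hw => (map_ne_zero _).2 (hF0 s hs _ (inv_conj_mem_sphere hw))
    · filter_upwards [hIcc, hC, hsmall] with s hs h1 h2 w hw
      have hw' := inv_conj_mem_sphere hw
      have h3 := h1 _ hw'
      have h4 := hcF _ hw'
      have h5 : c / 2 ≤ ‖conjMap f f' ψ s (conj w)⁻¹‖ := by
        have := norm_sub_norm_le (conjMap f f' ψ t (conj w)⁻¹) (conjMap f f' ψ s (conj w)⁻¹)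
        rw [norm_sub_rev] at this
        linarith
      have n1 : conj (conjMap f f' ψ s (conj w)⁻¹) ≠ 0 := (map_ne_zero _).2 (hF0 s hs _ hw')
      have n2 : conj (conjMap f f' ψ t (conj w)⁻¹) ≠ 0 := (map_ne_zero _).2 (hF0 t htm _ hw')
      rw [reflect, reflect, inv_sub_inv n1 n2, norm_div, norm_mul, RCLike.norm_conj,
        RCLike.norm_conj, ← map_sub, RCLike.norm_conj, norm_sub_rev, div_mul_eq_mul_div]
      have h6 := (norm_nonneg _).trans h3
      gcongr
    · have hw' := inv_conj_mem_sphere hw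
      have h1 := h.hasDerivAt_conjMap hρ hρ' hr ht ht' (hsph hw')
      have h2 : HasDerivAt (fun s => conj (conjMap f f' ψ s (conj w)⁻¹))
          (conj (conjMapDot ρ ρ' f f' ψ t (conj w)⁻¹)) t := h1.star
      exact h2.fun_inv ((map_ne_zero _).2 (hF0 t htm _ hw'))
  · refine hasDerivAt_circleIntegral_param (G := fun s => conjMap f f' ψ s)
      (C := C) ha0.le ?_ (hk _ hz.1.ne') hDc hC fun w hw =>
        h.hasDerivAt_conjMap hρ hρ' hr ht ht' (hsph hw)
    filter_upwards [hIcc] with s hs using hFc s hs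

/-- The conformal distortion of the local energy at a regular time. -/
theorem localEnergy_sub (h : IsConjugation ρ ρ' f f' ψ U U')
    (hρ : ∫⁻ t in Icc (0 : ℝ) 1, ρ t univ ≠ ∞) (hρ' : ∫⁻ t in Icc (0 : ℝ) 1, ρ' t univ ≠ ∞)
    (hr : IsRadius f f' ψ U r) (hra : r < a) (ha : a < 1)
    (ht : IsRegularTime ρ f t) (ht' : IsRegularTime ρ' f' t) (hL : localEnergy (ρ t) ≠ ∞) :
    localEnergy (ρ' t) ≠ ∞ ∧
    (((localEnergy (ρ' t)).toReal - (localEnergy (ρ t)).toReal : ℝ) : ℂ)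
      = 1 / 4 * schwarzianIntegral (reflectExt (conjMap f f' ψ t) a) (ρ t)
        + 1 / 8 * (((ρ' t).real univ - (ρ t).real univ : ℝ) : ℂ) := by
  have htm := Ioo_subset_Icc_self ht.mem
  have hIcc := Icc_mem_nhds ht.mem.1 ht.mem.2
  have ha0 : 0 < a := hr.pos.trans hra
  have hsph := sphere_subset_annulus hra ha
  have := ht.finite
  have := ht'.finite
  have hE := h.isCircleMap hr hra ha htm
  obtain ⟨φ, q, p, p', hφ, hφE, hq, hS⟩ := hE.exists_lift
  obtain ⟨ν, hν⟩ := IsSqrtDensity.of_localEnergy_ne_top hL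
  obtain ⟨ν', hν'⟩ := hφ.exists_transport ν
  set E := reflectExt (conjMap f f' ψ t) a with hEdef
  set D := extDot (conjMap f f' ψ t) (conjMapDot ρ ρ' f f' ψ t) a with hDdef
  have hD : ∀ z ∈ annulus a a⁻¹, HasDerivAt (fun s => reflectExt (conjMap f f' ψ s) a z) (D z) t :=
    fun z hz => h.hasDerivAt_reflectExt_conjMap hρ hρ' hr hra ha ht ht' hz
  have hDc : ContinuousOn D (annulus a a⁻¹) :=
    continuousOn_extDot ha0
      (((h.differentiableOn_conjMap htm).mono (annulus_subset hr htm)).continuousOn.mono hsph)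
      (fun w hw => hr.ne_zero t htm w (hsph hw)) ((h.continuousOn_conjMapDot hr ht ht').mono hsph)
  refine IsCircleMap.localEnergy_sub hφ hS hν hν' (hE.eq_withDensity_transport hφ hφE hq hν hν'
    (J := fun z => D z / E z) (fun z hz => ?_) fun ζ hζ => ?_)
  · have hz' : z ∈ annulus a a⁻¹ := ⟨hz.1, hz.2.trans ((one_lt_inv₀ ha0).2 ha)⟩
    have hzr : z ∈ annulus r 1 := ⟨hra.trans hz.1, hz.2⟩
    -- Inside the disk the extension is ψ_s for all nearby s, so uniqueness of derivatives
    -- identifies D.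
    have hDz : D z = conjMapDot ρ ρ' f f' ψ t z := by
      refine (hD z hz').unique ((h.hasDerivAt_conjMap hρ hρ' hr ht ht' hzr).congr_of_eventuallyEq ?_)
      filter_upwards [hIcc] with s hs using h.reflectExt_conjMap hr hra hs hz
    have hEz : E z = conjMap f f' ψ t z := h.reflectExt_conjMap hr hra htm hz
    have hE' : deriv E z = deriv (conjMap f f' ψ t) z := by
      refine EventuallyEq.deriv_eq ?_
      filter_upwards [(isOpen_annulus a 1).mem_nhds hz] with w hw
        using h.reflectExt_conjMap hr hra htm hw
    have hE0 := hE.ne_zero z hz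
    rw [hDz, IsCircleMap.angularDeriv, hE', conjMapDot, ← hEz]
    field_simp
  · have hζ' : ζ ∈ annulus a a⁻¹ := hE.mem_annulus_of_norm hζ
    have hE0 := hE.ne_zero_of_norm hζ
    have hcont : ContinuousAt (fun z => (D z / E z).re) ζ :=
      Complex.continuous_re.continuousAt.comp
        ((hDc.continuousAt ((isOpen_annulus a a⁻¹).mem_nhds hζ')).div
          (hE.analyticAt hζ').continuousAt hE0)
    -- Differentiating |E|² = 1 in time at a point of the circle.
    have h0 : (D ζ / E ζ).re = 0 := by
      have h1 := (hD ζ hζ').norm_sq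
      have h2 : (fun s => ‖reflectExt (conjMap f f' ψ s) a ζ‖ ^ 2) =ᶠ[𝓝 t] fun _ => 1 := by
        filter_upwards [hIcc] with s hs
        rw [(h.isCircleMap hr hra ha hs).norm_eq ζ hζ, one_pow]
      have h3 := h1.unique ((hasDerivAt_const t (1 : ℝ)).congr_of_eventuallyEq h2)
      rw [← hEdef, Complex.inner] at h3
      have h4 : D ζ / E ζ = conj (E ζ) * D ζ := by
        rw [div_eq_iff hE0, mul_assoc, mul_comm (D ζ), ← mul_assoc, mul_comm (conj (E ζ)),
          Complex.mul_conj, Complex.normSq_eq_norm_sq, hE.norm_eq ζ hζ]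
        simp
      rw [h4, mul_comm]
      linarith
    have h5 := hcont.tendsto
    rw [h0] at h5
    exact h5.mono_left nhdsWithin_le_nhds

end IsConjugation

end LoewnerKufarev

/-! ### Fourier coefficients on a period -/

namespace LoewnerKufarev

open Filter Topology ComplexConjugate

/-- The unnormalized Fourier coefficients on `[0, 2π]`. -/
noncomputable def expCoeff (g : ℝ → ℂ) (n : ℤ) : ℂ :=
  ∫ x in (0 : ℝ)..(2 * Real.pi), Complex.exp (-(n * x * Complex.I)) * g x

theorem fourier_neg_coe (n : ℤ) (x : ℝ) :
    fourier (-n) (x : S1) = Complex.exp (-(n * x * Complex.I)) := by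
  rw [fourier_coe_apply]
  congr 1
  have : (Real.pi : ℂ) ≠ 0 := by exact_mod_cast Real.pi_ne_zero
  push_cast
  field_simp

theorem expCoeff_coe (f : S1 → ℂ) (n : ℤ) :
    expCoeff (fun x : ℝ => f x) n = (2 * Real.pi : ℝ) * fourierCoeff f n := by
  rw [fourierCoeff_eq_intervalIntegral f n 0, zero_add, Complex.real_smul, ← mul_assoc,
    ← Complex.ofReal_mul, mul_one_div_cancel Real.two_pi_pos.ne', Complex.ofReal_one, one_mul]
  simp only [fourier_neg_coe, smul_eq_mul, expCoeff]

theorem hasSum_sq_expCoeff {g : ℝ → ℂ} (hg : MemLp g 2 (volume.restrict (Ioc 0 (2 * Real.pi)))) :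
    HasSum (fun n => ‖expCoeff g n‖ ^ 2)
      (2 * Real.pi * ∫ x in (0 : ℝ)..(2 * Real.pi), ‖g x‖ ^ 2) := by
  have h := (hasSum_sq_fourierCoeffOn Real.two_pi_pos hg).mul_left ((2 * Real.pi) ^ 2)
  have e : ∀ n, (2 * Real.pi) ^ 2 * ‖fourierCoeffOn Real.two_pi_pos g n‖ ^ 2
      = ‖expCoeff g n‖ ^ 2 := fun n => by
    have e2 : fourierCoeffOn Real.two_pi_pos g n = (1 / (2 * Real.pi) : ℝ) • expCoeff g n := by
      rw [fourierCoeffOn_eq_integral, sub_zero, expCoeff]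
      congr 1
      refine intervalIntegral.integral_congr fun x _ => ?_
      simp only [smul_eq_mul]
      rw [fourier_coe_apply]
      congr 2
      have : (Real.pi : ℂ) ≠ 0 := by exact_mod_cast Real.pi_ne_zero
      push_cast
      field_simp
    rw [e2, norm_smul, Real.norm_eq_abs, abs_of_pos (by positivity)]
    field_simp
  simp only [e] at h
  have e3 : (2 * Real.pi) ^ 2 * ((2 * Real.pi - 0)⁻¹ • ∫ x in (0 : ℝ)..(2 * Real.pi), ‖g x‖ ^ 2)
      = 2 * Real.pi * ∫ x in (0 : ℝ)..(2 * Real.pi), ‖g x‖ ^ 2 := by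
    rw [sub_zero, smul_eq_mul]
    field_simp
  rwa [e3] at h

theorem ae_eq_of_expCoeff_eq {g k : ℝ → ℂ}
    (hg : MemLp g 2 (volume.restrict (Ioc 0 (2 * Real.pi))))
    (hk : MemLp k 2 (volume.restrict (Ioc 0 (2 * Real.pi))))
    (h : ∀ n, expCoeff g n = expCoeff k n) :
    g =ᵐ[volume.restrict (Ioc 0 (2 * Real.pi))] k := by
  have hint : ∀ {g : ℝ → ℂ}, MemLp g 2 (volume.restrict (Ioc 0 (2 * Real.pi))) → ∀ n : ℤ,
      IntervalIntegrable (fun x : ℝ => Complex.exp (-(n * x * Complex.I)) * g x) volume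
        0 (2 * Real.pi) := fun hg n => by
    have h1 := hg.integrable one_le_two
    rw [← IntegrableOn, ← intervalIntegrable_iff_integrableOn_Ioc_of_le Real.two_pi_pos.le] at h1
    exact h1.continuousOn_mul (by fun_prop)
  have h0 : ∀ n, expCoeff (g - k) n = 0 := fun n => by
    rw [← sub_eq_zero.2 (h n), expCoeff, expCoeff, expCoeff,
      ← intervalIntegral.integral_sub (hint hg n) (hint hk n)]
    simp only [Pi.sub_apply, mul_sub]
  have h1 := hasSum_sq_expCoeff (hg.sub hk)
  simp only [h0, norm_zero, ne_eq, OfNat.ofNat_ne_zero, not_false_eq_true, zero_pow] at h1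
  have h2 := h1.unique hasSum_zero
  have h3 : ∫ x in (0 : ℝ)..(2 * Real.pi), ‖(g - k) x‖ ^ 2 = 0 :=
    (mul_eq_zero.1 h2).resolve_left Real.two_pi_pos.ne'
  rw [intervalIntegral.integral_of_le Real.two_pi_pos.le, integral_eq_zero_iff_of_nonneg
    (fun x => sq_nonneg _) ((memLp_two_iff_integrable_sq_norm (hg.sub hk).1).1 (hg.sub hk))] at h3
  filter_upwards [h3] with x hx
  simpa [sub_eq_zero] using hx

/-- Riesz–Fischer through the Fourier Hilbert basis, adjusted to coefficients that are not divided
by 2π. -/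
theorem exists_expCoeff_eq {d : ℤ → ℂ} (hd : Summable fun n => ‖d n‖ ^ 2) :
    ∃ w : ℝ → ℂ, MemLp w 2 (volume.restrict (Ioc 0 (2 * Real.pi))) ∧ ∀ n, expCoeff w n = d n := by
  have hc : ((2 * Real.pi : ℝ) : ℂ) ≠ 0 := by exact_mod_cast Real.two_pi_pos.ne'
  have hmem : Memℓp (fun n => ((2 * Real.pi : ℝ) : ℂ)⁻¹ * d n) 2 := by
    refine memℓp_gen ?_
    refine (hd.mul_left (‖((2 * Real.pi : ℝ) : ℂ)⁻¹‖ ^ 2)).congr fun n => ?_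
    rw [norm_mul]
    simp [mul_pow]
  set f := (fourierBasis (T := 2 * Real.pi)).repr.symm ⟨_, hmem⟩ with hf
  have hcoef : ∀ n, fourierCoeff f n = ((2 * Real.pi : ℝ) : ℂ)⁻¹ * d n := fun n => by
    rw [← fourierBasis_repr, hf, LinearIsometryEquiv.apply_symm_apply]
  refine ⟨fun x => f (x : S1), ?_, fun n => ?_⟩
  · have h1 : MemLp f 2 (volume : Measure S1) := by
      rw [AddCircle.volume_eq_smul_haarAddCircle]
      exact (Lp.memLp f).smul_measure ENNReal.ofReal_ne_top
    have h2 := AddCircle.measurePreserving_mk (2 * Real.pi) 0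
    rw [zero_add] at h2
    exact h1.comp_measurePreserving h2
  · rw [expCoeff_coe, hcoef, mul_inv_cancel_left₀ hc]

theorem absolutelyContinuousOnInterval_integral {w : ℝ → ℂ} {a b : ℝ}
    (hw : IntervalIntegrable w volume a b) :
    AbsolutelyContinuousOnInterval (fun x => ∫ u in a..x, w u) a b := by
  refine absolutelyContinuousOnInterval_of_dist_le zero_le_one
    (hw.norm.absolutelyContinuousOnInterval_intervalIntegral left_mem_uIcc) fun x hx y hy => ?_
  have hx' := hw.mono_set (uIcc_subset_uIcc left_mem_uIcc hx)
  have hy' := hw.mono_set (uIcc_subset_uIcc left_mem_uIcc hy)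
  rw [dist_eq_norm, Real.dist_eq, one_mul, intervalIntegral.integral_interval_sub_left hx' hy',
    intervalIntegral.integral_interval_sub_left hx'.norm hy'.norm]
  exact intervalIntegral.norm_integral_le_abs_integral_norm

/-- Integration by parts for a complex-valued primitive: the product minus the integral of its
derivative is absolutely continuous with zero derivative almost everywhere, hence constant. -/
theorem expCoeff_add_integral {w g : ℝ → ℂ} (k : ℂ)
    (hw : IntervalIntegrable w volume 0 (2 * Real.pi))
    (hg : ∀ x ∈ Icc 0 (2 * Real.pi), g x = k + ∫ u in (0 : ℝ)..x, w u) (n : ℤ) :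
    expCoeff w n = g (2 * Real.pi) - g 0 + n * Complex.I * expCoeff g n := by
  have hI : uIcc 0 (2 * Real.pi) = Icc 0 (2 * Real.pi) := uIcc_of_le Real.two_pi_pos.le
  set e : ℝ → ℂ := fun x => Complex.exp (-(n * x * Complex.I)) with he
  have hed : ∀ x, HasDerivAt e (-(n * Complex.I) * e x) x := fun x => by
    have h1 : HasDerivAt (fun y : ℝ => -(n * (y : ℂ) * Complex.I)) (-(n * 1 * Complex.I)) x :=
      ((Complex.ofRealCLM.hasDerivAt.const_mul (n : ℂ)).mul_const Complex.I).neg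
    refine h1.cexp.congr_deriv ?_
    simp only [he]
    ring
  have hec : Continuous e := by fun_prop
  have hgac : AbsolutelyContinuousOnInterval g 0 (2 * Real.pi) := by
    refine absolutelyContinuousOnInterval_of_dist_le zero_le_one
      (absolutelyContinuousOnInterval_integral hw) fun x hx y hy => ?_
    rw [hg x (hI ▸ hx), hg y (hI ▸ hy), dist_add_left, one_mul]
  have heac : AbsolutelyContinuousOnInterval e 0 (2 * Real.pi) := by
    have : ContDiff ℝ 1 e := by
      exact ((contDiff_const.mul Complex.ofRealCLM.contDiff).mul contDiff_const).neg.cexp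
    exact this.contDiffOn.absolutelyContinuousOnInterval
  have heg : IntervalIntegrable (fun x => n * Complex.I * (e x * g x)) volume 0 (2 * Real.pi) :=
    (hec.continuousOn.mul hgac.continuousOn).intervalIntegrable.const_mul _
  have hi : IntervalIntegrable (fun x => e x * w x - n * Complex.I * (e x * g x)) volume 0
      (2 * Real.pi) := (hw.continuousOn_mul hec.continuousOn).sub
    heg
  have hprod : AbsolutelyContinuousOnInterval (fun x => e x • g x) 0 (2 * Real.pi) :=
    heac.smul hgac
  obtain ⟨C, hC⟩ := (hprod.sub (absolutelyContinuousOnInterval_integral hi)).const_of_ae_hasDerivAt_zero (by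
    have hne : ∀ᵐ x : ℝ, x ≠ 0 ∧ x ≠ 2 * Real.pi := by
      filter_upwards [Measure.ae_ne volume (0 : ℝ), Measure.ae_ne volume (2 * Real.pi)] with x h1 h2
      exact ⟨h1, h2⟩
    filter_upwards [hi.ae_hasDerivAt_integral, hw.ae_hasDerivAt_integral, hne] with x h1 h2 h3 hx
    have hx' : x ∈ Ioo 0 (2 * Real.pi) := by
      rw [hI] at hx
      exact ⟨lt_of_le_of_ne hx.1 h3.1.symm, lt_of_le_of_ne hx.2 h3.2⟩
    have hgd : HasDerivAt g (w x) x := by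
      refine ((h2 hx 0 left_mem_uIcc).const_add k).congr_of_eventuallyEq ?_
      filter_upwards [Ioo_mem_nhds hx'.1 hx'.2] with y hy using hg y (Ioo_subset_Icc_self hy)
    refine (((hed x).smul hgd).sub (h1 hx 0 left_mem_uIcc)).congr_deriv ?_
    simp only [smul_eq_mul]
    ring)
  have h0 := hC 0 left_mem_uIcc
  have h1 := hC (2 * Real.pi) right_mem_uIcc
  rw [← h0] at h1
  have e0 : e 0 = 1 := by simp [he]
  have e1 : e (2 * Real.pi) = 1 := by
    simp only [he]
    rw [Complex.exp_eq_one_iff]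
    exact ⟨-n, by push_cast; ring⟩
  simp only [Pi.sub_apply, intervalIntegral.integral_same, smul_eq_mul, e0, e1, one_mul, sub_zero]
    at h1
  rw [intervalIntegral.integral_sub (hw.continuousOn_mul hec.continuousOn)
    heg, intervalIntegral.integral_const_mul] at h1
  have h2 : expCoeff w n = ∫ x in (0 : ℝ)..(2 * Real.pi), e x * w x := rfl
  have h3 : expCoeff g n = ∫ x in (0 : ℝ)..(2 * Real.pi), e x * g x := rfl
  rw [← h2, ← h3] at h1
  linear_combination -h1

end LoewnerKufarev

/-! ### A measurable substitute for the local energy -/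

namespace LoewnerKufarev

open Filter Topology ComplexConjugate

/-- The square root of the density `u` in the angular coordinate. -/
noncomputable def sqrtDensity (u : S1 → ℝ≥0∞) (x : ℝ) : ℝ := √(u x).toReal

/-- The squared `W^{1,2}`-seminorm of the square root of the density `u`, on the Fourier side. -/
noncomputable def sobolevSum (u : S1 → ℝ≥0∞) : ℝ≥0∞ :=
  ∑' n : ℤ, ENNReal.ofReal (n ^ 2 * ‖expCoeff (fun x => (sqrtDensity u x : ℂ)) n‖ ^ 2)

theorem quasiMeasurePreserving_coe : Measure.QuasiMeasurePreserving (fun x : ℝ => (x : S1))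
    (volume.restrict (Ioc 0 (2 * Real.pi))) volume := by
  have := AddCircle.measurePreserving_mk (2 * Real.pi) 0
  rw [zero_add] at this
  exact this.quasiMeasurePreserving

theorem ae_of_ae_coe {p : S1 → Prop} (hp : MeasurableSet {θ | p θ})
    (h : ∀ᵐ x : ℝ ∂volume.restrict (Ioc 0 (2 * Real.pi)), p x) : ∀ᵐ θ : S1, p θ := by
  have h1 := AddCircle.measurePreserving_mk (2 * Real.pi) 0
  rw [zero_add] at h1
  rw [← h1.map_eq, ae_map_iff h1.measurable.aemeasurable hp]
  exact h

theorem expCoeff_congr_ae {g k : ℝ → ℂ} (h : g =ᵐ[volume.restrict (Ioc 0 (2 * Real.pi))] k)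
    (n : ℤ) : expCoeff g n = expCoeff k n := by
  refine intervalIntegral.integral_congr_ae_restrict ?_
  rw [uIoc_of_le Real.two_pi_pos.le]
  filter_upwards [h] with x hx
  rw [hx]

/-- Parseval for the derivative of the square-root density. It in fact gives equality, with 4π = 2π
· 2 from the coefficient normalization and the ½ in the energy. -/
theorem sobolevSum_le {u : S1 → ℝ≥0∞} (hu : Measurable u) {ν : S1 → ℝ}
    (hν : IsSqrtDensity (volume.withDensity u) ν) :
    sobolevSum u ≤ ENNReal.ofReal (4 * Real.pi) * localEnergy (volume.withDensity u) := by
  have hc := hν.continuous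
  have hae : u =ᵐ[volume] fun θ => ENNReal.ofReal (ν θ ^ 2) := by
    refine (withDensity_eq_iff_of_sigmaFinite hu.aemeasurable ?_).1 hν.density
    fun_prop
  have hV : (fun x => (sqrtDensity u x : ℂ)) =ᵐ[volume.restrict (Ioc 0 (2 * Real.pi))]
      fun x : ℝ => (ν x : ℂ) := by
    filter_upwards [quasiMeasurePreserving_coe.ae hae] with x hx
    rw [sqrtDensity, hx, ENNReal.toReal_ofReal (sq_nonneg _), Real.sqrt_sq (hν.nonneg _)]
  have hcoe := periodic_coe_S1 ν
  set w : ℝ → ℝ := deriv fun x : ℝ => ν x with hw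
  have hL2 : MemLp (fun x => (w x : ℂ)) 2 (volume.restrict (Ioc 0 (2 * Real.pi))) :=
    hν.sqIntegrable.ofReal
  have hwi : IntervalIntegrable (fun x => (w x : ℂ)) volume 0 (2 * Real.pi) := by
    rw [intervalIntegrable_iff_integrableOn_Ioc_of_le Real.two_pi_pos.le]
    exact hL2.integrable one_le_two
  have hcoef : ∀ n : ℤ, expCoeff (fun x => (w x : ℂ)) n
      = n * Complex.I * expCoeff (fun x => (sqrtDensity u x : ℂ)) n := fun n => by
    rw [expCoeff_congr_ae hV, expCoeff_add_integral (g := fun x : ℝ => (ν x : ℂ))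
      (ν (0 : ℝ) : ℂ) hwi (fun x _ => ?_) n]
    · have : ν ((2 * Real.pi : ℝ) : S1) = ν (0 : ℝ) := by
        have := hcoe 0
        simpa using this
      rw [this, sub_self, zero_add]
    · rw [eq_add_integral_deriv_of_periodic Real.two_pi_pos hcoe hν.absCont x,
        intervalIntegral.integral_ofReal]
      push_cast
      rfl
  have hsum := hasSum_sq_expCoeff hL2
  have e : ∀ n : ℤ, ‖expCoeff (fun x => (w x : ℂ)) n‖ ^ 2
      = n ^ 2 * ‖expCoeff (fun x => (sqrtDensity u x : ℂ)) n‖ ^ 2 := fun n => by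
    rw [hcoef, norm_mul, norm_mul, Complex.norm_I, mul_one, mul_pow, Complex.norm_intCast, sq_abs]
  simp only [e] at hsum
  rw [sobolevSum, ← ENNReal.ofReal_tsum_of_nonneg (fun n => by positivity) hsum.summable,
    hsum.tsum_eq]
  obtain ⟨h1, h2⟩ := hν.localEnergy_toReal
  rw [← ENNReal.ofReal_toReal h1, h2, ← ENNReal.ofReal_mul (by positivity)]
  refine ENNReal.ofReal_le_ofReal (le_of_eq ?_)
  have e2 : ∀ x, ‖(w x : ℂ)‖ ^ 2 = w x ^ 2 := fun x => by
    rw [Complex.norm_real, Real.norm_eq_abs, sq_abs]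
  simp only [e2]
  ring

/-- The summable coefficients in·V̂(n) belong to some w in L². A primitive of w with the right mean
has the Fourier coefficients of V, so it equals V almost everywhere and is the absolutely continuous
representative. -/
theorem localEnergy_ne_top_of_sobolevSum {u : S1 → ℝ≥0∞} (hu : Measurable u)
    (hfin : ∫⁻ θ, u θ ≠ ∞) (hS : sobolevSum u ≠ ∞) :
    localEnergy (volume.withDensity u) ≠ ∞ := by
  have hpi := Real.two_pi_pos
  have hI : uIcc 0 (2 * Real.pi) = Icc 0 (2 * Real.pi) := uIcc_of_le hpi.le
  set V : ℝ → ℝ := sqrtDensity u with hV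
  have hVm : Measurable V := by
    have : Measurable fun x : ℝ => (x : S1) := AddCircle.measurable_mk'
    change Measurable fun x : ℝ => √(u x).toReal
    fun_prop
  have htop : ∀ᵐ θ : S1, u θ < ∞ := ae_lt_top hu hfin
  have hVL : MemLp (fun x => (V x : ℂ)) 2 (volume.restrict (Ioc 0 (2 * Real.pi))) := by
    refine MemLp.ofReal ((memLp_two_iff_integrable_sq hVm.aestronglyMeasurable).2 ?_)
    have h1 : Integrable (fun θ => (u θ).toReal) :=
      integrable_toReal_of_lintegral_ne_top hu.aemeasurable hfin
    have h2 := AddCircle.measurePreserving_mk (2 * Real.pi) 0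
    rw [zero_add] at h2
    refine (h2.integrable_comp_of_integrable h1).congr (Eventually.of_forall fun x => ?_)
    simp only [Function.comp_apply, hV, sqrtDensity]
    rw [Real.sq_sqrt ENNReal.toReal_nonneg]
  have hsum : Summable fun n : ℤ => ‖n * Complex.I * expCoeff (fun x => (V x : ℂ)) n‖ ^ 2 := by
    have h1 := ENNReal.summable_toReal hS
    refine h1.congr fun n => ?_
    rw [ENNReal.toReal_ofReal (by positivity), norm_mul, norm_mul, Complex.norm_I, mul_one,
      mul_pow, Complex.norm_intCast, sq_abs]
  obtain ⟨w, hwL, hw⟩ := exists_expCoeff_eq hsum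
  have hwi : IntervalIntegrable w volume 0 (2 * Real.pi) := by
    rw [intervalIntegrable_iff_integrableOn_Ioc_of_le hpi.le]
    exact hwL.integrable one_le_two
  -- The coefficient of index 0 is zero, so the primitive of w is periodic.
  have hw0 : ∫ x in (0 : ℝ)..(2 * Real.pi), w x = 0 := by
    have := hw 0
    simpa [expCoeff] using this
  set W : ℝ → ℂ := fun x => ∫ y in (0 : ℝ)..x, w y with hWdef
  have hWac := absolutelyContinuousOnInterval_integral hwi
  have hWi : IntervalIntegrable W volume 0 (2 * Real.pi) := hWac.continuousOn.intervalIntegrable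
  -- The constant of integration is fixed by matching the zeroth coefficient, which the derivative
  -- does not see.
  set k : ℂ := ((2 * Real.pi : ℝ) : ℂ)⁻¹ * (expCoeff (fun x => (V x : ℂ)) 0 - expCoeff W 0) with hk
  set g : ℝ → ℂ := fun x => k + W x with hg
  have hgac : AbsolutelyContinuousOnInterval g 0 (2 * Real.pi) :=
    absolutelyContinuousOnInterval_of_dist_le zero_le_one hWac fun x _ y _ => by
      simp only [hg, dist_add_left, one_mul]
      rfl
  have hg0 : g (2 * Real.pi) = g 0 := by
    simp [hg, hWdef, hw0]
  have hgL : MemLp g 2 (volume.restrict (Ioc 0 (2 * Real.pi))) := by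
    obtain ⟨C, hC⟩ := hgac.exists_bound
    refine MemLp.of_bound ?_ C ?_
    · exact (hgac.continuousOn.mono (by rw [hI]; exact Ioc_subset_Icc_self)).aestronglyMeasurable
        measurableSet_Ioc
    · filter_upwards [ae_restrict_mem measurableSet_Ioc] with x hx
      exact hC x (by rw [hI]; exact Ioc_subset_Icc_self hx)
  have hgV : g =ᵐ[volume.restrict (Ioc 0 (2 * Real.pi))] fun x => (V x : ℂ) := by
    refine ae_eq_of_expCoeff_eq hgL hVL fun n => ?_
    rcases eq_or_ne n 0 with rfl | hn
    · have h1 : expCoeff g 0 = (2 * Real.pi : ℝ) * k + expCoeff W 0 := by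
        simp only [expCoeff, Int.cast_zero, zero_mul, neg_zero, Complex.exp_zero, one_mul, hg]
        rw [intervalIntegral.integral_add intervalIntegrable_const hWi,
          intervalIntegral.integral_const, sub_zero, Complex.real_smul]
      have hc : ((2 * Real.pi : ℝ) : ℂ) ≠ 0 := by exact_mod_cast hpi.ne'
      rw [h1, hk, mul_inv_cancel_left₀ hc]
      ring
    · have h1 := expCoeff_add_integral (g := g) k hwi (fun x _ => rfl) n
      rw [hg0, sub_self, zero_add, hw] at h1
      have hnI : (n : ℂ) * Complex.I ≠ 0 :=
        mul_ne_zero (by exact_mod_cast hn) Complex.I_ne_zero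
      exact (mul_left_cancel₀ hnI h1).symm
  set G : ℝ → ℝ := fun x => (g x).re with hG
  have hGac : AbsolutelyContinuousOnInterval G 0 (2 * Real.pi) :=
    absolutelyContinuousOnInterval_of_dist_le zero_le_one hgac fun x _ y _ => by
      rw [Real.dist_eq, ← Complex.sub_re, one_mul, dist_eq_norm]
      exact Complex.abs_re_le_norm _
  have hGc : ContinuousOn G (Icc 0 (2 * Real.pi)) := hI ▸ hGac.continuousOn
  have hGV : ∀ᵐ x ∂volume.restrict (Ioc 0 (2 * Real.pi)), G x = V x := by
    filter_upwards [hgV] with x hx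
    rw [hG]
    simp only [hx, Complex.ofReal_re]
  -- G is nonnegative almost everywhere, hence on a dense set, hence everywhere by continuity.
  have hG0 : ∀ x ∈ Icc 0 (2 * Real.pi), 0 ≤ G x := by
    have h1 : ∀ᵐ x ∂volume.restrict (Ioo 0 (2 * Real.pi)), 0 ≤ G x := by
      refine ae_restrict_of_ae_restrict_of_subset Ioo_subset_Ioc_self ?_
      filter_upwards [hGV] with x hx
      rw [hx]
      exact Real.sqrt_nonneg _
    have h2 : Icc 0 (2 * Real.pi) ⊆ closure (Ioo 0 (2 * Real.pi) ∩ {x | 0 ≤ G x}) := by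
      have h3 : Ioo 0 (2 * Real.pi) ⊆ closure (Ioo 0 (2 * Real.pi) ∩ {x | 0 ≤ G x}) := by
        intro x hx
        rw [_root_.mem_closure_iff]
        intro o ho hxo
        by_contra hne
        rw [not_nonempty_iff_eq_empty] at hne
        rw [ae_restrict_iff' measurableSet_Ioo] at h1
        have h4 : volume (o ∩ Ioo 0 (2 * Real.pi)) = 0 := by
          refine measure_mono_null (fun y hy => ?_) h1
          intro hcon
          have : y ∈ o ∩ (Ioo 0 (2 * Real.pi) ∩ {x | 0 ≤ G x}) := ⟨hy.1, hy.2, hcon hy.2⟩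
          rw [hne] at this
          exact this
        exact ((ho.inter isOpen_Ioo).measure_pos volume ⟨x, hxo, hx⟩).ne' h4
      have h4 := closure_mono h3
      rwa [closure_Ioo hpi.ne, closure_closure] at h4
    intro x hx
    have h5 : ContinuousWithinAt G (Ioo 0 (2 * Real.pi) ∩ {x | 0 ≤ G x}) x :=
      (hGc x hx).mono (inter_subset_left.trans Ioo_subset_Icc_self)
    have h6 := h5.mem_closure (h2 hx) (t := Ici 0) fun y hy => hy.2
    rwa [closure_Ici] at h6
  have hlift : ∃ ν : S1 → ℝ, ∀ x ∈ Icc 0 (2 * Real.pi), ν (x : ℝ) = G x := by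
    refine ⟨AddCircle.liftIco (2 * Real.pi) 0 G, fun x hx => ?_⟩
    rcases eq_or_lt_of_le hx.2 with h | h
    · have e1 : ((x : ℝ) : S1) = ((0 : ℝ) : S1) := by
        rw [h]
        simp
      rw [e1, AddCircle.liftIco_coe_apply ⟨le_rfl, by simpa using hpi⟩, h]
      simp only [hG, hg0]
    · exact AddCircle.liftIco_coe_apply ⟨hx.1, by simpa using h⟩
  obtain ⟨ν, hν⟩ := hlift
  have hacν : AbsolutelyContinuousOnInterval (fun x : ℝ => ν x) 0 (2 * Real.pi) :=
    absolutelyContinuousOnInterval_of_dist_le zero_le_one hGac fun x hx y hy => by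
      rw [hν x (hI ▸ hx), hν y (hI ▸ hy), one_mul]
  have hνc : Continuous ν := by
    refine continuous_of_continuous_coe (continuous_iff_continuousAt.2 fun x => ?_)
    refine ((absolutelyContinuousOnInterval_of_periodic hpi (periodic_coe_S1 ν) hacν
      (x - 1) (x + 1)).continuousOn).continuousAt ?_
    rw [uIcc_of_le (by linarith)]
    exact Icc_mem_nhds (by linarith) (by linarith)
  have hsq : IsSqrtDensity (volume.withDensity u) ν := by
    refine ⟨fun θ => ?_, hacν, ?_, withDensity_congr_ae ?_⟩
    · obtain ⟨x, hx, rfl⟩ : ∃ x ∈ Ico 0 (2 * Real.pi), (x : S1) = θ := by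
        have := AddCircle.coe_image_Ico_eq (2 * Real.pi) 0
        have h2 : θ ∈ (univ : Set S1) := mem_univ _
        rw [← this, zero_add] at h2
        exact h2
      rw [hν x (Ico_subset_Icc_self hx)]
      exact hG0 x (Ico_subset_Icc_self hx)
    · have hwre : MemLp (fun x => (w x).re) 2 (volume.restrict (Ioc 0 (2 * Real.pi))) := hwL.re
      refine hwre.ae_eq ?_
      have h1 := hwi.ae_hasDerivAt_integral
      rw [← restrict_Ioo_eq_restrict_Ioc, EventuallyEq, ae_restrict_iff' measurableSet_Ioo]
      filter_upwards [h1] with x h1 hx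
      have h2 := h1 (hI ▸ Ioo_subset_Icc_self hx) 0 left_mem_uIcc
      have h3 : HasDerivAt (fun y : ℝ => ν y) (w x).re x := by
        refine (Complex.reCLM.hasFDerivAt.comp_hasDerivAt x (h2.const_add k)).congr_of_eventuallyEq ?_
        filter_upwards [Ioo_mem_nhds hx.1 hx.2] with y hy
        exact hν y (Ioo_subset_Icc_self hy)
      exact h3.deriv.symm
    · refine ae_of_ae_coe (measurableSet_eq_fun hu (by fun_prop)) ?_
      filter_upwards [hGV, quasiMeasurePreserving_coe.ae htop, ae_restrict_mem measurableSet_Ioc]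
        with x h1 h2 h3
      rw [hν x (Ioc_subset_Icc_self h3), h1, hV, sqrtDensity, Real.sq_sqrt ENNReal.toReal_nonneg,
        ENNReal.ofReal_toReal h2.ne]
  exact hsq.localEnergy_toReal.1

/-- On the Fourier side each term is a function of an integral depending measurably on t, and the
sum is countable. -/
theorem measurable_sobolevSum {u : ℝ → S1 → ℝ≥0∞} (hu : Measurable (Function.uncurry u)) :
    Measurable fun t => sobolevSum (u t) := by
  refine Measurable.tsum fun n => ?_
  have h0 : Measurable fun x : ℝ => (x : S1) := AddCircle.measurable_mk'
  have h1 : StronglyMeasurable fun p : ℝ × ℝ =>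
      Complex.exp (-(n * p.2 * Complex.I)) * (sqrtDensity (u p.1) p.2 : ℂ) := by
    refine Measurable.stronglyMeasurable ?_
    have h2 : Measurable fun p : ℝ × ℝ => u p.1 (p.2 : S1) :=
      hu.comp (measurable_fst.prodMk (h0.comp measurable_snd))
    simp only [sqrtDensity]
    fun_prop
  have h2 : StronglyMeasurable fun t => expCoeff (fun x => (sqrtDensity (u t) x : ℂ)) n := by
    simp only [expCoeff, intervalIntegral.integral_of_le Real.two_pi_pos.le]
    exact h1.integral_prod_right'
  have h3 := h2.measurable
  fun_prop

/-- Finite energy gives finite local energy at almost every time. -/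
theorem ae_localEnergy_ne_top {ρ : Kernel ℝ S1} (hρ : ∀ t ∈ Icc (0 : ℝ) 1, IsProbabilityMeasure (ρ t))
    (hS : energy ρ ≠ ∞) : ∀ᵐ t ∂volume.restrict (Icc (0 : ℝ) 1), localEnergy (ρ t) ≠ ∞ := by
  classical
  -- Only the measures at times in [0, 1] are assumed to be probabilities. Changing the others to a
  -- point mass gives a Markov kernel, for which jointly measurable densities are available.
  set κ : Kernel ℝ S1 := Kernel.piecewise measurableSet_Icc ρ (Kernel.const ℝ (Measure.dirac 0))
    (s := Icc (0 : ℝ) 1) with hκ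
  have hκt : ∀ t ∈ Icc (0 : ℝ) 1, κ t = ρ t := fun t ht => by
    rw [hκ, Kernel.piecewise_apply, if_pos ht]
  have : IsMarkovKernel κ := ⟨fun t => by
    by_cases ht : t ∈ Icc (0 : ℝ) 1
    · rw [hκt t ht]
      exact hρ t ht
    · rw [hκ, Kernel.piecewise_apply, if_neg ht, Kernel.const_apply]
      infer_instance⟩
  set η : Kernel ℝ S1 := Kernel.const ℝ volume with hη
  set u := Kernel.rnDeriv κ η with hu
  have hum : Measurable (Function.uncurry u) := Kernel.measurable_rnDeriv κ η
  have hac := Kernel.measurableSet_absolutelyContinuous κ η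
  have hdens : ∀ t, κ t ≪ η t → κ t = volume.withDensity (u t) := fun t ht => by
    have h1 := congrArg (fun ξ : Kernel ℝ S1 => ξ t) (Kernel.rnDeriv_add_singularPart κ η)
    simp only [FunLike.coe_add, Pi.add_apply,
      (Kernel.singularPart_eq_zero_iff_absolutelyContinuous κ η t).2 ht, add_zero] at h1
    rw [← h1, Kernel.withDensity_apply _ hum]
    rfl
  -- Times with a singular part get the value ∞, consistently with infinite local energy, so S stays
  -- below a multiple of the local energy. Being measurable, S is finite almost everywhere once its
  -- integral is.
  set S : ℝ → ℝ≥0∞ := fun t => if κ t ≪ η t then sobolevSum (u t) else ∞ with hSdef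
  have hSm : Measurable S := Measurable.ite hac (measurable_sobolevSum hum) measurable_const
  have hle : ∀ t ∈ Icc (0 : ℝ) 1, S t ≤ ENNReal.ofReal (4 * Real.pi) * localEnergy (ρ t) := by
    intro t ht
    by_cases hL : localEnergy (ρ t) = ∞
    · rw [hL, ENNReal.mul_top (by simp [Real.pi_pos])]
      exact le_top
    · obtain ⟨ν, hν⟩ := IsSqrtDensity.of_localEnergy_ne_top hL
      have hact : κ t ≪ η t := by
        rw [hκt t ht, hν.density]
        exact withDensity_absolutelyContinuous _ _
      simp only [hSdef, if_pos hact]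
      rw [← hκt t ht, hdens t hact] at hν ⊢
      exact sobolevSum_le (hum.comp measurable_prodMk_left) hν
  have hfin : ∫⁻ t in Icc (0 : ℝ) 1, S t ≠ ∞ := by
    refine ne_top_of_le_ne_top (ENNReal.mul_ne_top (ENNReal.ofReal_ne_top (r := 4 * Real.pi)) hS) ?_
    rw [energy, ← lintegral_const_mul' _ _ ENNReal.ofReal_ne_top]
    exact setLIntegral_mono' measurableSet_Icc hle
  filter_upwards [ae_lt_top hSm hfin, ae_restrict_mem measurableSet_Icc] with t ht htm
  have hact : κ t ≪ η t := by
    by_contra hn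
    simp [hSdef, if_neg hn] at ht
  simp only [hSdef, if_pos hact] at ht
  have hd := hdens t hact
  rw [← hκt t htm, hd]
  refine localEnergy_ne_top_of_sobolevSum (hum.comp measurable_prodMk_left) ?_ ht.ne
  have h1 : κ t univ = ∫⁻ θ, u t θ := by
    rw [hd, withDensity_apply _ MeasurableSet.univ, Measure.restrict_univ]
  rw [← h1]
  exact measure_ne_top _ _

end LoewnerKufarev

/-! ### Integration over time -/

namespace LoewnerKufarev

open Filter Topology ComplexConjugate

open IsLoewnerChain (IsRegularTime)

/-- Neither L nor L' need be measurable. The identity is rewritten as L' + R⁻ = L + R⁺, and lower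
integrals are additive when one summand is measurable. -/
theorem lintegral_toReal_sub {α : Type*} [MeasurableSpace α] {μ : Measure α} {L L' : α → ℝ≥0∞}
    {R : α → ℝ} (hR : Integrable R μ) (hL : ∫⁻ t, L t ∂μ ≠ ∞)
    (h : ∀ᵐ t ∂μ, L t ≠ ∞ ∧ L' t ≠ ∞ ∧ (L' t).toReal - (L t).toReal = R t) :
    ∫⁻ t, L' t ∂μ ≠ ∞ ∧ (∫⁻ t, L' t ∂μ).toReal - (∫⁻ t, L t ∂μ).toReal = ∫ t, R t ∂μ := by
  have hpos : AEMeasurable (fun t => ENNReal.ofReal (R t)) μ := hR.1.aemeasurable.ennreal_ofReal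
  have hneg : AEMeasurable (fun t => ENNReal.ofReal (-R t)) μ :=
    hR.1.aemeasurable.neg.ennreal_ofReal
  have hpf : ∫⁻ t, ENNReal.ofReal (R t) ∂μ ≠ ∞ := hR.lintegral_lt_top.ne
  have hnf : ∫⁻ t, ENNReal.ofReal (-R t) ∂μ ≠ ∞ := hR.neg.lintegral_lt_top.ne
  have e : ∫⁻ t, L' t ∂μ + ∫⁻ t, ENNReal.ofReal (-R t) ∂μ
      = ∫⁻ t, L t ∂μ + ∫⁻ t, ENNReal.ofReal (R t) ∂μ := by
    rw [← lintegral_add_right' _ hneg, ← lintegral_add_right' _ hpos]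
    refine lintegral_congr_ae ?_
    filter_upwards [h] with t ⟨h1, h2, h3⟩
    rw [← ENNReal.toReal_eq_toReal_iff' (by finiteness) (by finiteness),
      ENNReal.toReal_add h2 (by finiteness), ENNReal.toReal_add h1 (by finiteness),
      ENNReal.toReal_ofReal', ENNReal.toReal_ofReal']
    rcases le_total 0 (R t) with h0 | h0
    · rw [max_eq_left h0, max_eq_right (by linarith)]
      linarith
    · rw [max_eq_right h0, max_eq_left (by linarith)]
      linarith
  have hL' : ∫⁻ t, L' t ∂μ ≠ ∞ := by
    refine ne_top_of_le_ne_top (ENNReal.add_ne_top.2 ⟨hL, hpf⟩) (le_self_add.trans e.le)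
  refine ⟨hL', ?_⟩
  have e2 := congrArg ENNReal.toReal e
  rw [ENNReal.toReal_add hL' hnf, ENNReal.toReal_add hL hpf] at e2
  rw [integral_eq_lintegral_pos_part_sub_lintegral_neg_part hR]
  linarith

theorem schwarzian_congr {E E' : ℂ → ℂ} {z : ℂ} (h : E =ᶠ[𝓝 z] E') :
    schwarzian E z = schwarzian E' z := by
  have h1 := h.deriv
  have h2 := h1.deriv
  have h3 : (fun w => deriv (deriv E) w / deriv E w) =ᶠ[𝓝 z]
      fun w => deriv (deriv E') w / deriv E' w := by
    filter_upwards [h1, h2] with w e1 e2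
    rw [e1, e2]
  rw [schwarzian, schwarzian, h3.deriv_eq, h1.eq_of_nhds, h2.eq_of_nhds]

/-- Clamping time to [0, 1] extends k continuously to all times and makes the kernel Markov, so the
integral is measurable in t and bounded by the maximum of |k|. -/
theorem intervalIntegrable_integral_kernel {ρ : Kernel ℝ S1}
    (hρ : ∀ t ∈ Icc (0 : ℝ) 1, IsProbabilityMeasure (ρ t)) {k : Icc (0 : ℝ) 1 × S1 → ℂ}
    (hk : Continuous k) {H : ℝ → ℂ} (hH : ∀ t : Icc (0 : ℝ) 1, H t = ∫ θ, k (t, θ) ∂ρ t) :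
    IntervalIntegrable H volume 0 1 := by
  set pr : ℝ → Icc (0 : ℝ) 1 := projIcc 0 1 zero_le_one with hpr
  have hprc : Continuous pr := continuous_projIcc
  set κ : Kernel ℝ S1 := ρ.comap (fun t => (pr t : ℝ)) (by fun_prop) with hκ
  have hm : IsMarkovKernel κ := ⟨fun t => by
    rw [hκ, Kernel.comap_apply]
    exact hρ _ (pr t).2⟩
  obtain ⟨C, hC⟩ := isCompact_univ.exists_bound_of_continuousOn hk.continuousOn
  have h1 : StronglyMeasurable fun t => ∫ θ, k (pr t, θ) ∂κ t := by
    have : StronglyMeasurable fun p : ℝ × S1 => k (pr p.1, p.2) :=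
      Continuous.stronglyMeasurable (by fun_prop)
    exact this.integral_kernel_prod_right'
  have h2 : IntervalIntegrable (fun t => ∫ θ, k (pr t, θ) ∂κ t) volume 0 1 := by
    rw [intervalIntegrable_iff_integrableOn_Icc_of_le zero_le_one]
    refine Integrable.of_bound h1.aestronglyMeasurable C (Eventually.of_forall fun t => ?_)
    have h3 := norm_integral_le_of_norm_le_const (μ := κ t) (f := fun θ => k (pr t, θ))
      (Eventually.of_forall fun θ => hC (pr t, θ) (mem_univ _))
    simpa using h3
  refine h2.congr fun t ht => ?_
  rw [uIoc_of_le zero_le_one] at ht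
  have ht' := Ioc_subset_Icc_self ht
  have e : pr t = ⟨t, ht'⟩ := projIcc_of_mem _ ht'
  simp only [hκ, Kernel.comap_apply, e]
  exact (hH ⟨t, ht'⟩).symm

namespace IsConjugation

variable {ρ ρ' : Kernel ℝ S1} {f f' : ℝ → ℂ → ℂ} {ψ : ℂ → ℂ} {U U' : Set ℂ} {t r a : ℝ} {z : ℂ}

open Classical in
/-- The extension of the conjugated map across the circle. -/
noncomputable def extension (f f' : ℝ → ℂ → ℂ) (ψ : ℂ → ℂ) (U : Set ℂ) (a t : ℝ) (z : ℂ) : ℂ :=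
  if z ∈ ball (0 : ℂ) 1 ∧ f t z ∈ U then conjMap f f' ψ t z else reflectExt (conjMap f f' ψ t) a z

/-- The conjugated map may be defined further inside than the reflection formula reaches; the two
branches agree wherever both apply, so near the circle the glued map is the reflected one. -/
theorem extension_eq (h : IsConjugation ρ ρ' f f' ψ U U') (hr : IsRadius f f' ψ U r)
    (hra : r < a) (ht : t ∈ Icc (0 : ℝ) 1) (hz : z ∈ annulus a a⁻¹) :
    extension f f' ψ U a t z = reflectExt (conjMap f f' ψ t) a z := by
  rw [extension]
  split_ifs with hzU
  · exact (h.reflectExt_conjMap hr hra ht ⟨hz.1, mem_ball_zero_iff.1 hzU.1⟩).symm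
  · rfl

theorem extension_eventuallyEq (h : IsConjugation ρ ρ' f f' ψ U U') (hr : IsRadius f f' ψ U r)
    (hra : r < a) (ht : t ∈ Icc (0 : ℝ) 1) (hz : z ∈ annulus a a⁻¹) :
    extension f f' ψ U a t =ᶠ[𝓝 z] reflectExt (conjMap f f' ψ t) a := by
  filter_upwards [(isOpen_annulus a a⁻¹).mem_nhds hz] with w hw using h.extension_eq hr hra ht hw

theorem isConjugatedExtension (h : IsConjugation ρ ρ' f f' ψ U U') (hr : IsRadius f f' ψ U r)
    (hra : r < a) (ha : a < 1) (ht : t ∈ Icc (0 : ℝ) 1) :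
    IsConjugatedExtension f f' ψ U t (extension f f' ψ U a t) := by
  have hE := h.isCircleMap hr hra ha ht
  have hev : ∀ z ∈ sphere (0 : ℂ) 1,
      extension f f' ψ U a t =ᶠ[𝓝 z] reflectExt (conjMap f f' ψ t) a := fun z hz =>
    h.extension_eventuallyEq hr hra ht (hE.mem_annulus_of_norm (mem_sphere_zero_iff_norm.1 hz))
  refine ⟨fun z hz hzU => ?_, fun z hz => ?_, fun z hz => ?_⟩
  · rw [extension, if_pos ⟨hz, hzU⟩, conjMap]
  · exact (hE.analyticAt (hE.mem_annulus_of_norm (mem_sphere_zero_iff_norm.1 hz))).congr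
      (hev z hz).symm
  · rw [(hev z hz).deriv_eq]
    exact hE.deriv_ne_zero (mem_sphere_zero_iff_norm.1 hz)

theorem schwarzianIntegral_extension (h : IsConjugation ρ ρ' f f' ψ U U')
    (hr : IsRadius f f' ψ U r) (hra : r < a) (ha : a < 1) (ht : t ∈ Icc (0 : ℝ) 1)
    (σ : Measure S1) : schwarzianIntegral (extension f f' ψ U a t) σ
      = schwarzianIntegral (reflectExt (conjMap f f' ψ t) a) σ := by
  have hE := h.isCircleMap hr hra ha ht
  refine integral_congr_ae (Eventually.of_forall fun θ => ?_)
  simp only [schwarzian_congr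
    (h.extension_eventuallyEq hr hra ht (hE.mem_annulus_of_norm (norm_expI θ)))]

end IsConjugation

end LoewnerKufarev

theorem theorem1p6
    -- the measure `ρ_t(dθ) dt`, given by its disintegration into probability measures
    (ρ : Kernel ℝ LoewnerKufarev.S1) (hρ : ∀ t ∈ Icc (0 : ℝ) 1, IsProbabilityMeasure (ρ t))
    (hS : LoewnerKufarev.energy ρ ≠ ∞)
    (f : ℝ → ℂ → ℂ) (hf : LoewnerKufarev.IsLoewnerChain ρ f)
    -- the conformal map near the hull at time one
    (ψ : ℂ → ℂ) (U U' : Set ℂ) (hψ : LoewnerKufarev.IsConformalMap ψ U U')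
    (hU : LoewnerKufarev.hull f 1 ⊆ U)
    -- the finite measure `ρ'_t(dθ) dt` on `S¹ × [0,1]` that generates the image hulls
    (ρ' : Kernel ℝ LoewnerKufarev.S1) (hρ' : ∫⁻ t in Icc (0 : ℝ) 1, ρ' t univ ≠ ∞)
    (f' : ℝ → ℂ → ℂ) (hf' : LoewnerKufarev.IsLoewnerChain ρ' f')
    (hhull : ∀ t ∈ Icc (0 : ℝ) 1,
      LoewnerKufarev.hull f' t = ψ '' LoewnerKufarev.hull f t) :
    LoewnerKufarev.energy ρ' ≠ ∞ ∧
    ∃ Ψ : ℝ → ℂ → ℂ,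
      (∀ t ∈ Icc (0 : ℝ) 1, LoewnerKufarev.IsConjugatedExtension f f' ψ U t (Ψ t)) ∧
      (∀ᵐ t ∂(volume.restrict (Icc (0 : ℝ) 1)),
        LoewnerKufarev.localEnergy (ρ t) ≠ ∞ ∧ LoewnerKufarev.localEnergy (ρ' t) ≠ ∞ ∧
        (((LoewnerKufarev.localEnergy (ρ' t)).toReal
            - (LoewnerKufarev.localEnergy (ρ t)).toReal : ℝ) : ℂ)
          = 1 / 4 * LoewnerKufarev.schwarzianIntegral (Ψ t) (ρ t)
            + 1 / 8 * (((ρ' t).real univ - (ρ t).real univ : ℝ) : ℂ)) ∧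
      IntervalIntegrable (fun t => LoewnerKufarev.schwarzianIntegral (Ψ t) (ρ t)) volume 0 1 ∧
      (((LoewnerKufarev.energy ρ').toReal - (LoewnerKufarev.energy ρ).toReal : ℝ) : ℂ)
        = 1 / 4 * (∫ t in (0 : ℝ)..1, LoewnerKufarev.schwarzianIntegral (Ψ t) (ρ t))
          + 1 / 8 * ((Real.log (deriv (LoewnerKufarev.uniformizing f' 1) 0).re
              - Real.log (deriv (LoewnerKufarev.uniformizing f 1) 0).re : ℝ) : ℂ) := by
  -- Probability measures have total mass 1 over [0, 1], so all finite-mass results on chains apply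
  -- to ρ as well.
  have hρ1 : ∫⁻ t in Icc (0 : ℝ) 1, ρ t univ ≠ ∞ := by
    have e : ∫⁻ t in Icc (0 : ℝ) 1, ρ t univ = ∫⁻ t in Icc (0 : ℝ) 1, 1 :=
      setLIntegral_congr_fun measurableSet_Icc fun t ht => by
        have := hρ t ht
        exact measure_univ
    rw [e]
    simp
  have h : LoewnerKufarev.IsConjugation ρ ρ' f f' ψ U U' := ⟨hf, hf', hψ, hU, hhull⟩
  obtain ⟨r, hr⟩ := h.exists_isRadius
  obtain ⟨a, hra, ha⟩ := exists_between hr.lt_one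
  set Ψ := LoewnerKufarev.IsConjugation.extension f f' ψ U a with hΨ
  have hint := LoewnerKufarev.intervalIntegrable_integral_kernel hρ
    (h.continuous_schwarzian_reflectExt hρ' hr hra ha)
    (H := fun t => LoewnerKufarev.schwarzianIntegral (Ψ t) (ρ t))
    fun t => h.schwarzianIntegral_extension hr hra ha t.2 (ρ t)
  have hae : ∀ᵐ t ∂(volume.restrict (Icc (0 : ℝ) 1)),
      LoewnerKufarev.localEnergy (ρ t) ≠ ∞ ∧ LoewnerKufarev.localEnergy (ρ' t) ≠ ∞ ∧
      (((LoewnerKufarev.localEnergy (ρ' t)).toReal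
          - (LoewnerKufarev.localEnergy (ρ t)).toReal : ℝ) : ℂ)
        = 1 / 4 * LoewnerKufarev.schwarzianIntegral (Ψ t) (ρ t)
          + 1 / 8 * (((ρ' t).real univ - (ρ t).real univ : ℝ) : ℂ) := by
    filter_upwards [LoewnerKufarev.ae_localEnergy_ne_top hρ hS, hf.ae_isRegularTime hρ1,
      hf'.ae_isRegularTime hρ'] with t hL ht ht'
    rw [hΨ, h.schwarzianIntegral_extension hr hra ha (Ioo_subset_Icc_self ht.mem)]
    exact ⟨hL, h.localEnergy_sub hρ1 hρ' hr hra ha ht ht' hL⟩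
  have hm := LoewnerKufarev.intervalIntegrable_real_univ hρ1
  have hm' := LoewnerKufarev.intervalIntegrable_real_univ hρ'
  set Q : ℝ → ℂ := fun t => 1 / 4 * LoewnerKufarev.schwarzianIntegral (Ψ t) (ρ t)
    + 1 / 8 * (((ρ' t).real univ - (ρ t).real univ : ℝ) : ℂ) with hQ
  have hmm : IntervalIntegrable (fun t => (((ρ' t).real univ - (ρ t).real univ : ℝ) : ℂ))
      volume 0 1 := ⟨(hm'.sub hm).1.ofReal, (hm'.sub hm).2.ofReal⟩
  have hQi : IntervalIntegrable Q volume 0 1 := (hint.const_mul _).add (hmm.const_mul _)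
  have hQI : IntegrableOn Q (Icc 0 1) :=
    (intervalIntegrable_iff_integrableOn_Icc_of_le zero_le_one).1 hQi
  obtain ⟨hfin, hsub⟩ := LoewnerKufarev.lintegral_toReal_sub (R := fun t => (Q t).re) hQI.re hS (by
    filter_upwards [hae] with t ⟨h1, h2, h3⟩
    exact ⟨h1, h2, by rw [hQ]; simp only [← h3, Complex.ofReal_re]⟩)
  refine ⟨hfin, Ψ, fun t ht => h.isConjugatedExtension hr hra ha ht, hae, hint, ?_⟩
  -- Q is complex-valued by form, but it equals a real difference of energies at almost every time.
  have e1 : ((∫ t in Icc (0 : ℝ) 1, (Q t).re : ℝ) : ℂ) = ∫ t in Icc (0 : ℝ) 1, Q t := by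
    rw [← integral_complex_ofReal]
    refine integral_congr_ae ?_
    filter_upwards [hae] with t ⟨_, _, h3⟩
    rw [hQ]
    simp only [← h3, Complex.ofReal_re]
  have e2 : ∫ t in Icc (0 : ℝ) 1, Q t = ∫ t in (0 : ℝ)..1, Q t := by
    rw [intervalIntegral.integral_of_le zero_le_one, integral_Icc_eq_integral_Ioc]
  rw [LoewnerKufarev.energy, LoewnerKufarev.energy, hsub, e1, e2, hQ,
    intervalIntegral.integral_add (hint.const_mul _) (hmm.const_mul _),
    intervalIntegral.integral_const_mul, intervalIntegral.integral_const_mul,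
    intervalIntegral.integral_ofReal, intervalIntegral.integral_sub hm' hm,
    hf.log_deriv_uniformizing_zero hρ1, hf'.log_deriv_uniformizing_zero hρ']
  rfl
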